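/- Let $\mu$ range over finite Borel measures on $(0,\infty)$, and put $r_\mu := \inf\{r : \mu(r,\infty)=0\}\in(0,\infty]$. For $0<\rho\le\infty$ let $H_\rho$ be the set of analytic functions on $\{|z|<\rho\}$. For an analytic $f$ let $Z(f)$ be its multiset of zeros, with multiplicities, and let $Z_s(f)$ be the multiset of its zeros $z$ with $0<|z|<s$; inclusions are inclusions of multisets. Put $$\|f\|_{A^p(\mu,s)} := \Bigl(\int_0^s\int_0^1 |f(re^{2\pi i\theta})|^p\,d\theta\,d\mu(r)\Bigr)^{1/p}\in[0,\infty],$$ where $\int_0^s$ is the integral over $(0,s]$ (over $(0,\infty)$ if $s=\infty$). Theorem. Let $a_n\ge 0$ satisfy $R^{-1}:=\limsup_{n\to\infty}a_n^{1/n}<\infty$ and $a_0\neq 0$. Let $\zeta_n$ be independent standard complex Gaussian random variables (density $e^{-|z|^2}/\pi$), and let $F(z):=\sum_{n\ge 0}a_n\zeta_n z^n$ for $|z|<R$. Let $\mu$ be a finite measure on $(0,\infty)$ with $r_\mu=R$ and $\mu(\{R\})=0$, let $p\in(0,\infty)$ and $s\in(0,R]$. Put $$M_s := \sup\Bigl\{\frac{|f(0)|}{\|f\|_{A^p(\mu,s)}}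 : 0\not\equiv f\in H_R,\ Z(f)\supset Z_s(F)\Bigr\}\in[0,\infty],$$ where a quotient is $0$ if its denominator is $\infty$ or its numerator is $0$, and is $\infty$ if only its denominator is $0$. Then $M_s$ is measurable (off a null set), and, with $\|a^{(r)}\|_2:=\bigl(\sum_n a_n^2r^{2n}\bigr)^{1/2}$, $$\mathbf E[M_s]\ \le\ \frac{\sqrt{\pi}\,a_0}{\bigl(\int_0^s\|a^{(r)}\|_2^p\,d\mu(r)\bigr)^{1/p}},$$ the right-hand side being $0$ if the integral is infinite and $\infty$ if it is $0$. If $s=R$, then almost surely the supremum $M_R$ is attained, that is, it is a maximum. More generally, if $s\in(0,R]$ is such that $\mu(\{s\})=0$ and $\mu((t,s])>0$ for all $0<t<s$, then almost surely $$M_s=\max\Bigl\{\frac{|f(0)|}{\|f\|_{A^p(\mu,s)}} : 0\not\equiv f\in H_s,\ Z(f)\supset Z_s(F)\Bigr\},$$ the maximum being attained. -/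

import Mathlib

open MeasureTheory ProbabilityTheory Filter
open scoped ENNReal

namespace GAF

/-- The law of a standard complex Gaussian random variable: density `exp (-|z|^2) / π` with
respect to Lebesgue measure on the complex plane. -/
noncomputable def stdComplexGaussian : Measure ℂ :=
  (volume : Measure ℂ).withDensity fun z => ENNReal.ofReal (Real.exp (-‖z‖ ^ 2) / Real.pi)

/-- The open disc `{z | |z| < ρ}`, where `ρ` may be infinite. -/
def disc (ρ : ℝ≥0∞) : Set ℂ := {z | ‖z‖ₑ < ρ}

/-- The radii over which `∫_0^s` runs: `(0, s]`, or `(0, ∞)` if `s = ∞`. -/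
def radii (s : ℝ≥0∞) : Set ℝ := {r | 0 < r ∧ ENNReal.ofReal r ≤ s}

/-- `r_μ = inf {ρ | μ (ρ, ∞) = 0}` in `[0, ∞]`. -/
noncomputable def outerRadius (μ : Measure ℝ) : ℝ≥0∞ :=
  sInf {ρ : ℝ≥0∞ | μ {r : ℝ | ρ < ENNReal.ofReal r} = 0}

/-- The (quasi-)norm `(∫_0^s ∫_0^1 |f (r e^{2πiθ})|^p dθ dμ(r))^{1/p}`, with value in `[0, ∞]`. -/
noncomputable def normA (μ : Measure ℝ) (p : ℝ) (s : ℝ≥0∞) (f : ℂ → ℂ) : ℝ≥0∞ :=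
  (∫⁻ r in radii s, ∫⁻ θ in Set.Icc (0 : ℝ) 1,
    ‖f ((r : ℂ) * Complex.exp (2 * (Real.pi : ℂ) * Complex.I * (θ : ℂ)))‖ₑ ^ p ∂volume ∂μ) ^ (1 / p)

/-- `‖(a_n r^n)_n‖_2`, with value in `[0, ∞]`. -/
noncomputable def coeffNorm (a : ℕ → ℝ) (r : ℝ) : ℝ≥0∞ :=
  (∑' n : ℕ, ENNReal.ofReal (a n * r ^ n) ^ 2) ^ (1 / 2 : ℝ)

/-- The random power series `F(z) = ∑ a_n ζ_n z^n` at one sample point: `c n` is the value of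
`ζ_n`. -/
noncomputable def gaf (a : ℕ → ℝ) (c : ℕ → ℂ) (z : ℂ) : ℂ :=
  ∑' n : ℕ, (a n : ℂ) * c n * z ^ n

/-- `f` vanishes on the multiset `Z_s(g)` of the zeros `z` of `g` with `0 < |z| < s`, with at least
the same multiplicities. -/
def VanishesOnZeros (s : ℝ≥0∞) (g f : ℂ → ℂ) : Prop :=
  ∀ z ∈ disc s, z ≠ 0 → analyticOrderAt g z ≤ analyticOrderAt f z

/-- `f` is analytic on `{|z| < ρ}`, is not identically zero there, and vanishes on `Z_s(g)`. -/
structure Competitor (ρ s : ℝ≥0∞) (g f : ℂ → ℂ) : Prop where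
  analytic : AnalyticOnNhd ℂ f (disc ρ)
  not_identically_zero : ∃ z ∈ disc ρ, f z ≠ 0
  vanishes : VanishesOnZeros s g f

/-- The set of the ratios `|f(0)| / ‖f‖_{A^p(μ,s)}` in `[0, ∞]`, where `f` runs over the nonzero
analytic functions on `{|z| < ρ}` that vanish on `Z_s(g)`. A ratio is `0` if the norm is infinite;
`x / 0` is `∞` for `x ≠ 0`, and a zero norm occurs only if `μ (0, s] = 0`. -/
def ratios (μ : Measure ℝ) (p : ℝ) (ρ s : ℝ≥0∞) (g : ℂ → ℂ) : Set ℝ≥0∞ :=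
  {x | ∃ f : ℂ → ℂ, Competitor ρ s g f ∧ x = ‖f 0‖ₑ / normA μ p s f}

end GAF

namespace GAF

open Set Metric Topology

/-! ### Discs, circles and circular means -/

/-! The bound. If `f` vanishes on the zeros of `F`, Jensen's formula on the circle of radius `r`
says that the mean of `log |f|` exceeds `log |f 0|` by at least as much as the mean of `log |F|`
exceeds `log |F 0|`. Convexity of the exponential turns this into `|f 0| / |F 0| ≤ (mean
|f|^p)^{1/p} · mean (1 / |F|)` (`enorm_div_le_circMean_mul`). With a weight `b r` and Hölder's
inequality in `r`, the ratio of `f` is at most a quantity that involves `F` but not `f`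
(`ratio_le_of_weight`), so the supremum obeys the same bound. Expectations can now be taken inside:
`F 0` and `F z` are jointly Gaussian, and a unitary change of variables gives `E (|F 0| / |F z|) ≤
√π a₀ / ‖a^{(|z|)}‖₂` (`lintegral_enorm_div_gaussian_le`). The weight `b r = ‖a^{(r)}‖₂` then gives
exactly the constant claimed. This works for `s < R`; the case `s = R` follows by letting radii
increase to `R`.

Attainment. A maximizing sequence is normalized by `f 0 = 1`, so its norms are bounded. Since the
means of `|f|^p` increase with the radius (`circMean_mono`) and every annulus at the boundary has
mass, the functions are locally bounded. Montel's theorem gives a limit; it keeps the zeros, and by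
Fatou's lemma its norm is no larger (`exists_mem_ratios_of_tendsto`). Allowing zero conditions and
norms on growing discs in this argument also shows that the supremum for `R` is the infimum of those
for radii below `R`.

Measurability and the change of disc. Given the other coefficients, a zero on a fixed circle
confines `ζ 0` to a null curve, so almost surely `F` has no zeros there (`ae_gaf_ne_zero`). For a
competitor `f` on a larger disc, `f / F` is then analytic beyond the closed disc and is a uniform
limit of polynomials; the supremum is one over countably many polynomial multiples of `F`
(`sSup_ratios_eq_polySup`). If `f` is analytic only on the open disc, dilating `f / F` first leads
to the same countable supremum (`ratio_le_polySup_of_ne`), so both classes of functions give the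
same value. -/

theorem disc_eq_eball (ρ : ℝ≥0∞) : disc ρ = eball (0 : ℂ) ρ := by
  ext z; simp [disc]

theorem isOpen_disc (ρ : ℝ≥0∞) : IsOpen (disc ρ) := by
  rw [disc_eq_eball]; exact isOpen_eball

theorem mem_disc {z : ℂ} {ρ : ℝ≥0∞} : z ∈ disc ρ ↔ ENNReal.ofReal ‖z‖ < ρ := by
  rw [ofReal_norm]; rfl

theorem disc_mono {ρ σ : ℝ≥0∞} (h : ρ ≤ σ) : disc ρ ⊆ disc σ := fun _ hz => lt_of_lt_of_le hz h

theorem zero_mem_disc {ρ : ℝ≥0∞} (h : 0 < ρ) : (0 : ℂ) ∈ disc ρ := by simpa [disc] using h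

theorem closedBall_subset_disc {t : ℝ} {ρ : ℝ≥0∞} (h : ENNReal.ofReal t < ρ) :
    closedBall (0 : ℂ) t ⊆ disc ρ := fun z hz =>
  mem_disc.2 ((ENNReal.ofReal_le_ofReal (by simpa using hz)).trans_lt h)

theorem isPreconnected_disc (ρ : ℝ≥0∞) : IsPreconnected (disc ρ) := by
  refine isPreconnected_of_forall 0 fun z hz => ?_
  refine ⟨closedBall 0 ‖z‖, closedBall_subset_disc (mem_disc.1 hz), by simp, by simp, ?_⟩
  exact (convex_closedBall _ _).isPreconnected

theorem measurableSet_radii (s : ℝ≥0∞) : MeasurableSet (radii s) :=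
  (measurableSet_lt measurable_const measurable_id).inter
    (measurableSet_le ENNReal.measurable_ofReal measurable_const)

/-- The point `r e^{2πiθ}`. -/
noncomputable def circlePoint (r θ : ℝ) : ℂ :=
  (r : ℂ) * Complex.exp (2 * (Real.pi : ℂ) * Complex.I * (θ : ℂ))

theorem norm_exp_two_pi_mul (θ : ℝ) :
    ‖Complex.exp (2 * (Real.pi : ℂ) * Complex.I * (θ : ℂ))‖ = 1 := by
  have := Complex.norm_exp_ofReal_mul_I (2 * Real.pi * θ)
  rw [← this]; congr 2; push_cast; ring

theorem norm_circlePoint (r θ : ℝ) : ‖circlePoint r θ‖ = |r| := by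
  simp [circlePoint, norm_exp_two_pi_mul]

theorem continuous_circlePoint : Continuous fun x : ℝ × ℝ => circlePoint x.1 x.2 := by
  unfold circlePoint; fun_prop

theorem circleMap_eq_add_circlePoint (c : ℂ) (r θ : ℝ) :
    circleMap c r (2 * Real.pi * θ) = c + circlePoint r θ := by
  simp only [circleMap, circlePoint]; congr 3; push_cast; ring

theorem circlePoint_add (r θ φ : ℝ) :
    circlePoint r (θ + φ) = circlePoint 1 φ * circlePoint r θ := by
  simp only [circlePoint]
  push_cast
  rw [mul_add, Complex.exp_add]; ring

/-- Lebesgue measure on the unit interval. -/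
noncomputable abbrev unitMeasure : Measure ℝ := volume.restrict (Icc (0 : ℝ) 1)

instance : IsProbabilityMeasure unitMeasure := ⟨by simp [unitMeasure]⟩

/-- `∫_0^1 |f (r e^{2πiθ})|^p dθ`. -/
noncomputable def circMean (f : ℂ → ℂ) (p r : ℝ) : ℝ≥0∞ :=
  ∫⁻ θ in Icc (0 : ℝ) 1, ‖f (circlePoint r θ)‖ₑ ^ p

theorem normA_eq (μ : Measure ℝ) (p : ℝ) (s : ℝ≥0∞) (f : ℂ → ℂ) :
    normA μ p s f = (∫⁻ r in radii s, circMean f p r ∂μ) ^ (1 / p) := rfl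

theorem circMean_congr {f g : ℂ → ℂ} {p r : ℝ} (h : ∀ z, ‖z‖ = |r| → f z = g z) :
    circMean f p r = circMean g p r := by
  simp only [circMean]
  refine lintegral_congr fun θ => ?_
  rw [h _ (norm_circlePoint r θ)]

theorem measurable_circMean {f : ℂ → ℂ} (hf : Measurable f) (p : ℝ) :
    Measurable (circMean f p) := by
  unfold circMean
  have : Measurable fun x : ℝ × ℝ => ‖f (circlePoint x.1 x.2)‖ₑ ^ p :=
    ((hf.comp continuous_circlePoint.measurable).enorm).pow_const p
  exact this.lintegral_prod_right'

theorem integral_unit_eq_circleAverage (g : ℂ → ℝ) (c : ℂ) (r : ℝ) :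
    ∫ θ in Icc (0 : ℝ) 1, g (c + circlePoint r θ) = Real.circleAverage g c r := by
  rw [integral_Icc_eq_integral_Ioc, ← intervalIntegral.integral_of_le zero_le_one,
    Real.circleAverage_def]
  simp_rw [← circleMap_eq_add_circlePoint]
  rw [intervalIntegral.integral_comp_mul_left (fun x => g (circleMap c r x)) (by positivity)]
  simp

theorem integrable_unit_of_circleIntegrable {g : ℂ → ℝ} {c : ℂ} {r : ℝ}
    (h : CircleIntegrable g c r) :
    Integrable (fun θ => g (c + circlePoint r θ)) unitMeasure := by
  have h1 := IntervalIntegrable.comp_mul_left h (c := 2 * Real.pi)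
  simp only [zero_div, ne_eq, mul_eq_zero, OfNat.ofNat_ne_zero, Real.pi_ne_zero, or_self,
    not_false_eq_true, div_self] at h1
  rw [intervalIntegrable_iff_integrableOn_Icc_of_le zero_le_one] at h1
  refine h1.congr (ae_of_all _ fun θ => ?_)
  simp [circleMap_eq_add_circlePoint]

/-! ### Jensen's formula and the comparison of means -/

theorem ae_ne_zero_circle {f : ℂ → ℂ} {c : ℂ} {r : ℝ} (hr : 0 < r)
    (hf : AnalyticOnNhd ℂ f (closedBall c r)) (hc : f c ≠ 0) :
    ∀ᵐ θ ∂unitMeasure, f (c + circlePoint r θ) ≠ 0 := by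
  rcases hf.eqOn_zero_or_eventually_ne_zero_of_preconnected
    (convex_closedBall c r).isPreconnected with h | h
  · exact absurd (h (mem_closedBall_self hr.le)) hc
  have h2 : ∀ᶠ x in codiscreteWithin (sphere c |r|), f x ≠ 0 :=
    (codiscreteWithin_mono (by rw [abs_of_pos hr]; exact sphere_subset_closedBall)) h
  have h3 : ∀ᵐ x : ℝ ∂volume, f (circleMap c r x) ≠ 0 := by
    have := ae_restrict_le_codiscreteWithin (μ := (volume : Measure ℝ)) MeasurableSet.univ
      (circleMap_preimage_codiscrete hr.ne' h2)
    rw [Measure.restrict_univ] at this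
    exact this
  have h4 := (Measure.quasiMeasurePreserving_smul (μ := (volume : Measure ℝ))
    (r := 2 * Real.pi) (by positivity)).ae h3
  refine ae_restrict_of_ae (h4.mono fun θ hθ => ?_)
  rw [← circleMap_eq_add_circlePoint]
  exact hθ

/-- Jensen's inequality for the exponential function, with values in `[0, ∞]`. -/
theorem ofReal_exp_integral_le {α : Type*} [MeasurableSpace α] {ν : Measure α}
    [IsProbabilityMeasure ν] {g : α → ℝ} (hg : Integrable g ν) (q : ℝ) :
    ENNReal.ofReal (Real.exp (q * ∫ x, g x ∂ν)) ≤ ∫⁻ x, ENNReal.ofReal (Real.exp (q * g x)) ∂ν := by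
  by_cases hi : Integrable (fun x => Real.exp (q * g x)) ν
  · rw [← ofReal_integral_eq_lintegral_ofReal hi (ae_of_all _ fun x => (Real.exp_pos _).le)]
    refine ENNReal.ofReal_le_ofReal ?_
    rw [← integral_const_mul]
    exact convexOn_exp.map_integral_le Real.continuous_exp.continuousOn isClosed_univ
      (ae_of_all _ fun _ => mem_univ _) (hg.const_mul q) hi
  · have : ∫⁻ x, ENNReal.ofReal (Real.exp (q * g x)) ∂ν = ∞ := by
      by_contra hne
      refine hi ⟨(Real.continuous_exp.comp_aestronglyMeasurable
        (hg.aestronglyMeasurable.const_mul q)), ?_⟩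
      rw [hasFiniteIntegral_iff_ofReal (ae_of_all _ fun x => (Real.exp_pos _).le)]
      exact lt_top_iff_ne_top.2 hne
    rw [this]; exact le_top

theorem ofReal_exp_mul_log_norm {z : ℂ} (hz : z ≠ 0) (q : ℝ) :
    ENNReal.ofReal (Real.exp (q * Real.log ‖z‖)) = ‖z‖ₑ ^ q := by
  have h : 0 < ‖z‖ := norm_pos_iff.2 hz
  rw [mul_comm, ← Real.rpow_def_of_pos h, ← ENNReal.ofReal_rpow_of_pos h, ofReal_norm]

/-- Convexity of the exponential, applied to `q log |f|`. It is needed for `q = p`, to bring in the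
mean of `|f|^p`, and for `q = -1`, to bring in the mean of `1 / |F|`. -/
theorem ofReal_exp_circleAverage_le {f : ℂ → ℂ} {c : ℂ} {r : ℝ} (hr : 0 < r)
    (hf : AnalyticOnNhd ℂ f (closedBall c r)) (hc : f c ≠ 0) (q : ℝ) :
    ENNReal.ofReal (Real.exp (q * Real.circleAverage (fun z => Real.log ‖f z‖) c r)) ≤
      ∫⁻ θ in Icc (0 : ℝ) 1, ‖f (c + circlePoint r θ)‖ₑ ^ q := by
  have hci : CircleIntegrable (fun z => Real.log ‖f z‖) c r := by
    refine MeromorphicOn.circleIntegrable_log_norm fun z hz => ?_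
    rw [abs_of_pos hr] at hz
    exact (hf z (sphere_subset_closedBall hz)).meromorphicAt
  have hi := integrable_unit_of_circleIntegrable hci
  rw [← integral_unit_eq_circleAverage]
  refine (ofReal_exp_integral_le hi q).trans (lintegral_mono_ae ?_)
  filter_upwards [ae_ne_zero_circle hr hf hc] with θ hθ
  rw [ofReal_exp_mul_log_norm hθ]

/-- The sums of Jensen's formula are compared term by term: each weight `log (r / |u|)` is
nonnegative and the multiplicities are ordered by hypothesis. -/
theorem finsum_divisor_mul_log_le {f F : ℂ → ℂ} {r : ℝ} (hr : 0 < r)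
    (hf : AnalyticOnNhd ℂ f (closedBall 0 r)) (hF : AnalyticOnNhd ℂ F (closedBall 0 r))
    (hf0 : f 0 ≠ 0)
    (hv : ∀ z, ‖z‖ < r → z ≠ 0 → analyticOrderAt F z ≤ analyticOrderAt f z) :
    ∑ᶠ u, (MeromorphicOn.divisor F (closedBall 0 |r|) u : ℝ) * Real.log (r * ‖0 - u‖⁻¹) ≤
    ∑ᶠ u, (MeromorphicOn.divisor f (closedBall 0 |r|) u : ℝ) * Real.log (r * ‖0 - u‖⁻¹) := by
  rw [abs_of_pos hr]
  have key : ∀ g : ℂ → ℂ, AnalyticOnNhd ℂ g (closedBall 0 r) →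
      (Function.support fun u => (MeromorphicOn.divisor g (closedBall 0 r) u : ℝ) *
        Real.log (r * ‖0 - u‖⁻¹)).Finite := fun g _ =>
    ((MeromorphicOn.divisor g (closedBall 0 r)).finiteSupport
      (isCompact_closedBall 0 r)).subset fun u hu => by
        simp only [Function.mem_support, ne_eq, mul_eq_zero, Int.cast_eq_zero, not_or] at hu ⊢
        exact hu.1
  refine finsum_le_finsum' (key F hF) (key f hf) fun u => ?_
  by_cases hu : u ∈ closedBall (0 : ℂ) r
  swap
  · simp [Function.locallyFinsuppWithin.apply_eq_zero_of_notMem _ hu]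
  have hur : ‖u‖ ≤ r := by simpa using hu
  rw [MeromorphicOn.AnalyticOnNhd.divisor_apply hF hu,
    MeromorphicOn.AnalyticOnNhd.divisor_apply hf hu]
  -- The two places not covered by `hv` contribute nothing: at the centre because `0⁻¹` and `log 0`
  -- are `0` by convention, on the circle because `log 1 = 0`.
  rcases eq_or_ne u 0 with rfl | hu0
  · simp
  rcases hur.eq_or_lt with h | h
  · simp [h, hr.ne']
  have hlog : 0 ≤ Real.log (r * ‖0 - u‖⁻¹) := by
    refine Real.log_nonneg ?_
    rw [zero_sub, norm_neg, ← div_eq_mul_inv, one_le_div (norm_pos_iff.2 hu0)]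
    exact hur
  refine mul_le_mul_of_nonneg_right ?_ hlog
  have h1 := hv u h hu0
  -- An infinite order would be counted as `0` by the divisor; it is excluded by `f 0 ≠ 0`.
  have htop : analyticOrderAt f u ≠ ⊤ := by
    intro htop
    have := hf.eqOn_zero_of_preconnected_of_eventuallyEq_zero
      (convex_closedBall 0 r).isPreconnected hu (analyticOrderAt_eq_top.1 htop)
    exact hf0 (this (by simp [hr.le]))
  obtain ⟨n, hn⟩ := ENat.ne_top_iff_exists.1 htop
  obtain ⟨m, hm⟩ := ENat.ne_top_iff_exists.1 (ne_top_of_le_ne_top htop h1)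
  rw [← hn, ← hm] at h1 ⊢
  have : m ≤ n := by exact_mod_cast h1
  simpa using this

/-- A form of Jensen's formula: `log |f|` grows at least as `log |F|` if `f` has more zeros. -/
theorem circleAverage_log_sub_le {f F : ℂ → ℂ} {r : ℝ} (hr : 0 < r)
    (hf : AnalyticOnNhd ℂ f (closedBall 0 r)) (hF : AnalyticOnNhd ℂ F (closedBall 0 r))
    (hf0 : f 0 ≠ 0) (hF0 : F 0 ≠ 0)
    (hv : ∀ z, ‖z‖ < r → z ≠ 0 → analyticOrderAt F z ≤ analyticOrderAt f z) :
    Real.circleAverage (fun z => Real.log ‖F z‖) 0 r - Real.log ‖F 0‖ ≤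
      Real.circleAverage (fun z => Real.log ‖f z‖) 0 r - Real.log ‖f 0‖ := by
  have h1 := AnalyticOnNhd.circleAverage_log_norm (c := 0) hr.ne' (by rwa [abs_of_pos hr]) hf0
  have h2 := AnalyticOnNhd.circleAverage_log_norm (c := 0) hr.ne' (by rwa [abs_of_pos hr]) hF0
  rw [h1, h2]
  linarith [finsum_divisor_mul_log_le hr hf hF hf0 hv]

/-- All zero terms in Jensen's formula are nonnegative. -/
theorem log_norm_le_circleAverage {f : ℂ → ℂ} {c : ℂ} {r : ℝ} (hr : 0 < r)
    (hf : AnalyticOnNhd ℂ f (closedBall c r)) (hf0 : f c ≠ 0) :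
    Real.log ‖f c‖ ≤ Real.circleAverage (fun z => Real.log ‖f z‖) c r := by
  rw [AnalyticOnNhd.circleAverage_log_norm (c := c) hr.ne' (by rwa [abs_of_pos hr]) hf0]
  refine le_add_of_nonneg_left (finsum_nonneg fun u => ?_)
  rw [abs_of_pos hr]
  by_cases hu : u ∈ closedBall c r
  swap
  · simp [Function.locallyFinsuppWithin.apply_eq_zero_of_notMem _ hu]
  refine mul_nonneg ?_ ?_
  · exact_mod_cast (MeromorphicOn.AnalyticOnNhd.divisor_nonneg hf) u
  rcases eq_or_ne u c with rfl | hu0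
  · simp
  have : 0 < ‖c - u‖ := norm_pos_iff.2 (sub_ne_zero.2 hu0.symm)
  refine Real.log_nonneg ?_
  rw [← div_eq_mul_inv, one_le_div this, ← dist_eq_norm, dist_comm]
  exact hu

/-- `|f|^p` has the sub-mean value property. -/
theorem enorm_rpow_le_mean {f : ℂ → ℂ} {c : ℂ} {r p : ℝ} (hr : 0 < r) (hp : 0 < p)
    (hf : AnalyticOnNhd ℂ f (closedBall c r)) :
    ‖f c‖ₑ ^ p ≤ ∫⁻ θ in Icc (0 : ℝ) 1, ‖f (c + circlePoint r θ)‖ₑ ^ p := by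
  by_cases hc : f c = 0
  · simp [hc, hp]
  refine le_trans ?_ (ofReal_exp_circleAverage_le hr hf hc p)
  rw [← ofReal_exp_mul_log_norm hc]
  gcongr
  exact log_norm_le_circleAverage hr hf hc

/-- If `f` vanishes on the zeros of `F` in the disc of radius `r`, then
`|f 0| / |F 0|` is at most the product of a mean of `|f|^p` and a mean of `1 / |F|`. -/
theorem enorm_div_le_circMean_mul {f F : ℂ → ℂ} {r p : ℝ} (hr : 0 < r) (hp : 0 < p)
    (hf : AnalyticOnNhd ℂ f (closedBall 0 r)) (hF : AnalyticOnNhd ℂ F (closedBall 0 r))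
    (hf0 : f 0 ≠ 0) (hF0 : F 0 ≠ 0)
    (hv : ∀ z, ‖z‖ < r → z ≠ 0 → analyticOrderAt F z ≤ analyticOrderAt f z) :
    ‖f 0‖ₑ / ‖F 0‖ₑ ≤ circMean f p r ^ (1 / p) * circMean F (-1) r := by
  have hA := ofReal_exp_circleAverage_le hr hf hf0 p
  have hB := ofReal_exp_circleAverage_le hr hF hF0 (-1)
  simp only [zero_add] at hA hB
  set LF := Real.circleAverage (fun z => Real.log ‖F z‖) 0 r
  set Lf := Real.circleAverage (fun z => Real.log ‖f z‖) 0 r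
  have hJ : LF - Real.log ‖F 0‖ ≤ Lf - Real.log ‖f 0‖ :=
    circleAverage_log_sub_le hr hf hF hf0 hF0 hv
  have hA' : ENNReal.ofReal (Real.exp Lf) ≤ circMean f p r ^ (1 / p) := by
    rw [one_div, ENNReal.le_rpow_inv_iff hp, ENNReal.ofReal_rpow_of_pos (Real.exp_pos _),
      ← Real.exp_mul, mul_comm]
    exact hA
  have h1 : ‖f 0‖ₑ / ‖F 0‖ₑ = ENNReal.ofReal (Real.exp (Real.log ‖f 0‖ - Real.log ‖F 0‖)) := by
    rw [Real.exp_sub, Real.exp_log (norm_pos_iff.2 hf0), Real.exp_log (norm_pos_iff.2 hF0),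
      ENNReal.ofReal_div_of_pos (norm_pos_iff.2 hF0), ofReal_norm, ofReal_norm]
  calc ‖f 0‖ₑ / ‖F 0‖ₑ ≤ ENNReal.ofReal (Real.exp (Lf + -1 * LF)) := by
        rw [h1]; gcongr; linarith
    _ = ENNReal.ofReal (Real.exp Lf) * ENNReal.ofReal (Real.exp (-1 * LF)) := by
        rw [Real.exp_add, ENNReal.ofReal_mul (Real.exp_pos _).le]
    _ ≤ _ := mul_le_mul' hA' hB

/-! ### Monotonicity of the means, and pointwise bounds -/

/-- Both sides are integrals over the additive circle, whose measure is translation invariant. -/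
theorem lintegral_unit_shift {h : ℝ → ℝ≥0∞} (hh : Function.Periodic h 1) (ψ t : ℝ) :
    ∫⁻ θ in Ioc t (t + 1), h (ψ + θ) = ∫⁻ θ in Icc (0 : ℝ) 1, h θ := by
  have h1 := UnitAddCircle.lintegral_preimage t fun b => hh.lift ((ψ : UnitAddCircle) + b)
  have h2 := UnitAddCircle.lintegral_preimage 0 fun b => hh.lift b
  rw [lintegral_add_left_eq_self (μ := (volume : Measure UnitAddCircle)) hh.lift] at h1
  rw [← h2] at h1
  simp only [zero_add] at h1
  rw [setLIntegral_congr Ioc_ae_eq_Icc.symm]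
  exact h1

theorem circlePoint_periodic (r : ℝ) : Function.Periodic (circlePoint r) 1 := by
  intro θ
  rw [circlePoint_add]
  simp [circlePoint]

theorem exists_circlePoint (w : ℂ) : ∃ ψ, w = circlePoint ‖w‖ ψ := by
  refine ⟨w.arg / (2 * Real.pi), ?_⟩
  conv_lhs => rw [← Complex.norm_mul_exp_arg_mul_I w]
  simp only [circlePoint]
  congr 2
  have : (Real.pi : ℂ) ≠ 0 := by exact_mod_cast Real.pi_ne_zero
  push_cast
  field_simp

/-- Presents the mean as a radial function of `w`, averaged from the functions `|f|^p` of rotated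
arguments, so that it inherits their sub-mean value property. -/
theorem circMean_eq_rotation (f : ℂ → ℂ) (p : ℝ) (w : ℂ) :
    circMean f p ‖w‖ = ∫⁻ θ in Icc (0 : ℝ) 1, ‖f (circlePoint 1 θ * w)‖ₑ ^ p := by
  obtain ⟨ψ, hψ⟩ := exists_circlePoint w
  have hper : Function.Periodic (fun θ => ‖f (circlePoint ‖w‖ θ)‖ₑ ^ p) 1 := fun θ => by
    simp only [circlePoint_periodic ‖w‖ θ]
  have h := lintegral_unit_shift hper ψ 0
  simp only [zero_add] at h
  rw [circMean, ← h, setLIntegral_congr Ioc_ae_eq_Icc]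
  refine lintegral_congr fun θ => ?_
  rw [circlePoint_add, ← hψ]

theorem measurable_circlePoint (r : ℝ) : Measurable (circlePoint r) :=
  (continuous_circlePoint.comp (Continuous.prodMk_right r)).measurable

theorem continuousOn_circMean {f : ℂ → ℂ} {R p : ℝ} (hp : 0 < p)
    (hf : ContinuousOn f (closedBall 0 R)) : ContinuousOn (circMean f p) (Icc 0 R) := by
  obtain ⟨K, hK⟩ := (isCompact_closedBall (0 : ℂ) R).exists_bound_of_continuousOn hf
  have hmem : ∀ r ∈ Icc 0 R, ∀ θ, circlePoint r θ ∈ closedBall (0 : ℂ) R := fun r hr θ => by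
    simpa [norm_circlePoint, abs_of_nonneg hr.1] using hr.2
  intro x hx
  refine tendsto_lintegral_filter_of_dominated_convergence (fun _ => ENNReal.ofReal K ^ p)
    ?_ ?_ ?_ ?_
  · filter_upwards [self_mem_nhdsWithin] with r hr
    have : Continuous fun θ => f (circlePoint r θ) :=
      hf.comp_continuous (continuous_circlePoint.comp (Continuous.prodMk_right r)) (hmem r hr)
    exact this.measurable.enorm.pow_const p
  · filter_upwards [self_mem_nhdsWithin] with r hr
    refine ae_of_all _ fun θ => ?_
    gcongr
    rw [← ofReal_norm]
    exact ENNReal.ofReal_le_ofReal (hK _ (hmem r hr θ))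
  · rw [lintegral_const]
    simp [ENNReal.rpow_eq_top_iff, hp.not_gt]
  · refine ae_of_all _ fun θ => ?_
    have h2 : ContinuousOn (fun r => f (circlePoint r θ)) (Icc 0 R) :=
      hf.comp (continuous_circlePoint.comp (Continuous.prodMk_left θ)).continuousOn
        fun r hr => hmem r hr θ
    exact (ENNReal.continuous_rpow_const.tendsto _).comp
      ((continuous_enorm.tendsto _).comp (h2 x hx))

theorem circMean_lt_top {f : ℂ → ℂ} {r p : ℝ} (hr : 0 ≤ r) (hp : 0 < p)
    (hf : ContinuousOn f (closedBall 0 r)) : circMean f p r < ∞ := by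
  obtain ⟨K, hK⟩ := (isCompact_closedBall (0 : ℂ) r).exists_bound_of_continuousOn hf
  have : circMean f p r ≤ ∫⁻ _ in Icc (0 : ℝ) 1, ENNReal.ofReal K ^ p := by
    refine lintegral_mono fun θ => ?_
    dsimp only
    gcongr
    rw [← ofReal_norm]
    exact ENNReal.ofReal_le_ofReal (hK _ (by simp [norm_circlePoint, abs_of_nonneg hr]))
  refine this.trans_lt ?_
  rw [lintegral_const]
  simp [lt_top_iff_ne_top, ENNReal.rpow_eq_top_iff, hp.not_gt]

/-- The sub-mean value property of each rotated function, integrated over the rotations with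
Tonelli's theorem. -/
theorem circMean_le_lintegral_circMean {f : ℂ → ℂ} {R p x δ : ℝ} (hp : 0 < p) (hx : 0 ≤ x)
    (hδ : 0 < δ) (hR : x + δ ≤ R) (hf : AnalyticOnNhd ℂ f (closedBall 0 R)) :
    circMean f p x ≤ ∫⁻ φ in Icc (0 : ℝ) 1, circMean f p ‖(x : ℂ) + circlePoint δ φ‖ := by
  have hmem : ∀ θ, ∀ w : ℂ, ‖w‖ ≤ R → circlePoint 1 θ * w ∈ closedBall (0 : ℂ) R := fun θ w hw => by
    simpa [norm_circlePoint] using hw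
  have hn : ∀ φ, ‖(x : ℂ) + circlePoint δ φ‖ ≤ R := fun φ => by
    refine (norm_add_le _ _).trans ?_
    rw [norm_circlePoint, Complex.norm_real, Real.norm_of_nonneg hx, abs_of_pos hδ]
    exact hR
  have hcont : Continuous fun y : ℝ × ℝ =>
      ‖f (circlePoint 1 y.1 * ((x : ℂ) + circlePoint δ y.2))‖ₑ ^ p := by
    refine ENNReal.continuous_rpow_const.comp (continuous_enorm.comp ?_)
    refine hf.continuousOn.comp_continuous ?_ fun y => hmem _ _ (hn _)
    have h1 : Continuous fun y : ℝ × ℝ => circlePoint 1 y.1 :=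
      continuous_circlePoint.comp (continuous_const.prodMk continuous_fst)
    have h2 : Continuous fun y : ℝ × ℝ => circlePoint δ y.2 :=
      continuous_circlePoint.comp (continuous_const.prodMk continuous_snd)
    exact h1.mul (continuous_const.add h2)
  calc circMean f p x = ∫⁻ θ in Icc (0 : ℝ) 1, ‖f (circlePoint 1 θ * (x : ℂ))‖ₑ ^ p := by
        rw [← circMean_eq_rotation, Complex.norm_real, Real.norm_of_nonneg hx]
    _ ≤ ∫⁻ θ in Icc (0 : ℝ) 1, ∫⁻ φ in Icc (0 : ℝ) 1,
          ‖f (circlePoint 1 θ * ((x : ℂ) + circlePoint δ φ))‖ₑ ^ p := by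
        refine lintegral_mono fun θ => ?_
        refine enorm_rpow_le_mean (f := fun w => f (circlePoint 1 θ * w)) hδ hp fun w hw => ?_
        have hwR : ‖w‖ ≤ R := by
          have : ‖w - x‖ ≤ δ := by rwa [← dist_eq_norm]
          calc ‖w‖ = ‖(x : ℂ) + (w - x)‖ := by ring_nf
            _ ≤ ‖(x : ℂ)‖ + ‖w - x‖ := norm_add_le _ _
            _ ≤ R := by rw [Complex.norm_real, Real.norm_of_nonneg hx]; linarith
        exact (hf _ (hmem θ w hwR)).comp_of_eq (by fun_prop) rfl
    _ = ∫⁻ φ in Icc (0 : ℝ) 1, ∫⁻ θ in Icc (0 : ℝ) 1,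
          ‖f (circlePoint 1 θ * ((x : ℂ) + circlePoint δ φ))‖ₑ ^ p :=
        lintegral_lintegral_swap hcont.measurable.aemeasurable
    _ = _ := by simp_rw [← circMean_eq_rotation]

/-- Hardy's theorem: the means of `|f|^p` increase with the radius. -/
theorem circMean_mono {f : ℂ → ℂ} {R p x : ℝ} (hp : 0 < p) (hx : 0 ≤ x) (hxR : x ≤ R)
    (hf : AnalyticOnNhd ℂ f (closedBall 0 R)) : circMean f p x ≤ circMean f p R := by
  have hcont := continuousOn_circMean hp hf.continuousOn
  have hR : 0 ≤ R := hx.trans hxR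
  obtain ⟨x₀, hx₀, hmax⟩ := isCompact_Icc.exists_isMaxOn (nonempty_Icc.2 hR) hcont
  set m := circMean f p x₀ with hm
  have hle : ∀ y ∈ Icc 0 R, circMean f p y ≤ m := fun y hy => hmax hy
  have hmtop : m < ∞ := circMean_lt_top hx₀.1 hp
    (hf.continuousOn.mono (closedBall_subset_closedBall hx₀.2))
  have hcl : IsClosed (Icc 0 R ∩ circMean f p ⁻¹' Ici m) :=
    hcont.preimage_isClosed_of_isClosed isClosed_Icc isClosed_Ici
  -- Maximum principle: `y` is the largest radius where the maximum of the means is reached. If `y <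
  -- R`, the circle about `y` that touches the circle of radius `R` gives a contradiction.
  obtain ⟨y, ⟨hyI, hym⟩, hy⟩ := (isCompact_Icc.of_isClosed_subset hcl
    inter_subset_left).exists_isGreatest ⟨x₀, hx₀, le_refl m⟩
  rcases hyI.2.eq_or_lt with rfl | hlt
  · exact (hle x ⟨hx, hxR⟩).trans hym
  exfalso
  have hδ : 0 < R - y := sub_pos.2 hlt
  have hn : ∀ φ, ‖(y : ℂ) + circlePoint (R - y) φ‖ ∈ Icc 0 R := fun φ => by
    refine ⟨norm_nonneg _, (norm_add_le _ _).trans ?_⟩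
    rw [norm_circlePoint, Complex.norm_real, Real.norm_of_nonneg hyI.1, abs_of_pos hδ]
    linarith
  have hcφ : Continuous fun φ => ‖(y : ℂ) + circlePoint (R - y) φ‖ := by
    have : Continuous fun φ => circlePoint (R - y) φ :=
      continuous_circlePoint.comp (Continuous.prodMk_right _)
    fun_prop
  have hgc : Continuous fun φ => circMean f p ‖(y : ℂ) + circlePoint (R - y) φ‖ :=
    hcont.comp_continuous hcφ hn
  have h1 : m ≤ ∫⁻ φ in Icc (0 : ℝ) 1, circMean f p ‖(y : ℂ) + circlePoint (R - y) φ‖ :=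
    le_trans hym (circMean_le_lintegral_circMean hp hyI.1 hδ (by linarith) hf)
  have h2 : ∀ᵐ φ ∂unitMeasure, circMean f p ‖(y : ℂ) + circlePoint (R - y) φ‖ = m := by
    refine ae_eq_of_ae_le_of_lintegral_le (ae_of_all _ fun φ => hle _ (hn φ)) ?_ ?_ ?_
    · refine ((lintegral_mono fun φ => hle _ (hn φ)).trans_lt ?_).ne
      simpa using hmtop
    · exact aemeasurable_const
    · simpa using h1
  -- By `h2` almost every point of the small circle has mean `m`, but an open set of its angles near
  -- `0` has modulus above `y`.
  have hU : IsOpen {φ | y < ‖(y : ℂ) + circlePoint (R - y) φ‖} := isOpen_lt continuous_const hcφ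
  have h0 : (0 : ℝ) ∈ {φ | y < ‖(y : ℂ) + circlePoint (R - y) φ‖} := by
    have : (y : ℂ) + circlePoint (R - y) 0 = (R : ℂ) := by simp [circlePoint]
    rw [mem_ofPred_eq, this, Complex.norm_real, Real.norm_of_nonneg hR]
    exact hlt
  have hne : ({φ | y < ‖(y : ℂ) + circlePoint (R - y) φ‖} ∩ Ioo (0 : ℝ) 1).Nonempty := by
    have : (0 : ℝ) ∈ closure (Ioo (0 : ℝ) 1) := by rw [closure_Ioo zero_ne_one]; simp
    exact mem_closure_iff.1 this _ hU h0
  have hpos := (hU.inter isOpen_Ioo).measure_pos volume hne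
  refine hpos.ne' (measure_mono_null (fun φ hφ => ?_) ((ae_iff.1
    ((ae_restrict_iff' measurableSet_Icc).1 h2))))
  simp only [Classical.not_imp, mem_ofPred_eq]
  refine ⟨Ioo_subset_Icc_self hφ.2, fun heq => ?_⟩
  exact absurd (hy ⟨hn φ, heq.ge⟩) (not_le.2 hφ.1)

/-! ### Pointwise bounds from area integrals -/

theorem lintegral_eq_polar {g : ℂ → ℝ≥0∞} (hg : Measurable g) :
    ∫⁻ w, g w = ∫⁻ ρ in Ioi (0 : ℝ), ENNReal.ofReal ρ *
      (ENNReal.ofReal (2 * Real.pi) * ∫⁻ φ in Icc (0 : ℝ) 1, g (circlePoint ρ φ)) := by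
  have hinner : ∀ ρ : ℝ, ∫⁻ α in Ioo (-Real.pi) Real.pi, g (Complex.polarCoord.symm (ρ, α)) =
      ENNReal.ofReal (2 * Real.pi) * ∫⁻ φ in Icc (0 : ℝ) 1, g (circlePoint ρ φ) := by
    intro ρ
    have himg : (fun x : ℝ => 2 * Real.pi * x) '' Ioc (-(1 / 2)) (-(1 / 2) + 1) =
        Ioc (-Real.pi) Real.pi := by
      rw [image_mul_left_Ioc (by positivity)]
      congr 1 <;> ring
    rw [setLIntegral_congr Ioo_ae_eq_Ioc, ← himg,
      lintegral_image_eq_lintegral_abs_deriv_mul measurableSet_Ioc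
        (f' := fun _ => 2 * Real.pi)
        (fun x _ => by simpa using ((hasDerivAt_id x).const_mul (2 * Real.pi)).hasDerivWithinAt)
        (fun x _ y _ h => by simpa [Real.pi_ne_zero] using h)]
    rw [lintegral_const_mul' _ _ ENNReal.ofReal_ne_top, abs_of_pos (by positivity)]
    congr 1
    have hper : Function.Periodic (fun θ => g (circlePoint ρ θ)) 1 := fun θ => by
      simp only [circlePoint_periodic ρ θ]
    rw [← lintegral_unit_shift hper 0 (-(1 / 2))]
    refine lintegral_congr fun θ => ?_
    rw [Complex.polarCoord_symm_apply, zero_add]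
    congr 1
    simp only [circlePoint]
    rw [show 2 * (Real.pi : ℂ) * Complex.I * (θ : ℂ) = ((2 * Real.pi * θ : ℝ) : ℂ) * Complex.I by
      push_cast; ring, Complex.exp_mul_I]
    push_cast
    rfl
  rw [← Complex.lintegral_comp_polarCoord_symm, polarCoord_target,
    Measure.volume_eq_prod, ← Measure.prod_restrict, lintegral_prod]
  · refine lintegral_congr fun ρ => ?_
    rw [← hinner, ← lintegral_const_mul' _ _ ENNReal.ofReal_ne_top]
    rfl
  · refine Measurable.aemeasurable ?_
    have h : Measurable fun x : ℝ × ℝ =>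
        (x.1 : ℂ) * ((Real.cos x.2 : ℂ) + (Real.sin x.2 : ℂ) * Complex.I) := by fun_prop
    have h' : Measurable fun x => Complex.polarCoord.symm x := by
      rw [show (fun x => Complex.polarCoord.symm x) = _ from funext Complex.polarCoord_symm_apply]
      exact h
    exact Measurable.mul (by fun_prop) (hg.comp h')

theorem lintegral_Ioi_indicator_id {δ : ℝ} (hδ : 0 < δ) :
    ∫⁻ ρ in Ioi (0 : ℝ), (Iic δ).indicator ENNReal.ofReal ρ = ENNReal.ofReal (δ ^ 2 / 2) := by
  rw [setLIntegral_indicator measurableSet_Iic, inter_comm, Ioi_inter_Iic,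
    ← ofReal_integral_eq_lintegral_ofReal, ← intervalIntegral.integral_of_le hδ.le, integral_id]
  · simp
  · exact (continuous_id.integrableOn_Icc (a := 0) (b := δ)).mono_set Ioc_subset_Icc_self
  · filter_upwards [ae_restrict_mem measurableSet_Ioc] with x hx using hx.1.le

theorem measurable_indicator_of_continuousOn {E : Type*} [TopologicalSpace E] [MeasurableSpace E]
    [BorelSpace E] [Zero E] {f : ℂ → E} {S : Set ℂ} (hf : ContinuousOn f S)
    (hS : MeasurableSet S) : Measurable (S.indicator f) := by
  classical
  rw [← piecewise_eq_indicator]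
  exact hf.measurable_piecewise continuousOn_const hS

/-- A bound of `|f z|` by the means of `|f|^p`. -/
theorem enorm_rpow_le_circMean {f : ℂ → ℂ} {t p δ : ℝ} {z : ℂ} (hp : 0 < p) (hδ : 0 < δ)
    (hz : ‖z‖ + δ ≤ t) (hf : AnalyticOnNhd ℂ f (closedBall 0 t)) :
    ENNReal.ofReal (δ ^ 2) * ‖f z‖ₑ ^ p ≤ ENNReal.ofReal (t ^ 2) * circMean f p t := by
  have ht : 0 < t := by linarith [norm_nonneg z]
  set u : ℂ → ℝ≥0∞ := (closedBall (0 : ℂ) t).indicator fun w => ‖f w‖ₑ ^ p with hu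
  have hum : Measurable u := by
    refine measurable_indicator_of_continuousOn ?_ measurableSet_closedBall
    exact ENNReal.continuous_rpow_const.comp_continuousOn
      (continuous_enorm.comp_continuousOn hf.continuousOn)
  set v : ℂ → ℝ≥0∞ := (closedBall (0 : ℂ) δ).indicator fun w => u (z + w) with hv
  have hvm : Measurable v :=
    (hum.comp (measurable_const_add z)).indicator measurableSet_closedBall
  have hC : ENNReal.ofReal (2 * Real.pi) ≠ ∞ := ENNReal.ofReal_ne_top
  have hC0 : ENNReal.ofReal (2 * Real.pi) ≠ 0 := by
    simp [Real.pi_pos]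
  -- The sub-mean value property on all circles about `z` of radius at most `δ`, integrated in polar
  -- coordinates.
  have hlow : ENNReal.ofReal (2 * Real.pi) * (ENNReal.ofReal (δ ^ 2 / 2) * ‖f z‖ₑ ^ p) ≤
      ∫⁻ w, v w := by
    rw [lintegral_eq_polar hvm, ← lintegral_Ioi_indicator_id hδ, ← mul_assoc,
      ← lintegral_const_mul' _ _ hC, mul_comm _ (‖f z‖ₑ ^ p),
      ← lintegral_const_mul' _ _ (by simp [hp.le])]
    refine setLIntegral_mono' measurableSet_Ioi fun ρ hρ => ?_
    by_cases hρδ : ρ ≤ δ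
    swap
    · simp [hρδ]
    rw [indicator_of_mem (by exact hρδ)]
    have hmem : ∀ θ, circlePoint ρ θ ∈ closedBall (0 : ℂ) δ := fun θ => by
      simpa [norm_circlePoint, abs_of_pos (show (0 : ℝ) < ρ from hρ)] using hρδ
    have hsub : closedBall z δ ⊆ closedBall 0 t :=
      closedBall_subset_closedBall' (by rw [dist_zero_right]; linarith)
    have := enorm_rpow_le_mean (show (0 : ℝ) < ρ from hρ) hp
      (hf.mono ((closedBall_subset_closedBall hρδ).trans hsub))
    calc ‖f z‖ₑ ^ p * (ENNReal.ofReal (2 * Real.pi) * ENNReal.ofReal ρ)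
        = ENNReal.ofReal ρ * (ENNReal.ofReal (2 * Real.pi) * ‖f z‖ₑ ^ p) := by ring
      _ ≤ ENNReal.ofReal ρ * (ENNReal.ofReal (2 * Real.pi) *
          ∫⁻ θ in Icc (0 : ℝ) 1, ‖f (z + circlePoint ρ θ)‖ₑ ^ p) := by gcongr
      _ = _ := by
        congr 2
        refine lintegral_congr fun θ => ?_
        have hmem2 : z + circlePoint ρ θ ∈ closedBall (0 : ℂ) t := hsub (by
          simpa [mem_closedBall_iff_norm] using hmem θ)
        rw [hv, indicator_of_mem (hmem θ), hu, indicator_of_mem hmem2]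
  have hmid : ∫⁻ w, v w ≤ ∫⁻ w, u w := by
    calc ∫⁻ w, v w ≤ ∫⁻ w, u (z + w) := lintegral_mono fun w => indicator_le_self _ _ _
      _ = ∫⁻ w, u w := lintegral_add_left_eq_self u z
  -- On circles about the origin the means are at most the one at radius `t`, by monotonicity.
  have hup : ∫⁻ w, u w ≤ ENNReal.ofReal (2 * Real.pi) *
      (ENNReal.ofReal (t ^ 2 / 2) * circMean f p t) := by
    have hfin : circMean f p t ≠ ∞ := (circMean_lt_top ht.le hp hf.continuousOn).ne
    rw [lintegral_eq_polar hum, ← lintegral_Ioi_indicator_id ht, ← mul_assoc,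
      ← lintegral_const_mul' _ _ hC, mul_comm _ (circMean f p t), ← lintegral_const_mul' _ _ hfin]
    refine setLIntegral_mono' measurableSet_Ioi fun ρ hρ => ?_
    have hρ0 : (0 : ℝ) < ρ := hρ
    by_cases hρt : ρ ≤ t
    · rw [indicator_of_mem (by exact hρt)]
      calc ENNReal.ofReal ρ * (ENNReal.ofReal (2 * Real.pi) *
            ∫⁻ θ in Icc (0 : ℝ) 1, u (circlePoint ρ θ))
          ≤ ENNReal.ofReal ρ * (ENNReal.ofReal (2 * Real.pi) * circMean f p t) := by
            gcongr
            refine le_trans ?_ (circMean_mono hp hρ0.le hρt hf)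
            exact lintegral_mono fun θ => indicator_le_self _ _ _
        _ = _ := by ring
    · have : ∀ θ, u (circlePoint ρ θ) = 0 := fun θ => by
        rw [hu, indicator_of_notMem]
        simpa [norm_circlePoint, abs_of_pos hρ0] using hρt
      simp [this]
  have hall := (hlow.trans hmid).trans hup
  rw [ENNReal.mul_le_mul_iff_right hC0 hC] at hall
  have h2 : ∀ x : ℝ, ENNReal.ofReal (x ^ 2) = 2 * ENNReal.ofReal (x ^ 2 / 2) := fun x => by
    rw [show (2 : ℝ≥0∞) = ENNReal.ofReal 2 by simp, ← ENNReal.ofReal_mul (by norm_num)]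
    congr 1; ring
  rw [h2, h2, mul_assoc, mul_assoc]
  gcongr

/-! ### Normal families -/

theorem exists_lt_ofReal_lt {t : ℝ} {s : ℝ≥0∞} (ht : 0 ≤ t) (h : ENNReal.ofReal t < s) :
    ∃ t' : ℝ, t < t' ∧ ENNReal.ofReal t' < s := by
  obtain ⟨x, hx1, hx2⟩ := exists_between h
  refine ⟨x.toReal, ?_, ?_⟩
  · exact (ENNReal.ofReal_lt_iff_lt_toReal ht (ne_top_of_lt hx2)).1 hx1
  · rwa [ENNReal.ofReal_toReal (ne_top_of_lt hx2)]

theorem exists_closedBall_of_isCompact {K : Set ℂ} {s : ℝ≥0∞} (hs : 0 < s) (hK : IsCompact K)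
    (h : K ⊆ disc s) : ∃ t : ℝ, 0 < t ∧ ENNReal.ofReal t < s ∧ K ⊆ closedBall 0 t := by
  rcases K.eq_empty_or_nonempty with rfl | hne
  · obtain ⟨t, ht, hts⟩ := exists_lt_ofReal_lt le_rfl (by simpa using hs)
    exact ⟨t, ht, hts, empty_subset _⟩
  obtain ⟨z, hz, hmax⟩ := hK.exists_isMaxOn hne continuous_norm.continuousOn
  obtain ⟨t, ht, hts⟩ := exists_lt_ofReal_lt (norm_nonneg z) (mem_disc.1 (h hz))
  refine ⟨t, (norm_nonneg z).trans_lt ht, hts, fun w hw => ?_⟩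
  rw [mem_closedBall_zero_iff]
  exact (hmax hw).trans ht.le

/-- Montel's theorem for a disc centred at the origin. -/
theorem exists_subseq_tendstoLocallyUniformlyOn {s : ℝ≥0∞} (hs : 0 < s) {f : ℕ → ℂ → ℂ}
    (hf : ∀ n, AnalyticOnNhd ℂ (f n) (disc s))
    (hb : ∀ t : ℝ, 0 < t → ENNReal.ofReal t < s →
      ∃ K : ℝ, ∀ᶠ n in atTop, ∀ z ∈ closedBall (0 : ℂ) t, ‖f n z‖ ≤ K) :
    ∃ (g : ℂ → ℂ) (φ : ℕ → ℕ), StrictMono φ ∧ AnalyticOnNhd ℂ g (disc s) ∧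
      TendstoLocallyUniformlyOn (fun n => f (φ n)) g atTop (disc s) := by
  set c : ℕ → ℕ → ℂ := fun n k => (k.factorial : ℂ)⁻¹ * iteratedDeriv k (f n) 0 with hc
  have hsum : ∀ n, ∀ z ∈ disc s, HasSum (fun k => c n k * z ^ k) (f n z) := by
    intro n z hz
    have h1 := Complex.hasSum_taylorSeries_on_eball (c := 0) (z := z) (r := s) (f := f n)
      (by rw [← disc_eq_eball]; exact (hf n).differentiableOn) (by rwa [← disc_eq_eball])
    refine h1.congr_fun fun k => ?_
    simp only [smul_eq_mul, sub_zero]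
    ring
  have hcb : ∀ t : ℝ, 0 < t → ENNReal.ofReal t < s → ∃ K : ℝ, ∀ᶠ n in atTop, ∀ k,
      ‖c n k‖ * t ^ k ≤ K := by
    intro t ht hts
    obtain ⟨K, hK⟩ := hb t ht hts
    refine ⟨K, hK.mono fun n hn k => ?_⟩
    have h1 := Complex.norm_iteratedDeriv_le_of_forall_mem_sphere_norm_le (c := 0) (f := f n) k ht
      (C := K)
      (((hf n).mono (closedBall_subset_disc hts)).differentiableOn.diffContOnCl_ball subset_rfl)
      (fun z hz => hn z (sphere_subset_closedBall hz))
    have hk : (0 : ℝ) < k.factorial := by exact_mod_cast k.factorial_pos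
    rw [hc]
    simp only [norm_mul, norm_inv, Complex.norm_natCast]
    rw [mul_assoc, inv_mul_le_iff₀ hk, ← le_div_iff₀ (by positivity)]
    exact h1
  obtain ⟨t₀, ht₀, ht₀s⟩ := exists_lt_ofReal_lt le_rfl (show ENNReal.ofReal 0 < s by simpa using hs)
  have hck : ∀ k, ∃ C : ℝ, ∀ n, ‖c n k‖ ≤ C := by
    intro k
    obtain ⟨K, hK⟩ := hcb t₀ ht₀ ht₀s
    have : IsBoundedUnder (· ≤ ·) atTop fun n => ‖c n k‖ :=
      ⟨K / t₀ ^ k, by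
        rw [eventually_map]
        exact hK.mono fun n hn => (le_div_iff₀ (by positivity)).2 (hn k)⟩
    obtain ⟨C, hC⟩ := this.bddAbove_range
    exact ⟨C, fun n => hC (mem_range_self n)⟩
  choose C hC using hck
  -- Compactness of the product of discs replaces the diagonal argument: one subsequence makes all
  -- Taylor coefficients converge.
  obtain ⟨c', -, φ, hφ, hlim⟩ := (isCompact_univ_pi fun k => isCompact_closedBall (0 : ℂ) (C k))
    |>.tendsto_subseq (x := c) fun n k _ => by simpa using hC k n
  have hlimk : ∀ k, Tendsto (fun n => c (φ n) k) atTop (𝓝 (c' k)) := tendsto_pi_nhds.1 hlim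
  have hunif : ∀ t : ℝ, 0 < t → ENNReal.ofReal t < s →
      TendstoUniformlyOn (fun n => f (φ n)) (fun z => ∑' k, c' k * z ^ k) atTop
        (closedBall 0 t) := by
    intro t ht hts
    -- Cauchy's estimates at a larger radius `t'` dominate the coefficient series at `t` by a
    -- geometric series of ratio `t / t'`.
    obtain ⟨t', htt', ht's⟩ := exists_lt_ofReal_lt ht.le hts
    have ht' : 0 < t' := ht.trans htt'
    obtain ⟨K, hK⟩ := hcb t' ht' ht's
    have hK' := hφ.tendsto_atTop.eventually hK
    have hKc' : ∀ k, ‖c' k‖ * t' ^ k ≤ K := fun k =>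
      le_of_tendsto (((hlimk k).norm).mul_const _) (hK'.mono fun n hn => hn k)
    have hgeo : Summable fun k : ℕ => 2 * K * (t / t') ^ k :=
      (summable_geometric_of_lt_one (by positivity) ((div_lt_one ht').2 htt')).mul_left _
    have hconv : ∀ x : ℝ, ∀ k : ℕ, x * t' ^ k ≤ K → x * t ^ k ≤ K * (t / t') ^ k := by
      intro x k hx
      calc x * t ^ k = x * t' ^ k * (t / t') ^ k := by
            rw [div_pow]; field_simp
        _ ≤ _ := by gcongr
    have hdom : ∀ᶠ n in atTop, ∀ k, ‖c (φ n) k - c' k‖ * t ^ k ≤ 2 * K * (t / t') ^ k := by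
      filter_upwards [hK'] with n hn k
      have h1 := hconv _ k (hn k)
      have h2 := hconv _ k (hKc' k)
      have h3 : ‖c (φ n) k - c' k‖ * t ^ k ≤ (‖c (φ n) k‖ + ‖c' k‖) * t ^ k := by
        gcongr; exact norm_sub_le _ _
      linarith
    have hto : Tendsto (fun n => ∑' k, ‖c (φ n) k - c' k‖ * t ^ k) atTop (𝓝 0) := by
      have := tendsto_tsum_of_dominated_convergence (𝓕 := atTop)
        (f := fun n k => ‖c (φ n) k - c' k‖ * t ^ k) (g := fun _ => (0 : ℝ)) hgeo
        (fun k => by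
          have h := ((hlimk k).sub_const (c' k)).norm.mul_const (t ^ k)
          simpa using h)
        (hdom.mono fun n hn k => by
          rw [Real.norm_of_nonneg (by positivity)]
          exact hn k)
      simpa using this
    rw [Metric.tendstoUniformlyOn_iff]
    intro ε hε
    filter_upwards [hto.eventually (gt_mem_nhds hε), hdom] with n hn hd z hz
    have hz' : ‖z‖ ≤ t := by simpa using hz
    have hsumd : Summable fun k => ‖c (φ n) k - c' k‖ * t ^ k :=
      hgeo.of_nonneg_of_le (fun k => by positivity) hd
    have hbd : ∀ k, ‖(c (φ n) k - c' k) * z ^ k‖ ≤ ‖c (φ n) k - c' k‖ * t ^ k := fun k => by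
      rw [norm_mul, norm_pow]; gcongr
    have hs1 := hsum (φ n) z (closedBall_subset_disc hts hz)
    have hsd : Summable fun k => (c (φ n) k - c' k) * z ^ k := .of_norm_bounded hsumd hbd
    have hs2 : Summable fun k => c' k * z ^ k := by
      have := hs1.summable.sub hsd
      refine this.congr fun k => ?_
      ring
    rw [dist_comm, dist_eq_norm, ← hs1.tsum_eq, ← hs1.summable.tsum_sub hs2]
    have : ‖∑' k, (c (φ n) k * z ^ k - c' k * z ^ k)‖ ≤ ∑' k, ‖c (φ n) k - c' k‖ * t ^ k := by
      refine tsum_of_norm_bounded hsumd.hasSum fun k => ?_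
      rw [← sub_mul]; exact hbd k
    exact this.trans_lt hn
  have hloc : TendstoLocallyUniformlyOn (fun n => f (φ n)) (fun z => ∑' k, c' k * z ^ k) atTop
      (disc s) := by
    rw [tendstoLocallyUniformlyOn_iff_forall_isCompact (isOpen_disc s)]
    intro K hKs hK
    obtain ⟨t, ht, hts, hKt⟩ := exists_closedBall_of_isCompact hs hK hKs
    exact (hunif t ht hts).mono hKt
  refine ⟨_, φ, hφ, ?_, hloc⟩
  exact (hloc.differentiableOn (.of_forall fun n => (hf (φ n)).differentiableOn)
    (isOpen_disc s)).analyticOnNhd (isOpen_disc s)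

theorem tendstoLocallyUniformlyOn_iteratedDeriv {U : Set ℂ} (hU : IsOpen U) {f : ℕ → ℂ → ℂ}
    {g : ℂ → ℂ} (hf : ∀ n, AnalyticOnNhd ℂ (f n) U)
    (h : TendstoLocallyUniformlyOn f g atTop U) (k : ℕ) :
    TendstoLocallyUniformlyOn (fun n => iteratedDeriv k (f n)) (iteratedDeriv k g) atTop U := by
  induction k with
  | zero => simpa using h
  | succ k ih =>
    simp only [iteratedDeriv_succ]
    refine ih.deriv (.of_forall fun n => ?_) hU
    rw [iteratedDeriv_eq_iterate]
    exact ((hf n).iterated_deriv k).differentiableOn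

/-- The order of vanishing at a point does not decrease in the limit. -/
theorem le_analyticOrderAt_of_tendsto {U : Set ℂ} (hU : IsOpen U) {f : ℕ → ℂ → ℂ} {g : ℂ → ℂ}
    (hf : ∀ n, AnalyticOnNhd ℂ (f n) U) (hg : AnalyticOnNhd ℂ g U)
    (h : TendstoLocallyUniformlyOn f g atTop U) {z : ℂ} (hz : z ∈ U) {m : ℕ∞}
    (hm : ∀ᶠ n in atTop, m ≤ analyticOrderAt (f n) z) : m ≤ analyticOrderAt g z := by
  rw [← ENat.forall_natCast_le_iff_le]
  intro k hk
  rw [natCast_le_analyticOrderAt_iff_iteratedDeriv_eq_zero (hg z hz)]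
  intro i hi
  have h1 := (tendstoLocallyUniformlyOn_iteratedDeriv hU hf h i).tendsto_at hz
  refine tendsto_nhds_unique h1 (tendsto_const_nhds.congr' ?_)
  filter_upwards [hm] with n hn
  exact ((natCast_le_analyticOrderAt_iff_iteratedDeriv_eq_zero (hf n z hz)).1
    (hk.trans hn) i hi).symm

/-! ### Compactness of sets of competitors -/

theorem normA_rpow {μ : Measure ℝ} {p : ℝ} (hp : 0 < p) (s : ℝ≥0∞) (f : ℂ → ℂ) :
    normA μ p s f ^ p = ∫⁻ r in radii s, circMean f p r ∂μ := by
  rw [normA_eq, one_div, ENNReal.rpow_inv_rpow hp.ne']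

theorem normA_mono {μ : Measure ℝ} {p : ℝ} (hp : 0 < p) {s t : ℝ≥0∞} (hst : s ≤ t) (f : ℂ → ℂ) :
    normA μ p s f ≤ normA μ p t f := by
  rw [normA_eq, normA_eq]
  gcongr
  exact fun r hr => ⟨hr.1, hr.2.trans hst⟩

theorem normA_const_mul {μ : Measure ℝ} {p : ℝ} (hp : 0 < p) (s : ℝ≥0∞) (c : ℂ) (f : ℂ → ℂ) :
    normA μ p s (fun z => c * f z) = ‖c‖ₑ * normA μ p s f := by
  have h1 : ∀ r, circMean (fun z => c * f z) p r = ‖c‖ₑ ^ p * circMean f p r := fun r => by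
    simp only [circMean, enorm_mul, ENNReal.mul_rpow_of_nonneg _ _ hp.le]
    rw [lintegral_const_mul' _ _ (by simp [hp.le])]
  rw [normA_eq, normA_eq]
  simp only [h1]
  rw [lintegral_const_mul' _ _ (by simp [hp.le]), ENNReal.mul_rpow_of_nonneg _ _ (by positivity),
    one_div, ENNReal.rpow_rpow_inv hp.ne']

/-- Every annulus at the boundary of the disc of radius `s` has positive mass. -/
def ChargesBoundary (μ : Measure ℝ) (s : ℝ≥0∞) : Prop :=
  ∀ t : ℝ, 0 ≤ t → ENNReal.ofReal t < s → μ {r : ℝ | t < r ∧ ENNReal.ofReal r < s} ≠ 0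

/-- Continuity of the measure from below. A charged annulus that ends before `s` lies inside the
discs of a sequence of radii tending to `s`, from some index on. -/
theorem ChargesBoundary.exists_le {μ : Measure ℝ} {s : ℝ≥0∞} (h : ChargesBoundary μ s) {t : ℝ}
    (ht : 0 ≤ t) (hts : ENNReal.ofReal t < s) :
    ∃ u < s, μ {r : ℝ | t < r ∧ ENNReal.ofReal r ≤ u} ≠ 0 := by
  obtain ⟨u, -, hu, hlim⟩ := exists_seq_strictMono_tendsto' hts
  by_contra! hcon
  refine h t ht hts (measure_mono_null (t := ⋃ n, {r : ℝ | t < r ∧ ENNReal.ofReal r ≤ u n}) ?_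
    (measure_iUnion_null fun n => hcon _ (hu n).2))
  rintro r ⟨hr, hrs⟩
  obtain ⟨n, hn⟩ := (hlim.eventually (lt_mem_nhds hrs)).exists
  exact mem_iUnion.2 ⟨n, hr, hn.le⟩

/-- Monotone means make the mean at `t'` times the mass of an annulus outside `t'` at most the norm
to the power `p`; a bound of the mean at `t' > t` controls the values on the disc of radius `t`. -/
theorem exists_bound_of_normA_le {μ : Measure ℝ} [IsFiniteMeasure μ] {p : ℝ} (hp : 0 < p)
    {s : ℝ≥0∞} (hμ : ChargesBoundary μ s) {f : ℕ → ℂ → ℂ}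
    (hf : ∀ n, AnalyticOnNhd ℂ (f n) (disc s)) {T : ℕ → ℝ≥0∞}
    (hT : Tendsto T atTop (𝓝 s)) {K : ℝ≥0∞} (hK : K ≠ ∞)
    (hb : ∀ᶠ n in atTop, normA μ p (T n) (f n) ≤ K) {t : ℝ} (ht : 0 < t)
    (hts : ENNReal.ofReal t < s) :
    ∃ B : ℝ, ∀ᶠ n in atTop, ∀ z ∈ closedBall (0 : ℂ) t, ‖f n z‖ ≤ B := by
  obtain ⟨t', htt', ht's⟩ := exists_lt_ofReal_lt ht.le hts
  have ht' : 0 < t' := ht.trans htt'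
  obtain ⟨u, hus, hu⟩ := hμ.exists_le ht'.le ht's
  set E := {r : ℝ | t' < r ∧ ENNReal.ofReal r ≤ u} with hE
  have hEm : MeasurableSet E := (measurableSet_lt measurable_const measurable_id).inter
    (measurableSet_le ENNReal.measurable_ofReal measurable_const)
  have hδ : 0 < t' - t := sub_pos.2 htt'
  have hδ0 : ENNReal.ofReal ((t' - t) ^ 2) ≠ 0 := by
    rw [Ne, ENNReal.ofReal_eq_zero, not_le]; positivity
  set B := ENNReal.ofReal (t' ^ 2) * (K ^ p / μ E) / ENNReal.ofReal ((t' - t) ^ 2) with hB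
  have hBtop : B ≠ ∞ := by
    refine ENNReal.div_ne_top (ENNReal.mul_ne_top ENNReal.ofReal_ne_top
      (ENNReal.div_ne_top ?_ hu)) hδ0
    exact ENNReal.rpow_ne_top_of_nonneg hp.le hK
  refine ⟨(B ^ (1 / p)).toReal, ?_⟩
  filter_upwards [hb, hT.eventually (lt_mem_nhds hus)] with n hn hun z hz
  have hzt : ‖z‖ ≤ t := by simpa using hz
  have h1 : circMean (f n) p t' * μ E ≤ K ^ p := by
    calc circMean (f n) p t' * μ E = ∫⁻ _ in E, circMean (f n) p t' ∂μ := by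
          rw [setLIntegral_const]
      _ ≤ ∫⁻ r in E, circMean (f n) p r ∂μ := by
          refine setLIntegral_mono' hEm fun r hr => ?_
          exact circMean_mono hp ht'.le hr.1.le
            ((hf n).mono (closedBall_subset_disc (hr.2.trans_lt hus)))
      _ ≤ ∫⁻ r in radii (T n), circMean (f n) p r ∂μ :=
          lintegral_mono_set fun r hr => ⟨ht'.trans hr.1, hr.2.trans hun.le⟩
      _ ≤ K ^ p := by
          rw [← normA_rpow hp]
          gcongr
  have h2 : circMean (f n) p t' ≤ K ^ p / μ E :=
    ENNReal.le_div_iff_mul_le (Or.inl hu) (Or.inl (measure_ne_top μ E)) |>.2 h1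
  have h3 := enorm_rpow_le_circMean (z := z) hp hδ (t := t') (by linarith)
    ((hf n).mono (closedBall_subset_disc ht's))
  have h4 : ‖f n z‖ₑ ^ p ≤ B := by
    rw [hB, ENNReal.le_div_iff_mul_le (Or.inl hδ0) (Or.inl ENNReal.ofReal_ne_top), mul_comm]
    refine h3.trans ?_
    gcongr
  have h5 : ‖f n z‖ₑ ≤ B ^ (1 / p) := by
    rw [one_div, ENNReal.le_rpow_inv_iff hp]; exact h4
  rw [← toReal_enorm]
  exact ENNReal.toReal_mono (ENNReal.rpow_ne_top_of_nonneg (by positivity) hBtop) h5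

/-- Fatou's lemma twice, in the angle and in the radius. The circle of radius `s`, where nothing is
known about `g`, is negligible because `s` is not an atom. -/
theorem normA_le_of_tendsto {μ : Measure ℝ} {p : ℝ} (hp : 0 < p)
    {s : ℝ≥0∞} (hμ : μ {r : ℝ | ENNReal.ofReal r = s} = 0) {f : ℕ → ℂ → ℂ} {g : ℂ → ℂ}
    (hf : ∀ n, ContinuousOn (f n) (disc s)) {T : ℕ → ℝ≥0∞} (hTs : ∀ n, T n < s)
    (hT : Tendsto T atTop (𝓝 s)) {K : ℕ → ℝ≥0∞} {L : ℝ≥0∞} (hK : Tendsto K atTop (𝓝 L))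
    (hb : ∀ n, normA μ p (T n) (f n) ≤ K n)
    (hg : ∀ z ∈ disc s, Tendsto (fun n => f n z) atTop (𝓝 (g z))) : normA μ p s g ≤ L := by
  rw [normA_eq, one_div, ENNReal.rpow_inv_le_iff hp]
  -- Outside the disc the values of `f n` are arbitrary; cutting them off makes the functions
  -- measurable.
  set h : ℕ → ℂ → ℂ := fun n => (disc s).indicator (f n) with hh
  have hm : ∀ n, Measurable (h n) := fun n =>
    measurable_indicator_of_continuousOn (hf n) (isOpen_disc s).measurableSet
  have hmem : ∀ r : ℝ, 0 < r → ENNReal.ofReal r < s → ∀ z : ℂ, ‖z‖ = |r| → z ∈ disc s :=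
    fun r hr hrs z hz => by rw [mem_disc, hz, abs_of_pos hr]; exact hrs
  have hne : ∀ᵐ r ∂μ, ENNReal.ofReal r ≠ s := measure_eq_zero_iff_ae_notMem.1 hμ
  calc ∫⁻ r in radii s, circMean g p r ∂μ
      ≤ ∫⁻ r in radii s, liminf (fun n => (radii (T n)).indicator (circMean (h n) p) r) atTop
          ∂μ := by
        refine lintegral_mono_ae ?_
        filter_upwards [ae_restrict_of_ae hne, ae_restrict_mem (measurableSet_radii s)]
          with r hr hrs
        have hlt : ENNReal.ofReal r < s := lt_of_le_of_ne hrs.2 hr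
        have h1 : liminf (fun n => (radii (T n)).indicator (circMean (h n) p) r) atTop =
            liminf (fun n => circMean (h n) p r) atTop := by
          refine liminf_congr ?_
          filter_upwards [hT.eventually (lt_mem_nhds hlt)] with n hn
          rw [indicator_of_mem]
          exact ⟨hrs.1, hn.le⟩
        rw [h1]
        refine le_trans ?_ (lintegral_liminf_le fun n =>
          ((hm n).comp (measurable_circlePoint r)).enorm.pow_const p)
        refine lintegral_mono fun θ => ?_
        have hz := hmem r hrs.1 hlt _ (norm_circlePoint r θ)
        have h2 : Tendsto (fun n => ‖h n (circlePoint r θ)‖ₑ ^ p) atTop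
            (𝓝 (‖g (circlePoint r θ)‖ₑ ^ p)) := by
          simp only [hh, indicator_of_mem hz]
          exact (ENNReal.continuous_rpow_const.tendsto _).comp
            ((continuous_enorm.tendsto _).comp (hg _ hz))
        exact h2.liminf_eq.ge
    _ ≤ liminf (fun n => ∫⁻ r in radii s, (radii (T n)).indicator (circMean (h n) p) r ∂μ) atTop :=
        lintegral_liminf_le fun n => (measurable_circMean (hm n) p).indicator
          (measurableSet_radii _)
    _ ≤ liminf (fun n => K n ^ p) atTop := by
        refine liminf_le_liminf (.of_forall fun n => ?_)
        rw [setLIntegral_indicator (measurableSet_radii _)]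
        calc ∫⁻ r in radii (T n) ∩ radii s, circMean (h n) p r ∂μ
            ≤ ∫⁻ r in radii (T n), circMean (h n) p r ∂μ := lintegral_mono_set inter_subset_left
          _ = ∫⁻ r in radii (T n), circMean (f n) p r ∂μ := by
            refine setLIntegral_congr_fun (measurableSet_radii _) fun r hr => ?_
            refine circMean_congr fun z hz => ?_
            simp only [hh]
            rw [indicator_of_mem (hmem r hr.1 (hr.2.trans_lt (hTs n)) z hz)]
          _ ≤ K n ^ p := by
            rw [← normA_rpow hp]
            have := hb n
            gcongr
    _ = L ^ p := ((ENNReal.continuous_rpow_const.tendsto _).comp hK).liminf_eq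

theorem le_of_mem_ratios {μ : Measure ℝ} {p : ℝ} (hp : 0 < p) {ρ s : ℝ≥0∞} {F : ℂ → ℂ}
    {x L : ℝ≥0∞} (hL : 0 < L) (hx : x ∈ ratios μ p ρ s F) (hLx : L ≤ x) :
    ∃ f, Competitor ρ s F f ∧ f 0 = 1 ∧ normA μ p s f ≤ L⁻¹ := by
  obtain ⟨f, hf, rfl⟩ := hx
  have hf0 : f 0 ≠ 0 := by
    rintro h0
    simp [h0, hL.ne'] at hLx
  have hf0' : ‖f 0‖ₑ ≠ 0 := by simpa using hf0
  refine ⟨fun z => (f 0)⁻¹ * f z, ⟨?_, ?_, ?_⟩, inv_mul_cancel₀ hf0, ?_⟩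
  · exact fun z hz => analyticAt_const.mul (hf.analytic z hz)
  · obtain ⟨z, hz, hne⟩ := hf.not_identically_zero
    exact ⟨z, hz, mul_ne_zero (inv_ne_zero hf0) hne⟩
  · intro z hz hz0
    -- Since `s ≤ ρ` is not assumed, `f` need not be analytic at `z`; its order is then `0` by
    -- convention, and so is that of `F`.
    by_cases hz' : AnalyticAt ℂ f z
    · have h1 : analyticOrderAt (fun z => (f 0)⁻¹ * f z) z = analyticOrderAt f z := by
        have : (fun z => (f 0)⁻¹ * f z) = (fun _ => (f 0)⁻¹) * f := rfl
        rw [this, analyticOrderAt_mul analyticAt_const hz',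
          analyticAt_const.analyticOrderAt_eq_zero.2 (inv_ne_zero hf0), zero_add]
      rw [h1]
      exact hf.vanishes z hz hz0
    · have := hf.vanishes z hz hz0
      rw [analyticOrderAt_of_not_analyticAt hz'] at this
      exact this.trans zero_le
  · rw [normA_const_mul hp, enorm_inv hf0]
    rw [ENNReal.le_inv_iff_mul_le]
    calc ‖f 0‖ₑ⁻¹ * normA μ p s f * L ≤ ‖f 0‖ₑ⁻¹ * normA μ p s f * (‖f 0‖ₑ / normA μ p s f) := by
          gcongr
      _ = (‖f 0‖ₑ⁻¹ * ‖f 0‖ₑ) * (normA μ p s f * (normA μ p s f)⁻¹) := by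
          rw [div_eq_mul_inv]; ring
      -- Inequalities rather than equalities, since `x * x⁻¹` is `0` for a norm `x` equal to `0` or
      -- `∞`.
      _ ≤ 1 * 1 := by
          gcongr
          · exact ENNReal.inv_mul_le_one _
          · exact ENNReal.mul_inv_le_one _
      _ = 1 := one_mul 1

/-- Limits of ratios over smaller discs are attained. -/
theorem exists_mem_ratios_of_tendsto {μ : Measure ℝ} [IsFiniteMeasure μ] {p : ℝ} (hp : 0 < p)
    {s : ℝ≥0∞} (hs : 0 < s) (hμ : ChargesBoundary μ s)
    (hatom : μ {r : ℝ | ENNReal.ofReal r = s} = 0) {F : ℂ → ℂ}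
    {T : ℕ → ℝ≥0∞} (hTs : ∀ n, T n < s) (hT : Tendsto T atTop (𝓝 s)) {L : ℕ → ℝ≥0∞} {M : ℝ≥0∞}
    (hM : 0 < M) (hL0 : ∀ n, 0 < L n) (hL : Tendsto L atTop (𝓝 M))
    (h : ∀ n, ∃ x ∈ ratios μ p s (T n) F, L n ≤ x) : ∃ x ∈ ratios μ p s s F, M ≤ x := by
  have h' : ∀ n, ∃ f, Competitor s (T n) F f ∧ f 0 = 1 ∧ normA μ p (T n) f ≤ (L n)⁻¹ := fun n => by
    obtain ⟨x, hx, hxL⟩ := h n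
    exact le_of_mem_ratios hp (hL0 n) hx hxL
  choose f hf hf0 hfL using h'
  have hLinv : Tendsto (fun n => (L n)⁻¹) atTop (𝓝 M⁻¹) := tendsto_inv_iff.2 hL
  -- `M = ∞` is not excluded here; positivity of `M` is what bounds the norms.
  obtain ⟨K, hMK, hK⟩ := exists_between (show M⁻¹ < ∞ by simpa using hM)
  have hKn : ∀ᶠ n in atTop, normA μ p (T n) (f n) ≤ K :=
    (hLinv.eventually (gt_mem_nhds hMK)).mono fun n hn => (hfL n).trans hn.le
  obtain ⟨g, φ, hφ, hg, hfg⟩ := exists_subseq_tendstoLocallyUniformlyOn hs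
    (fun n => (hf n).analytic)
    fun t ht hts => exists_bound_of_normA_le hp hμ (fun n => (hf n).analytic) hT hK.ne hKn ht hts
  have hpt : ∀ z ∈ disc s, Tendsto (fun n => f (φ n) z) atTop (𝓝 (g z)) :=
    fun z hz => hfg.tendsto_at hz
  have hg0 : g 0 = 1 := by
    refine tendsto_nhds_unique (hpt 0 (zero_mem_disc hs)) ?_
    simp [hf0]
  have hTφ := hT.comp hφ.tendsto_atTop
  have hnorm : normA μ p s g ≤ M⁻¹ :=
    normA_le_of_tendsto hp hatom (fun n => (hf (φ n)).analytic.continuousOn)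
      (fun n => hTs (φ n)) hTφ (hLinv.comp hφ.tendsto_atTop) (fun n => hfL (φ n)) hpt
  refine ⟨_, ⟨g, ⟨hg, ⟨0, zero_mem_disc hs, by simp [hg0]⟩, ?_⟩, rfl⟩, ?_⟩
  · intro z hz hz0
    refine le_analyticOrderAt_of_tendsto (isOpen_disc s) (fun n => (hf (φ n)).analytic) hg hfg hz ?_
    filter_upwards [hTφ.eventually (lt_mem_nhds hz)] with n hn
    exact (hf (φ n)).vanishes z hn hz0
  · rw [hg0, enorm_one, one_div, ENNReal.le_inv_iff_le_inv]
    exact hnorm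

theorem ratios_le_of_le {μ : Measure ℝ} {p : ℝ} (hp : 0 < p) {ρ s t : ℝ≥0∞} (hts : t ≤ s)
    {F : ℂ → ℂ} {x : ℝ≥0∞} (hx : x ∈ ratios μ p ρ s F) : ∃ y ∈ ratios μ p ρ t F, x ≤ y := by
  obtain ⟨f, hf, rfl⟩ := hx
  refine ⟨_, ⟨f, ⟨hf.analytic, hf.not_identically_zero, fun z hz hz0 =>
    hf.vanishes z (disc_mono hts hz) hz0⟩, rfl⟩, ?_⟩
  exact ENNReal.div_le_div_left (normA_mono hp hts f) _

theorem competitor_self {ρ s : ℝ≥0∞} (hρ : 0 < ρ) {F : ℂ → ℂ} (hF : AnalyticOnNhd ℂ F (disc ρ))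
    (hF0 : F 0 ≠ 0) : Competitor ρ s F F :=
  ⟨hF, ⟨0, zero_mem_disc hρ, hF0⟩, fun _ _ _ => le_rfl⟩

/-- The supremum is attained. -/
theorem isGreatest_ratios {μ : Measure ℝ} [IsFiniteMeasure μ] {p : ℝ} (hp : 0 < p)
    {s : ℝ≥0∞} (hs : 0 < s) (hμ : ChargesBoundary μ s)
    (hatom : μ {r : ℝ | ENNReal.ofReal r = s} = 0) {F : ℂ → ℂ}
    (hF : AnalyticOnNhd ℂ F (disc s)) (hF0 : F 0 ≠ 0) :
    IsGreatest (ratios μ p s s F) (sSup (ratios μ p s s F)) := by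
  refine ⟨?_, fun x hx => le_sSup hx⟩
  set M := sSup (ratios μ p s s F) with hMdef
  rcases (zero_le (a := M)).eq_or_lt with hM | hM
  · have h1 : ‖F 0‖ₑ / normA μ p s F ∈ ratios μ p s s F := ⟨F, competitor_self hs hF hF0, rfl⟩
    have h2 : ‖F 0‖ₑ / normA μ p s F ≤ M := le_sSup h1
    rw [← hM, nonpos_iff_eq_zero] at h2
    rw [← hM, ← h2]
    exact h1
  obtain ⟨T, -, hT, hTlim⟩ := exists_seq_strictMono_tendsto' hs
  obtain ⟨L, -, hL, hLlim⟩ := exists_seq_strictMono_tendsto' hM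
  obtain ⟨x, hx, hxM⟩ := exists_mem_ratios_of_tendsto hp hs hμ hatom (F := F)
    (fun n => (hT n).2) hTlim hM (fun n => (hL n).1) hLlim fun n => by
      obtain ⟨y, hy, hyL⟩ := lt_sSup_iff.1 (hL n).2
      obtain ⟨z, hz, hyz⟩ := ratios_le_of_le hp (hT n).2.le hy
      exact ⟨z, hz, hyL.le.trans hyz⟩
  have : x = M := le_antisymm (le_sSup hx) hxM
  rwa [← this]

/-- Suprema over smaller discs converge. -/
theorem sSup_ratios_eq_iInf {μ : Measure ℝ} [IsFiniteMeasure μ] {p : ℝ} (hp : 0 < p)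
    {s : ℝ≥0∞} (hs : 0 < s) (hμ : ChargesBoundary μ s)
    (hatom : μ {r : ℝ | ENNReal.ofReal r = s} = 0) {F : ℂ → ℂ}
    {T : ℕ → ℝ≥0∞} (hTs : ∀ n, T n < s) (hT : Tendsto T atTop (𝓝 s)) :
    sSup (ratios μ p s s F) = ⨅ n, sSup (ratios μ p s (T n) F) := by
  refine le_antisymm (le_iInf fun n => sSup_le fun x hx => ?_) ?_
  · obtain ⟨y, hy, hxy⟩ := ratios_le_of_le hp (hTs n).le hx
    exact hxy.trans (le_sSup hy)
  set M := ⨅ n, sSup (ratios μ p s (T n) F) with hMdef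
  rcases (zero_le (a := M)).eq_or_lt with hM | hM
  · rw [← hM]; exact zero_le
  obtain ⟨L, -, hL, hLlim⟩ := exists_seq_strictMono_tendsto' hM
  obtain ⟨x, hx, hxM⟩ := exists_mem_ratios_of_tendsto hp hs hμ hatom (F := F)
    hTs hT hM (fun n => (hL n).1) hLlim fun n => by
      obtain ⟨y, hy, hyL⟩ := lt_sSup_iff.1 ((hL n).2.trans_le (iInf_le _ n))
      exact ⟨y, hy, hyL.le⟩
  exact hxM.trans (le_sSup hx)

/-! ### Division and polynomial approximation -/

/-- An analytic function that vanishes on the zeros of `F` is a multiple of `F`. -/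
theorem exists_eq_mul_of_analyticOrderAt_le {U : Set ℂ} (hU : IsPreconnected U) {f F : ℂ → ℂ}
    (hf : AnalyticOnNhd ℂ f U) (hF : AnalyticOnNhd ℂ F U)
    (hF0 : ∃ z ∈ U, F z ≠ 0) (h : ∀ z ∈ U, analyticOrderAt F z ≤ analyticOrderAt f z) :
    ∃ g, AnalyticOnNhd ℂ g U ∧ ∀ z ∈ U, f z = F z * g z := by
  have htop : ∀ z ∈ U, analyticOrderAt F z ≠ ⊤ := by
    intro z hz htop
    obtain ⟨w, hw, hne⟩ := hF0
    exact hne (hF.eqOn_zero_of_preconnected_of_eventuallyEq_zero hU hz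
      (analyticOrderAt_eq_top.1 htop) hw)
  have hmer : MeromorphicOn (f / F) U := fun z hz =>
    (hf z hz).meromorphicAt.div (hF z hz).meromorphicAt
  -- The normal form of the quotient fills in its removable singularities; it is analytic where its
  -- order is nonnegative.
  have hNF := meromorphicNFOn_toMeromorphicNFOn (f / F) U
  have han : AnalyticOnNhd ℂ (toMeromorphicNFOn (f / F) U) U := by
    intro z hz
    rw [← (hNF hz).meromorphicOrderAt_nonneg_iff_analyticAt,
      meromorphicOrderAt_toMeromorphicNFOn hmer hz,
      meromorphicOrderAt_div (hf z hz).meromorphicAt (hF z hz).meromorphicAt,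
      (hf z hz).meromorphicOrderAt_eq, (hF z hz).meromorphicOrderAt_eq]
    have h1 := h z hz
    obtain ⟨m, hm⟩ := ENat.ne_top_iff_exists.1 (htop z hz)
    rw [← hm] at h1 ⊢
    rcases eq_or_ne (analyticOrderAt f z) ⊤ with htop' | htop'
    · simp [htop']
    · obtain ⟨n, hn⟩ := ENat.ne_top_iff_exists.1 htop'
      rw [← hn] at h1 ⊢
      have h2 : m ≤ n := by exact_mod_cast h1
      simp only [ENat.map_natCast]
      have h3 : (0 : ℤ) ≤ (n : ℤ) - m := by omega
      exact_mod_cast h3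
  refine ⟨toMeromorphicNFOn (f / F) U, han, fun z hz => ?_⟩
  have hne : ∀ᶠ w in 𝓝[≠] z, F w ≠ 0 := by
    rcases (hF z hz).eventually_eq_zero_or_eventually_ne_zero with h0 | h0
    · exact absurd (analyticOrderAt_eq_top.2 h0) (htop z hz)
    · exact h0
  have heq : f =ᶠ[𝓝[≠] z] F * toMeromorphicNFOn (f / F) U := by
    filter_upwards [hmer.toMeromorphicNFOn_eq_self_on_nhdsNE hz, hne] with w hw hFw
    rw [Pi.mul_apply, hw, Pi.div_apply, mul_div_cancel₀ _ hFw]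
  exact ((hf z hz).continuousAt.eventuallyEq_nhds_iff_eventuallyEq_nhdsNE
    ((hF z hz).mul (han z hz)).continuousAt |>.1 heq).eq_of_nhds

theorem exists_polynomial_near {g : ℂ → ℂ} {t : ℝ} (ht : 0 ≤ t) {ρ : ℝ≥0∞}
    (htρ : ENNReal.ofReal t < ρ) (hg : AnalyticOnNhd ℂ g (disc ρ)) {ε : ℝ} (hε : 0 < ε) :
    ∃ q : Polynomial ℂ, ∀ z ∈ closedBall (0 : ℂ) t, ‖g z - q.eval z‖ < ε := by
  obtain ⟨t₁, ht₁, ht₁ρ⟩ := exists_lt_ofReal_lt ht htρ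
  have ht₁0 : 0 ≤ t₁ := ht.trans ht₁.le
  obtain ⟨t₂, ht₂, ht₂ρ⟩ := exists_lt_ofReal_lt ht₁0 ht₁ρ
  lift t₁ to NNReal using ht₁0
  lift t₂ to NNReal using ht₁.le.trans (ht₂.le) |> ht.trans
  have hfs := DifferentiableOn.hasFPowerSeriesOnBall
    (hg.mono (closedBall_subset_disc ht₂ρ)).differentiableOn
    (show 0 < t₂ from (ht.trans_lt ht₁).trans ht₂ |> fun h => by exact_mod_cast h)
  have hu := hfs.tendstoUniformlyOn' (r' := t₁) (by exact_mod_cast ht₂)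
  obtain ⟨n, hn⟩ := ((Metric.tendstoUniformlyOn_iff.1 hu) ε hε).exists
  refine ⟨∑ k ∈ Finset.range n,
    Polynomial.C ((cauchyPowerSeries g 0 t₂).coeff k) * Polynomial.X ^ k, fun z hz => ?_⟩
  have hz' : z ∈ ball (0 : ℂ) t₁ := closedBall_subset_ball ht₁ hz
  have heval : (∑ k ∈ Finset.range n, Polynomial.C ((cauchyPowerSeries g 0 t₂).coeff k) *
      Polynomial.X ^ k).eval z = (cauchyPowerSeries g 0 t₂).partialSum n (z - 0) := by
    rw [sub_zero, Polynomial.eval_finsetSum, FormalMultilinearSeries.partialSum]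
    refine Finset.sum_congr rfl fun k _ => ?_
    rw [FormalMultilinearSeries.apply_eq_pow_smul_coeff, Polynomial.eval_mul, Polynomial.eval_C,
      Polynomial.eval_pow, Polynomial.eval_X, smul_eq_mul, mul_comm]
  rw [heval, ← dist_eq_norm]
  exact hn z hz'

/-- A sequence of polynomials that is dense for uniform convergence on closed discs. -/
theorem exists_dense_polynomials {t : ℝ} (ht : 0 ≤ t) : ∃ q : ℕ → Polynomial ℂ,
    ∀ (ρ : ℝ≥0∞) (g : ℂ → ℂ), ENNReal.ofReal t < ρ → AnalyticOnNhd ℂ g (disc ρ) →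
      ∀ ε : ℝ, 0 < ε → ∃ n, ∀ z ∈ closedBall (0 : ℂ) t, ‖g z - (q n).eval z‖ < ε := by
  let K := closedBall (0 : ℂ) t
  have : CompactSpace K := isCompact_iff_compactSpace.1 (isCompact_closedBall _ _)
  -- The continuous functions on a compact disc form a separable metric space, so the polynomials
  -- among them have a countable dense subset.
  let S : Set C(K, ℂ) := range fun q : Polynomial ℂ => q.toContinuousMapOn K
  have : Nonempty S := ⟨⟨_, mem_range_self 0⟩⟩
  let d := TopologicalSpace.denseSeq S
  have hd : DenseRange d := TopologicalSpace.denseRange_denseSeq S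
  choose q hq using fun n => (d n).2
  refine ⟨q, fun ρ g htρ hg ε hε => ?_⟩
  obtain ⟨r, hr⟩ := exists_polynomial_near ht htρ hg (half_pos hε)
  obtain ⟨n, hn⟩ := hd.exists_dist_lt (⟨r.toContinuousMapOn K, mem_range_self r⟩ : S) (half_pos hε)
  refine ⟨n, fun z hz => ?_⟩
  have h1 : dist (r.toContinuousMapOn K) ((q n).toContinuousMapOn K) < ε / 2 := by
    have := hq n
    simp only at this
    rw [this]
    exact hn
  have h2 : ‖r.eval z - (q n).eval z‖ < ε / 2 := by
    have := (ContinuousMap.dist_apply_le_dist (⟨z, hz⟩ : K)).trans_lt h1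
    rwa [dist_eq_norm] at this
  calc ‖g z - (q n).eval z‖ = ‖(g z - r.eval z) + (r.eval z - (q n).eval z)‖ := by ring_nf
    _ ≤ ‖g z - r.eval z‖ + ‖r.eval z - (q n).eval z‖ := norm_add_le _ _
    _ < ε := by linarith [hr z hz]

/-! ### Convergence of norms -/

theorem tendsto_circMean {h : ℕ → ℂ → ℂ} {g : ℂ → ℂ} {p r K : ℝ} (hp : 0 < p)
    (hc : ∀ n, ContinuousOn (h n) (sphere 0 |r|)) (hK : ∀ n, ∀ z ∈ sphere (0 : ℂ) |r|, ‖h n z‖ ≤ K)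
    (hlim : ∀ z ∈ sphere (0 : ℂ) |r|, Tendsto (fun n => h n z) atTop (𝓝 (g z))) :
    Tendsto (fun n => circMean (h n) p r) atTop (𝓝 (circMean g p r)) := by
  have hmem : ∀ θ, circlePoint r θ ∈ sphere (0 : ℂ) |r| := fun θ => by simp [norm_circlePoint]
  refine tendsto_lintegral_of_dominated_convergence (fun _ => ENNReal.ofReal K ^ p) (fun n => ?_)
    (fun n => ?_) ?_ ?_
  · have : Continuous fun θ => h n (circlePoint r θ) :=
      (hc n).comp_continuous (continuous_circlePoint.comp (Continuous.prodMk_right r)) hmem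
    exact this.measurable.enorm.pow_const p
  · refine ae_of_all _ fun θ => ?_
    dsimp only
    gcongr
    rw [← ofReal_norm]
    exact ENNReal.ofReal_le_ofReal (hK n _ (hmem θ))
  · rw [lintegral_const]
    simp [ENNReal.rpow_eq_top_iff, hp.not_gt]
  · exact ae_of_all _ fun θ => (ENNReal.continuous_rpow_const.tendsto _).comp
      ((continuous_enorm.tendsto _).comp (hlim _ (hmem θ)))

theorem aemeasurable_circMean {ν : Measure ℝ} {f : ℂ → ℂ} {p : ℝ} {S : Set ℂ}
    (hS : MeasurableSet S) (hν : ∀ᵐ r ∂ν, ∀ z : ℂ, ‖z‖ = |r| → z ∈ S) (hf : ContinuousOn f S) :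
    AEMeasurable (circMean f p) ν := by
  refine ⟨circMean (S.indicator f) p,
    measurable_circMean (measurable_indicator_of_continuousOn hf hS) p, ?_⟩
  filter_upwards [hν] with r hr
  exact circMean_congr fun z hz => (indicator_of_mem (hr z hz) f).symm

theorem tendsto_normA {μ : Measure ℝ} {p : ℝ} {s : ℝ≥0∞} {S : Set ℂ}
    (hS : MeasurableSet S) (hν : ∀ᵐ r ∂(μ.restrict (radii s)), ∀ z : ℂ, ‖z‖ = |r| → z ∈ S)
    {h : ℕ → ℂ → ℂ} {g : ℂ → ℂ} (hc : ∀ n, ContinuousOn (h n) S) (bound : ℝ → ℝ≥0∞)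
    (hbound : ∀ n, ∀ᵐ r ∂(μ.restrict (radii s)), circMean (h n) p r ≤ bound r)
    (hfin : ∫⁻ r in radii s, bound r ∂μ ≠ ∞)
    (hlim : ∀ᵐ r ∂(μ.restrict (radii s)),
      Tendsto (fun n => circMean (h n) p r) atTop (𝓝 (circMean g p r))) :
    Tendsto (fun n => normA μ p s (h n)) atTop (𝓝 (normA μ p s g)) := by
  simp only [normA_eq]
  refine (ENNReal.continuous_rpow_const.tendsto _).comp ?_
  exact tendsto_lintegral_of_dominated_convergence' bound
    (fun n => aemeasurable_circMean hS hν (hc n)) hbound hfin hlim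

theorem mem_closedBall_of_mem_radii {t r : ℝ} (ht : 0 ≤ t)
    (hr : r ∈ radii (ENNReal.ofReal t)) {z : ℂ}
    (hz : ‖z‖ = |r|) : z ∈ closedBall (0 : ℂ) t := by
  rw [mem_closedBall_zero_iff, hz, abs_of_pos hr.1]
  exact (ENNReal.ofReal_le_ofReal_iff ht).1 hr.2

theorem tendsto_normA_of_bounded {μ : Measure ℝ} [IsFiniteMeasure μ] {p t : ℝ} (hp : 0 < p)
    (ht : 0 ≤ t) {h : ℕ → ℂ → ℂ} {g : ℂ → ℂ} (hc : ∀ n, ContinuousOn (h n) (closedBall 0 t)) {K : ℝ}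
    (hK : ∀ n, ∀ z ∈ closedBall (0 : ℂ) t, ‖h n z‖ ≤ K)
    (hlim : ∀ z ∈ closedBall (0 : ℂ) t, Tendsto (fun n => h n z) atTop (𝓝 (g z))) :
    Tendsto (fun n => normA μ p (ENNReal.ofReal t) (h n)) atTop
      (𝓝 (normA μ p (ENNReal.ofReal t) g)) := by
  have hmem : ∀ r ∈ radii (ENNReal.ofReal t), sphere (0 : ℂ) |r| ⊆ closedBall 0 t :=
    fun r hr z hz => mem_closedBall_of_mem_radii ht hr (by simpa using hz)
  refine tendsto_normA measurableSet_closedBall ?_ hc (fun _ => ENNReal.ofReal K ^ p) ?_ ?_ ?_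
  · filter_upwards [ae_restrict_mem (measurableSet_radii _)] with r hr z hz
    exact mem_closedBall_of_mem_radii ht hr hz
  · intro n
    filter_upwards [ae_restrict_mem (measurableSet_radii _)] with r hr
    calc circMean (h n) p r ≤ ∫⁻ _ in Icc (0 : ℝ) 1, ENNReal.ofReal K ^ p := by
          refine lintegral_mono fun θ => ?_
          dsimp only
          gcongr
          rw [← ofReal_norm]
          exact ENNReal.ofReal_le_ofReal (hK n _ (hmem r hr (by simp [norm_circlePoint])))
      _ = _ := by simp
  · rw [lintegral_const]
    exact ENNReal.mul_ne_top (ENNReal.rpow_ne_top_of_nonneg hp.le ENNReal.ofReal_ne_top)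
      (measure_ne_top _ _)
  · filter_upwards [ae_restrict_mem (measurableSet_radii _)] with r hr
    exact tendsto_circMean hp (fun n => (hc n).mono (hmem r hr))
      (fun n z hz => hK n z (hmem r hr hz)) fun z hz => hlim z (hmem r hr hz)

/-! ### Countable suprema -/

/-- The zeros in a closed annulus starting at `t` form a compact set, and its element of least
modulus is strictly beyond `t`. -/
theorem exists_zeroFree_outside {F : ℂ → ℂ} {t : ℝ} {ρ : ℝ≥0∞} (ht : 0 < t)
    (htρ : ENNReal.ofReal t < ρ) (hF : ContinuousOn F (disc ρ)) (hnz : ∀ z, ‖z‖ = t → F z ≠ 0) :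
    ∃ t', t < t' ∧ ENNReal.ofReal t' ≤ ρ ∧ ∀ z, t ≤ ‖z‖ → ‖z‖ < t' → F z ≠ 0 := by
  obtain ⟨t₁, ht₁, ht₁ρ⟩ := exists_lt_ofReal_lt ht.le htρ
  set Z := {z ∈ closedBall (0 : ℂ) t₁ | t ≤ ‖z‖} ∩ F ⁻¹' {0} with hZ
  have hcl : IsClosed {z ∈ closedBall (0 : ℂ) t₁ | t ≤ ‖z‖} :=
    isClosed_closedBall.inter (isClosed_le continuous_const continuous_norm)
  have hZc : IsCompact Z := (isCompact_closedBall (0 : ℂ) t₁).of_isClosed_subset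
    ((hF.mono (fun z hz => closedBall_subset_disc ht₁ρ hz.1)).preimage_isClosed_of_isClosed hcl
      isClosed_singleton) fun z hz => hz.1.1
  rcases Z.eq_empty_or_nonempty with h | h
  · refine ⟨t₁, ht₁, ht₁ρ.le, fun z hz hz₁ h0 => ?_⟩
    have : z ∈ Z := ⟨⟨by simpa using hz₁.le, hz⟩, h0⟩
    simp [h] at this
  · obtain ⟨w, hw, hmin⟩ := hZc.exists_isMinOn h continuous_norm.continuousOn
    have hwt : t < ‖w‖ := lt_of_le_of_ne hw.1.2 fun h => hnz w h.symm hw.2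
    have hwt₁ : ‖w‖ ≤ t₁ := by simpa using hw.1.1
    refine ⟨‖w‖, hwt, (ENNReal.ofReal_le_ofReal hwt₁).trans ht₁ρ.le, fun z hz hz₁ h0 => ?_⟩
    have : z ∈ Z := ⟨⟨by simpa using hz₁.le.trans hwt₁, hz⟩, h0⟩
    exact absurd (hmin this) (not_le.2 hz₁)

theorem exists_zeroFree_inside {F : ℂ → ℂ} {t : ℝ} (ht : 0 < t)
    (hF : ContinuousOn F (closedBall 0 t)) (hnz : ∀ z, ‖z‖ = t → F z ≠ 0) :
    ∃ t', 0 < t' ∧ t' < t ∧ ∀ z, t' ≤ ‖z‖ → ‖z‖ ≤ t → F z ≠ 0 := by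
  set Z := closedBall (0 : ℂ) t ∩ F ⁻¹' {0} with hZ
  have hZc : IsCompact Z := (isCompact_closedBall (0 : ℂ) t).of_isClosed_subset
    (hF.preimage_isClosed_of_isClosed isClosed_closedBall isClosed_singleton) inter_subset_left
  rcases Z.eq_empty_or_nonempty with h | h
  · refine ⟨t / 2, by positivity, by linarith, fun z hz hz₁ h0 => ?_⟩
    have : z ∈ Z := ⟨by simpa using hz₁, h0⟩
    simp [h] at this
  · obtain ⟨w, hw, hmax⟩ := hZc.exists_isMaxOn h continuous_norm.continuousOn
    have hwt : ‖w‖ < t := lt_of_le_of_ne (by simpa using hw.1) fun h => hnz w h hw.2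
    refine ⟨(‖w‖ + t) / 2, by positivity, by linarith, fun z hz hz₁ h0 => ?_⟩
    have : z ∈ Z := ⟨by simpa using hz₁, h0⟩
    have := hmax this
    simp only [mem_ofPred_eq] at this
    linarith

/-- The supremum of the ratios over the multiples of `F` by the polynomials `q n`. -/
noncomputable def polySup (μ : Measure ℝ) (p : ℝ) (s : ℝ≥0∞) (q : ℕ → Polynomial ℂ)
    (F : ℂ → ℂ) : ℝ≥0∞ :=
  ⨆ n, ‖F 0 * (q n).eval 0‖ₑ / normA μ p s fun z => F z * (q n).eval z

theorem analyticAt_polynomial_eval (q : Polynomial ℂ) (z : ℂ) :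
    AnalyticAt ℂ (fun w => q.eval w) z := by
  simpa using AnalyticAt.aeval_polynomial (analyticAt_id (𝕜 := ℂ) (z := z)) q

theorem polySup_le_sSup_ratios {μ : Measure ℝ} {p : ℝ} {ρ s : ℝ≥0∞} {F : ℂ → ℂ} (hρ : 0 < ρ)
    (hsρ : s ≤ ρ) (hF : AnalyticOnNhd ℂ F (disc ρ)) (q : ℕ → Polynomial ℂ) :
    polySup μ p s q F ≤ sSup (ratios μ p ρ s F) := by
  refine iSup_le fun n => ?_
  by_cases h0 : F 0 * (q n).eval 0 = 0
  · simp [h0]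
  refine le_sSup ⟨fun z => F z * (q n).eval z, ⟨fun z hz =>
    (hF z hz).mul (analyticAt_polynomial_eval _ z), ⟨0, zero_mem_disc hρ, h0⟩,
    fun z hz _ => ?_⟩, rfl⟩
  have : (fun z => F z * (q n).eval z) = F * fun z => (q n).eval z := rfl
  rw [this, analyticOrderAt_mul (hF z (disc_mono hsρ hz)) (analyticAt_polynomial_eval _ z)]
  exact le_self_add

/-! ### Reduction of the suprema to polynomial multiples -/

section Dense

variable {t : ℝ} {q : ℕ → Polynomial ℂ}

/-- Because `F` has no zeros in a thin annulus outside the circle, `f / F` is analytic on a disc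
larger than the closed one. Polynomials approximate it uniformly there, and numerator and norm
converge. -/
theorem ratio_le_polySup {μ : Measure ℝ} [IsFiniteMeasure μ] {p : ℝ} (hp : 0 < p) (ht : 0 < t)
    (hq : ∀ (ρ : ℝ≥0∞) (g : ℂ → ℂ), ENNReal.ofReal t < ρ → AnalyticOnNhd ℂ g (disc ρ) →
      ∀ ε : ℝ, 0 < ε → ∃ n, ∀ z ∈ closedBall (0 : ℂ) t, ‖g z - (q n).eval z‖ < ε)
    {ρ : ℝ≥0∞} (htρ : ENNReal.ofReal t < ρ) {F f : ℂ → ℂ} (hF : AnalyticOnNhd ℂ F (disc ρ))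
    (hF0 : F 0 ≠ 0) (hnz : ∀ z, ‖z‖ = t → F z ≠ 0) (hf : AnalyticOnNhd ℂ f (disc ρ))
    (hv : VanishesOnZeros (ENNReal.ofReal t) F f) :
    ‖f 0‖ₑ / normA μ p (ENNReal.ofReal t) f ≤ polySup μ p (ENNReal.ofReal t) q F := by
  by_cases hf0 : f 0 = 0
  · simp [hf0]
  obtain ⟨t', htt', ht'ρ, hnz'⟩ := exists_zeroFree_outside ht htρ hF.continuousOn hnz
  have ht'pos : 0 < ENNReal.ofReal t' := ENNReal.ofReal_pos.2 (ht.trans htt')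
  have htt'2 : ENNReal.ofReal t < ENNReal.ofReal t' :=
    (ENNReal.ofReal_lt_ofReal_iff (ht.trans htt')).2 htt'
  have hF' := hF.mono (disc_mono ht'ρ)
  obtain ⟨g, hg, hfg⟩ := exists_eq_mul_of_analyticOrderAt_le (isPreconnected_disc _)
    (hf.mono (disc_mono ht'ρ)) hF' ⟨0, zero_mem_disc ht'pos, hF0⟩ fun z hz => by
      by_cases hFz : F z = 0
      · have hzt : ‖z‖ < t := by
          by_contra hcon
          refine hnz' z (not_lt.1 hcon) ?_ hFz
          exact (ENNReal.ofReal_lt_ofReal_iff (ht.trans htt')).1 (mem_disc.1 hz)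
        refine hv z (mem_disc.2 ((ENNReal.ofReal_lt_ofReal_iff ht).2 hzt)) ?_
        rintro rfl
        exact hF0 hFz
      · rw [(hF' z hz).analyticOrderAt_eq_zero.2 hFz]
        exact zero_le
  have hball := closedBall_subset_disc htt'2
  choose k hk using fun j : ℕ => hq _ g htt'2 hg (1 / ((j : ℝ) + 1)) (by positivity)
  obtain ⟨A, hA⟩ := (isCompact_closedBall (0 : ℂ) t).exists_bound_of_continuousOn
    (hF'.continuousOn.mono hball)
  obtain ⟨B, hB⟩ := (isCompact_closedBall (0 : ℂ) t).exists_bound_of_continuousOn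
    (hg.continuousOn.mono hball)
  have hqlim : ∀ z ∈ closedBall (0 : ℂ) t, Tendsto (fun j => F z * (q (k j)).eval z) atTop
      (𝓝 (f z)) := by
    intro z hz
    rw [hfg z (hball hz)]
    refine Tendsto.const_mul _ ?_
    rw [tendsto_iff_norm_sub_tendsto_zero]
    refine squeeze_zero (fun _ => norm_nonneg _) (fun j => ?_)
      tendsto_one_div_add_atTop_nhds_zero_nat
    rw [norm_sub_rev]
    exact (hk j z hz).le
  have hnorm := tendsto_normA_of_bounded (μ := μ) (p := p) hp ht.le
    (h := fun j z => F z * (q (k j)).eval z) (g := f) (K := A * (B + 1))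
    (fun j => (hF'.continuousOn.mono hball).mul
      (fun z _ => (analyticAt_polynomial_eval _ z).continuousAt.continuousWithinAt))
    (fun j z hz => by
      rw [norm_mul]
      have h1 : ‖(q (k j)).eval z‖ ≤ B + 1 := by
        have h2 := (hk j z hz).le
        have h3 : 1 / ((j : ℝ) + 1) ≤ 1 := by
          rw [div_le_one (by positivity)]; linarith [(Nat.cast_nonneg j : (0 : ℝ) ≤ j)]
        have h4 : ‖(q (k j)).eval z‖ ≤ ‖g z‖ + ‖g z - (q (k j)).eval z‖ := by
          rw [norm_sub_rev]
          calc ‖(q (k j)).eval z‖ = ‖g z + ((q (k j)).eval z - g z)‖ := by ring_nf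
            _ ≤ _ := norm_add_le _ _
        linarith [hB z hz]
      have h5 := hA z hz
      have h6 : 0 ≤ A := (norm_nonneg _).trans h5
      gcongr) hqlim
  have hnum : Tendsto (fun j => ‖F 0 * (q (k j)).eval 0‖ₑ) atTop (𝓝 ‖f 0‖ₑ) :=
    (continuous_enorm.tendsto _).comp (hqlim 0 (by simp [ht.le]))
  have hdiv := ENNReal.Tendsto.div hnum (Or.inl (by simpa using hf0)) hnorm (Or.inr enorm_ne_top)
  exact le_of_tendsto' hdiv fun j => le_iSup (fun n => ‖F 0 * (q n).eval 0‖ₑ /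
    normA μ p (ENNReal.ofReal t) fun z => F z * (q n).eval z) (k j)

theorem sSup_ratios_eq_polySup {μ : Measure ℝ} [IsFiniteMeasure μ] {p : ℝ} (hp : 0 < p) (ht : 0 < t)
    (hq : ∀ (ρ : ℝ≥0∞) (g : ℂ → ℂ), ENNReal.ofReal t < ρ → AnalyticOnNhd ℂ g (disc ρ) →
      ∀ ε : ℝ, 0 < ε → ∃ n, ∀ z ∈ closedBall (0 : ℂ) t, ‖g z - (q n).eval z‖ < ε)
    {ρ : ℝ≥0∞} (htρ : ENNReal.ofReal t < ρ) {F : ℂ → ℂ} (hF : AnalyticOnNhd ℂ F (disc ρ))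
    (hF0 : F 0 ≠ 0) (hnz : ∀ z, ‖z‖ = t → F z ≠ 0) :
    sSup (ratios μ p ρ (ENNReal.ofReal t) F) = polySup μ p (ENNReal.ofReal t) q F := by
  refine le_antisymm (sSup_le ?_) (polySup_le_sSup_ratios (pos_of_gt htρ) htρ.le hF q)
  rintro x ⟨f, hf, rfl⟩
  exact ratio_le_polySup hp ht hq htρ hF hF0 hnz hf.analytic hf.vanishes

theorem circMean_dilation (g : ℂ → ℂ) (p κ r : ℝ) :
    circMean (fun z => g ((κ : ℂ) * z)) p r = circMean g p (κ * r) := by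
  simp only [circMean, circlePoint]
  push_cast
  simp only [mul_assoc]

theorem circMean_le_mul {f g : ℂ → ℂ} {p r K : ℝ} (hp : 0 < p)
    (h : ∀ z, ‖z‖ = |r| → ‖f z‖ ≤ K * ‖g z‖) :
    circMean f p r ≤ ENNReal.ofReal K ^ p * circMean g p r := by
  simp only [circMean]
  rw [← lintegral_const_mul' _ _ (ENNReal.rpow_ne_top_of_nonneg hp.le ENNReal.ofReal_ne_top)]
  refine lintegral_mono fun θ => ?_
  dsimp only
  rw [← ENNReal.mul_rpow_of_nonneg _ _ hp.le]
  gcongr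
  rw [← ofReal_norm, ← ofReal_norm, ← ENNReal.ofReal_mul' (norm_nonneg _)]
  exact ENNReal.ofReal_le_ofReal (h _ (norm_circlePoint r θ))

/-- The functions analytic on the smaller disc do not give larger ratios. -/
theorem ratio_le_polySup_of_ne {μ : Measure ℝ} [IsFiniteMeasure μ] {p : ℝ} (hp : 0 < p) (ht : 0 < t)
    (hq : ∀ (ρ : ℝ≥0∞) (g : ℂ → ℂ), ENNReal.ofReal t < ρ → AnalyticOnNhd ℂ g (disc ρ) →
      ∀ ε : ℝ, 0 < ε → ∃ n, ∀ z ∈ closedBall (0 : ℂ) t, ‖g z - (q n).eval z‖ < ε)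
    {ρ : ℝ≥0∞} (htρ : ENNReal.ofReal t < ρ) {F f : ℂ → ℂ} (hF : AnalyticOnNhd ℂ F (disc ρ))
    (hF0 : F 0 ≠ 0) (hnz : ∀ z, ‖z‖ = t → F z ≠ 0)
    (hatom : μ {r : ℝ | ENNReal.ofReal r = ENNReal.ofReal t} = 0)
    (hf : AnalyticOnNhd ℂ f (disc (ENNReal.ofReal t)))
    (hv : VanishesOnZeros (ENNReal.ofReal t) F f) :
    ‖f 0‖ₑ / normA μ p (ENNReal.ofReal t) f ≤ polySup μ p (ENNReal.ofReal t) q F := by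
  by_cases hf0 : f 0 = 0
  · simp [hf0]
  by_cases hN : normA μ p (ENNReal.ofReal t) f = ∞
  · simp [hN]
  have htpos : 0 < ENNReal.ofReal t := ENNReal.ofReal_pos.2 ht
  have hmemt : ∀ z : ℂ, z ∈ disc (ENNReal.ofReal t) ↔ ‖z‖ < t := fun z => by
    rw [mem_disc, ENNReal.ofReal_lt_ofReal_iff ht]
  have hF' := hF.mono (disc_mono htρ.le)
  obtain ⟨g, hg, hfg⟩ := exists_eq_mul_of_analyticOrderAt_le (isPreconnected_disc _) hf hF'
      ⟨0, zero_mem_disc htpos, hF0⟩ fun z hz => by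
      rcases eq_or_ne z 0 with rfl | hz0
      · rw [(hF' 0 hz).analyticOrderAt_eq_zero.2 hF0]
        exact zero_le
      · exact hv z hz hz0
  have hball := closedBall_subset_disc htρ
  obtain ⟨t₁, ht₁, ht₁t, hann⟩ := exists_zeroFree_inside ht (hF.continuousOn.mono hball) hnz
  have ht₁d : closedBall (0 : ℂ) t₁ ⊆ disc (ENNReal.ofReal t) :=
    closedBall_subset_disc ((ENNReal.ofReal_lt_ofReal_iff ht).2 ht₁t)
  obtain ⟨A, hA⟩ := (isCompact_closedBall (0 : ℂ) t).exists_bound_of_continuousOn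
    (hF.continuousOn.mono hball)
  obtain ⟨B, hB⟩ := (isCompact_closedBall (0 : ℂ) t₁).exists_bound_of_continuousOn
    (hg.continuousOn.mono ht₁d)
  obtain ⟨C, hC⟩ : ∃ C : ℝ, ∀ z, t₁ ≤ ‖z‖ → ‖z‖ ≤ t → ‖(F z)⁻¹‖ ≤ C := by
    have hcomp : IsCompact (closedBall (0 : ℂ) t ∩ {z | t₁ ≤ ‖z‖}) :=
      (isCompact_closedBall _ _).inter_right (isClosed_le continuous_const continuous_norm)
    obtain ⟨C, hC⟩ := hcomp.exists_bound_of_continuousOn (f := fun z => (F z)⁻¹)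
      ((hF.continuousOn.mono (inter_subset_left.trans hball)).inv₀
        fun z hz => hann z hz.2 (by simpa using hz.1))
    exact ⟨C, fun z h1 h2 => hC z ⟨by simpa using h2, h1⟩⟩
  -- Dilation factors increasing to `1`; the shift by `2` keeps even the first one positive.
  set κ : ℕ → ℝ := fun n => 1 - 1 / ((n : ℝ) + 2) with hκ
  have hκ0 : ∀ n, 0 < κ n := fun n => by
    rw [hκ, sub_pos, div_lt_one (by positivity)]
    linarith [(Nat.cast_nonneg n : (0 : ℝ) ≤ n)]
  have hκ1 : ∀ n, κ n < 1 := fun n => by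
    have : 0 < 1 / ((n : ℝ) + 2) := by positivity
    simp only [hκ]; linarith
  have hκlim : Tendsto κ atTop (𝓝 1) := by
    have h1 : Tendsto (fun n : ℕ => 1 / ((n : ℝ) + 2)) atTop (𝓝 0) :=
      tendsto_const_nhds.div_atTop (tendsto_atTop_add_const_right _ _ tendsto_natCast_atTop_atTop)
    simpa [hκ] using h1.const_sub 1
  have hnκ : ∀ n, ∀ z : ℂ, ‖(κ n : ℂ) * z‖ = κ n * ‖z‖ := fun n z => by
    rw [norm_mul, Complex.norm_real, Real.norm_of_nonneg (hκ0 n).le]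
  have hnκle : ∀ n, ∀ z : ℂ, ‖(κ n : ℂ) * z‖ ≤ ‖z‖ := fun n z => by
    rw [hnκ]; exact mul_le_of_le_one_left (norm_nonneg _) (hκ1 n).le
  set h : ℕ → ℂ → ℂ := fun n z => F z * g ((κ n : ℂ) * z) with hh
  -- Only the quotient `g` is dilated, so `h n` keeps the zeros of `F` and the value at `0`, and it
  -- is analytic on a disc of radius larger than `t`.
  have hratio : ∀ n, ‖f 0‖ₑ / normA μ p (ENNReal.ofReal t) (h n) ≤
      polySup μ p (ENNReal.ofReal t) q F := by
    intro n
    have hlt : t < t / κ n := by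
      rw [lt_div_iff₀ (hκ0 n)]; nlinarith [hκ1 n]
    have hn0 : h n 0 = f 0 := by
      rw [hfg 0 (zero_mem_disc htpos)]; simp [hh]
    rw [← hn0]
    have hgd : ∀ z ∈ disc (min ρ (ENNReal.ofReal (t / κ n))),
        AnalyticAt ℂ (fun z => g ((κ n : ℂ) * z)) z := by
      intro z hz
      refine (hg _ ((hmemt _).2 ?_)).comp_of_eq (by fun_prop) rfl
      have h2 := (lt_min_iff.1 (mem_disc.1 hz)).2
      rw [ENNReal.ofReal_lt_ofReal_iff (ht.trans hlt), lt_div_iff₀ (hκ0 n)] at h2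
      rw [hnκ]; linarith
    have hFd : AnalyticOnNhd ℂ F (disc (min ρ (ENNReal.ofReal (t / κ n)))) :=
      hF.mono (disc_mono (min_le_left _ _))
    have hlt' : ENNReal.ofReal t < min ρ (ENNReal.ofReal (t / κ n)) :=
      lt_min htρ ((ENNReal.ofReal_lt_ofReal_iff (ht.trans hlt)).2 hlt)
    refine ratio_le_polySup hp ht hq hlt' hFd hF0 hnz (fun z hz => (hFd z hz).mul (hgd z hz)) ?_
    intro z hz _
    have hz' := disc_mono hlt'.le hz
    have : h n = F * fun z => g ((κ n : ℂ) * z) := rfl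
    rw [this, analyticOrderAt_mul (hFd z hz') (hgd z hz')]
    exact le_self_add
  have hcont : ∀ n, ContinuousOn (h n) (disc (ENNReal.ofReal t)) := fun n =>
    hF'.continuousOn.mul (hg.continuousOn.comp (by fun_prop) fun z hz =>
      (hmemt _).2 ((hnκle n z).trans_lt ((hmemt z).1 hz)))
  have hrad : ∀ᵐ r ∂(μ.restrict (radii (ENNReal.ofReal t))), 0 < r ∧ r < t := by
    filter_upwards [ae_restrict_mem (measurableSet_radii _),
      ae_restrict_of_ae (measure_eq_zero_iff_ae_notMem.1 hatom)] with r hr hne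
    exact ⟨hr.1, lt_of_le_of_ne ((ENNReal.ofReal_le_ofReal_iff ht.le).1 hr.2)
      fun h => hne (congrArg ENNReal.ofReal h)⟩
  have hnorm : Tendsto (fun n => normA μ p (ENNReal.ofReal t) (h n)) atTop
      (𝓝 (normA μ p (ENNReal.ofReal t) f)) := by
    -- Domination. For `r ≤ t₁`, `F` and `g` are bounded. For `r ≥ t₁`, monotone means remove the
    -- dilation from `g`, and the lower bound of `|F|` compares `g` with `f`, whose norm is finite.
    refine tendsto_normA (isOpen_disc (ENNReal.ofReal t)).measurableSet ?_ hcont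
      (fun r => ENNReal.ofReal (A * B) ^ p +
        ENNReal.ofReal A ^ p * (ENNReal.ofReal C ^ p * circMean f p r)) ?_ ?_ ?_
    · filter_upwards [hrad] with r hr z hz
      rw [hmemt, hz, abs_of_pos hr.1]
      exact hr.2
    · intro n
      filter_upwards [hrad] with r hr
      have hrn : ∀ z : ℂ, ‖z‖ = |r| → ‖z‖ = r := fun z hz => by rw [hz, abs_of_pos hr.1]
      have hA0 : 0 ≤ A := (norm_nonneg _).trans (hA 0 (by simp [ht.le]))
      have hFA : ∀ z : ℂ, ‖z‖ = |r| → ‖F z‖ ≤ A := fun z hz =>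
        hA z (by simpa [hrn z hz] using hr.2.le)
      rcases le_total r t₁ with hrt | hrt
      · refine le_add_right ?_
        have := circMean_le_mul (f := h n) (g := fun _ => 1) (K := A * B) (r := r) hp fun z hz => by
          rw [norm_one, mul_one, norm_mul]
          refine mul_le_mul (hFA z hz) (hB _ ?_) (norm_nonneg _) hA0
          rw [mem_closedBall_zero_iff]
          exact (hnκle n z).trans ((hrn z hz).le.trans hrt)
        refine this.trans (le_of_eq ?_)
        simp [circMean]
      · refine le_add_left ?_
        calc circMean (h n) p r
            ≤ ENNReal.ofReal A ^ p * circMean (fun z => g ((κ n : ℂ) * z)) p r := by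
              refine circMean_le_mul hp fun z hz => ?_
              rw [norm_mul]
              gcongr
              exact hFA z hz
          _ ≤ ENNReal.ofReal A ^ p * circMean g p r := by
              rw [circMean_dilation]
              gcongr
              refine circMean_mono hp (mul_nonneg (hκ0 n).le hr.1.le)
                (mul_le_of_le_one_left hr.1.le (hκ1 n).le) (hg.mono ?_)
              exact closedBall_subset_disc ((ENNReal.ofReal_lt_ofReal_iff ht).2 hr.2)
          _ ≤ _ := by
              gcongr
              refine circMean_le_mul hp fun z hz => ?_
              have hFz : F z ≠ 0 :=
                hann z (by rw [hrn z hz]; exact hrt) (by rw [hrn z hz]; exact hr.2.le)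
              have hgz : g z = (F z)⁻¹ * f z := by
                rw [hfg z ((hmemt z).2 (by rw [hrn z hz]; exact hr.2)), inv_mul_cancel_left₀ hFz]
              rw [hgz, norm_mul]
              gcongr
              exact hC z (by rw [hrn z hz]; exact hrt) (by rw [hrn z hz]; exact hr.2.le)
    · rw [lintegral_add_left measurable_const, lintegral_const_mul' _ _
        (ENNReal.rpow_ne_top_of_nonneg hp.le ENNReal.ofReal_ne_top), lintegral_const_mul' _ _
        (ENNReal.rpow_ne_top_of_nonneg hp.le ENNReal.ofReal_ne_top), ← normA_rpow hp,
        lintegral_const]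
      refine ENNReal.add_ne_top.2 ⟨ENNReal.mul_ne_top (ENNReal.rpow_ne_top_of_nonneg hp.le
        ENNReal.ofReal_ne_top) (measure_ne_top _ _), ?_⟩
      exact ENNReal.mul_ne_top (ENNReal.rpow_ne_top_of_nonneg hp.le ENNReal.ofReal_ne_top)
        (ENNReal.mul_ne_top (ENNReal.rpow_ne_top_of_nonneg hp.le ENNReal.ofReal_ne_top)
          (ENNReal.rpow_ne_top_of_nonneg hp.le hN))
    · filter_upwards [hrad] with r hr
      have hsub : closedBall (0 : ℂ) r ⊆ disc (ENNReal.ofReal t) :=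
        closedBall_subset_disc ((ENNReal.ofReal_lt_ofReal_iff ht).2 hr.2)
      have hsph : sphere (0 : ℂ) |r| ⊆ closedBall 0 r := by
        rw [abs_of_pos hr.1]; exact sphere_subset_closedBall
      obtain ⟨D, hD⟩ := (isCompact_closedBall (0 : ℂ) r).exists_bound_of_continuousOn
        (hg.continuousOn.mono hsub)
      refine tendsto_circMean (K := A * D) hp (fun n => (hcont n).mono (hsph.trans hsub))
        (fun n z hz => ?_) fun z hz => ?_
      · have hz' : ‖z‖ ≤ r := by simpa using hsph hz
        have hFz := hA z (by simpa using hz'.trans hr.2.le)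
        rw [norm_mul]
        refine mul_le_mul hFz (hD _ ?_) (norm_nonneg _) ((norm_nonneg _).trans hFz)
        rw [mem_closedBall_zero_iff]
        exact (hnκle n z).trans hz'
      · have hzd := hsub (hsph hz)
        rw [hfg z hzd]
        refine Tendsto.const_mul _ ?_
        refine (hg z hzd).continuousAt.tendsto.comp ?_
        have : Tendsto (fun n => (κ n : ℂ) * z) atTop (𝓝 (((1 : ℝ) : ℂ) * z)) :=
          ((Complex.continuous_ofReal.tendsto _).comp hκlim).mul_const z
        simpa using this
  have hdiv := ENNReal.Tendsto.div (tendsto_const_nhds (x := ‖f 0‖ₑ) (f := atTop))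
    (Or.inl (by simpa using hf0)) hnorm (Or.inr enorm_ne_top)
  exact le_of_tendsto' hdiv hratio

theorem sSup_ratios_eq_polySup_of_ne {μ : Measure ℝ} [IsFiniteMeasure μ] {p : ℝ} (hp : 0 < p)
    (ht : 0 < t)
    (hq : ∀ (ρ : ℝ≥0∞) (g : ℂ → ℂ), ENNReal.ofReal t < ρ → AnalyticOnNhd ℂ g (disc ρ) →
      ∀ ε : ℝ, 0 < ε → ∃ n, ∀ z ∈ closedBall (0 : ℂ) t, ‖g z - (q n).eval z‖ < ε)
    {ρ : ℝ≥0∞} (htρ : ENNReal.ofReal t < ρ) {F : ℂ → ℂ} (hF : AnalyticOnNhd ℂ F (disc ρ))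
    (hF0 : F 0 ≠ 0) (hnz : ∀ z, ‖z‖ = t → F z ≠ 0)
    (hatom : μ {r : ℝ | ENNReal.ofReal r = ENNReal.ofReal t} = 0) :
    sSup (ratios μ p (ENNReal.ofReal t) (ENNReal.ofReal t) F) =
      polySup μ p (ENNReal.ofReal t) q F := by
  refine le_antisymm (sSup_le ?_) (polySup_le_sSup_ratios (ENNReal.ofReal_pos.2 ht) le_rfl
    (hF.mono (disc_mono htρ.le)) q)
  rintro x ⟨f, hf, rfl⟩
  exact ratio_le_polySup_of_ne hp ht hq htρ hF hF0 hnz hatom hf.analytic hf.vanishes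

end Dense

/-! ### The standard complex Gaussian distribution -/

/-- The density of `stdComplexGaussian`. -/
noncomputable def gaussDensity (z : ℂ) : ℝ≥0∞ := ENNReal.ofReal (Real.exp (-‖z‖ ^ 2) / Real.pi)

theorem stdComplexGaussian_eq : stdComplexGaussian = volume.withDensity gaussDensity := rfl

theorem measurable_gaussDensity : Measurable gaussDensity := by
  unfold gaussDensity; fun_prop

/-- A Gamma integral in polar coordinates. The exponents `0`, `-1`, `1` and `2` are the ones needed.
-/
theorem lintegral_enorm_rpow_gaussian {q : ℝ} (hq : -2 < q) :
    ∫⁻ z, ‖z‖ₑ ^ q ∂stdComplexGaussian = ENNReal.ofReal (Real.Gamma ((q + 2) / 2)) := by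
  have hval := Complex.integral_rpow_mul_exp_neg_rpow (p := 2) (by norm_num) hq
  have hpos : 0 < (2 * Real.pi / 2) * Real.Gamma ((q + 2) / 2) :=
    mul_pos (by positivity) (Real.Gamma_pos_of_pos (by linarith))
  -- The integral of a non-integrable function is `0` by convention, so the positive value proves
  -- integrability.
  have hint : Integrable fun z : ℂ => ‖z‖ ^ q * Real.exp (-‖z‖ ^ (2 : ℝ)) := by
    by_contra hcon
    rw [integral_undef hcon] at hval
    exact hpos.ne hval
  rw [stdComplexGaussian_eq, lintegral_withDensity_eq_lintegral_mul _ measurable_gaussDensity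
    (by fun_prop)]
  have h1 : ∀ᵐ z : ℂ ∂volume, (gaussDensity * (fun w : ℂ => ‖w‖ₑ ^ q)) z =
      ENNReal.ofReal (Real.pi⁻¹ * (‖z‖ ^ q * Real.exp (-‖z‖ ^ (2 : ℝ)))) := by
    have h0 : ∀ᵐ z : ℂ ∂volume, z ≠ 0 := by
      simp [ae_iff]
    filter_upwards [h0] with z hz
    rw [Pi.mul_apply, gaussDensity, ← ofReal_norm, ENNReal.ofReal_rpow_of_pos (norm_pos_iff.2 hz),
      ← ENNReal.ofReal_mul (by positivity)]
    congr 1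
    rw [Real.rpow_two]
    ring
  rw [lintegral_congr_ae h1, ← ofReal_integral_eq_lintegral_ofReal (hint.const_mul _)
    (ae_of_all _ fun z => by positivity), integral_const_mul, hval]
  congr 1
  field_simp

instance : IsProbabilityMeasure stdComplexGaussian := ⟨by
  have := lintegral_enorm_rpow_gaussian (q := 0) (by norm_num)
  simpa using this⟩

theorem lintegral_enorm_inv_gaussian :
    ∫⁻ z, ‖z‖ₑ⁻¹ ∂stdComplexGaussian = ENNReal.ofReal (Real.sqrt Real.pi) := by
  have := lintegral_enorm_rpow_gaussian (q := -1) (by norm_num)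
  rw [show ((-1 : ℝ) + 2) / 2 = 1 / 2 by norm_num, Real.Gamma_one_half_eq] at this
  simpa only [ENNReal.rpow_neg_one] using this

theorem lintegral_enorm_gaussian :
    ∫⁻ z, ‖z‖ₑ ∂stdComplexGaussian = ENNReal.ofReal (Real.sqrt Real.pi) / 2 := by
  have := lintegral_enorm_rpow_gaussian (q := 1) (by norm_num)
  rw [show ((1 : ℝ) + 2) / 2 = 1 / 2 + 1 by norm_num, Real.Gamma_add_one (by norm_num),
    Real.Gamma_one_half_eq] at this
  simp only [ENNReal.rpow_one] at this
  rw [this, one_div, inv_mul_eq_div, ENNReal.ofReal_div_of_pos (by norm_num)]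
  simp

theorem lintegral_enorm_sq_gaussian : ∫⁻ z, ‖z‖ₑ ^ 2 ∂stdComplexGaussian = 1 := by
  have := lintegral_enorm_rpow_gaussian (q := 2) (by norm_num)
  rw [show ((2 : ℝ) + 2) / 2 = 2 by norm_num, Real.Gamma_two] at this
  simpa using this

theorem MeasurePreserving.withDensity {α : Type*} [MeasurableSpace α] {ν : Measure α} {T : α → α}
    (hT : MeasurePreserving T ν ν) {D : α → ℝ≥0∞} (hD : Measurable D) (h : ∀ x, D (T x) = D x) :
    MeasurePreserving T (ν.withDensity D) (ν.withDensity D) := by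
  refine ⟨hT.measurable, ?_⟩
  ext s hs
  rw [Measure.map_apply hT.measurable hs, withDensity_apply _ (hT.measurable hs),
    withDensity_apply _ hs, ← hT.setLIntegral_comp_preimage hs hD]
  simp only [h]

theorem measurePreserving_neg_gaussian :
    MeasurePreserving (fun z : ℂ => -z) stdComplexGaussian stdComplexGaussian :=
  MeasurePreserving.withDensity ((LinearIsometryEquiv.neg ℝ (E := ℂ)).measurePreserving)
    measurable_gaussDensity fun z => by
      simp only [LinearIsometryEquiv.coe_neg, norm_neg]

/-! ### Unitary invariance of the Gaussian law on `ℂ²` -/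

theorem norm_sq_add_norm_sq_rotation {α β : ℂ} (h : ‖α‖ ^ 2 + ‖β‖ ^ 2 = 1) (z w : ℂ) :
    ‖α * z + β * w‖ ^ 2 + ‖-(starRingEnd ℂ β) * z + starRingEnd ℂ α * w‖ ^ 2 =
      ‖z‖ ^ 2 + ‖w‖ ^ 2 := by
  simp only [Complex.sq_norm, Complex.normSq_apply, Complex.add_re, Complex.add_im, Complex.mul_re,
    Complex.mul_im, Complex.neg_re, Complex.neg_im, Complex.conj_re, Complex.conj_im] at h ⊢
  linear_combination (z.re * z.re + z.im * z.im + (w.re * w.re + w.im * w.im)) * h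

/-- A unitary transformation of `ℂ²`. -/
noncomputable def rotation (α β : ℂ) (x : ℂ × ℂ) : ℂ × ℂ :=
  (α * x.1 + β * x.2, -(starRingEnd ℂ β) * x.1 + starRingEnd ℂ α * x.2)

theorem rotation_add (α β : ℂ) (x y : ℂ × ℂ) :
    rotation α β (x + y) = rotation α β x + rotation α β y := by
  ext1 <;> simp only [rotation, Prod.fst_add, Prod.snd_add] <;> ring

theorem rotation_smul (α β : ℂ) (c : ℝ) (x : ℂ × ℂ) :
    rotation α β (c • x) = c • rotation α β x := by
  ext1 <;> simp only [rotation, Prod.smul_fst, Prod.smul_snd, Complex.real_smul] <;> ring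

theorem measurePreserving_rotation_volume {α β : ℂ} (h : ‖α‖ ^ 2 + ‖β‖ ^ 2 = 1) :
    MeasurePreserving (rotation α β) (volume : Measure (ℂ × ℂ)) volume := by
  -- The rotation is an isometry for the Euclidean norm, not for the maximum norm of the product,
  -- hence the passage through `WithLp 2`.
  let L : WithLp 2 (ℂ × ℂ) →ₗ[ℝ] WithLp 2 (ℂ × ℂ) :=
    { toFun := fun x => WithLp.toLp 2 (rotation α β (WithLp.ofLp x))
      map_add' := fun x y => congrArg (WithLp.toLp 2) (rotation_add α β x.ofLp y.ofLp)
      map_smul' := fun c x => congrArg (WithLp.toLp 2) (rotation_smul α β c x.ofLp) }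
  let e := LinearIsometry.toLinearIsometryEquiv (⟨L, fun x => by
    rw [← sq_eq_sq₀ (norm_nonneg _) (norm_nonneg _), WithLp.prod_norm_sq_eq_of_L2,
      WithLp.prod_norm_sq_eq_of_L2]
    exact norm_sq_add_norm_sq_rotation h _ _⟩ : WithLp 2 (ℂ × ℂ) →ₗᵢ[ℝ] WithLp 2 (ℂ × ℂ)) rfl
  have h1 := WithLp.volume_preserving_symm_measurableEquiv_toLp_prod ℂ ℂ
  exact (h1.comp e.measurePreserving).comp (h1.symm _)

/-- The product density depends only on `|z|² + |w|²`, which the rotation preserves along with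
Lebesgue measure. -/
theorem measurePreserving_rotation {α β : ℂ} (h : ‖α‖ ^ 2 + ‖β‖ ^ 2 = 1) :
    MeasurePreserving (rotation α β) (stdComplexGaussian.prod stdComplexGaussian)
      (stdComplexGaussian.prod stdComplexGaussian) := by
  have h1 : stdComplexGaussian.prod stdComplexGaussian =
      (volume : Measure (ℂ × ℂ)).withDensity fun z => gaussDensity z.1 * gaussDensity z.2 := by
    rw [stdComplexGaussian_eq]
    have : SFinite ((volume : Measure ℂ).withDensity gaussDensity) := by
      rw [← stdComplexGaussian_eq]; infer_instance
    rw [prod_withDensity measurable_gaussDensity measurable_gaussDensity, Measure.volume_eq_prod]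
  rw [h1]
  have hD : Measurable fun z : ℂ × ℂ => gaussDensity z.1 * gaussDensity z.2 :=
    (measurable_gaussDensity.comp measurable_fst).mul (measurable_gaussDensity.comp measurable_snd)
  refine MeasurePreserving.withDensity (measurePreserving_rotation_volume h) hD fun x => ?_
  have hmul : ∀ a b : ℂ, gaussDensity a * gaussDensity b =
      ENNReal.ofReal (Real.exp (-(‖a‖ ^ 2 + ‖b‖ ^ 2)) / Real.pi ^ 2) := fun a b => by
    rw [gaussDensity, gaussDensity, ← ENNReal.ofReal_mul (by positivity), neg_add, Real.exp_add]
    congr 1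
    ring
  rw [hmul, hmul]
  congr 4
  exact norm_sq_add_norm_sq_rotation h x.1 x.2

/-- The law of `σ` times a standard complex Gaussian. -/
noncomputable def scaledGaussian (σ : ℝ) : Measure ℂ :=
  stdComplexGaussian.map fun z => (σ : ℂ) * z

/-- A rotation turns the linear form into a multiple of the first coordinate. -/
theorem map_add_eq_scaledGaussian {σ : ℝ} (c : ℂ) :
    (stdComplexGaussian.prod stdComplexGaussian).map (fun x => (σ : ℂ) * x.1 + c * x.2) =
      scaledGaussian (Real.sqrt (σ ^ 2 + ‖c‖ ^ 2)) := by
  set τ := Real.sqrt (σ ^ 2 + ‖c‖ ^ 2) with hτ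
  have hτ2 : τ ^ 2 = σ ^ 2 + ‖c‖ ^ 2 := Real.sq_sqrt (by positivity)
  rcases (Real.sqrt_nonneg (σ ^ 2 + ‖c‖ ^ 2)).eq_or_lt with h0 | h0
  · rw [← hτ] at h0
    rw [← h0] at hτ2
    have hσ : σ = 0 := by nlinarith [sq_nonneg σ, sq_nonneg ‖c‖]
    have hc : c = 0 := by
      rw [← norm_eq_zero]; nlinarith [sq_nonneg σ, sq_nonneg ‖c‖]
    simp [scaledGaussian, ← h0, hσ, hc, Measure.map_const]
  rw [← hτ] at h0
  have hτc : (τ : ℂ) ≠ 0 := by exact_mod_cast h0.ne'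
  have hαβ : ‖(σ : ℂ) / τ‖ ^ 2 + ‖c / τ‖ ^ 2 = 1 := by
    rw [norm_div, norm_div, Complex.norm_real, Complex.norm_real,
      Real.norm_of_nonneg h0.le, div_pow, div_pow, Real.norm_eq_abs, sq_abs, ← add_div, ← hτ2]
    exact div_self (by positivity)
  have hfun : (fun x : ℂ × ℂ => (σ : ℂ) * x.1 + c * x.2) =
      (fun z : ℂ => (τ : ℂ) * z) ∘ Prod.fst ∘ rotation ((σ : ℂ) / τ) (c / τ) := by
    ext x
    simp only [rotation, Function.comp_apply]
    field_simp
  rw [hfun, ← Measure.map_map (by fun_prop) (measurable_fst.comp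
    (measurePreserving_rotation hαβ).measurable), ← Measure.map_map measurable_fst
    (measurePreserving_rotation hαβ).measurable, (measurePreserving_rotation hαβ).map_eq]
  have := Measure.fst_prod (μ := stdComplexGaussian) (ν := stdComplexGaussian)
  rw [Measure.fst] at this
  rw [this, scaledGaussian]

/-- Averaging over `y` and `-y` removes the mixed term by the parallelogram law, so everything stays
nonnegative. -/
theorem lintegral_enorm_add_sq_gaussian_le (u v : ℂ) :
    ∫⁻ y, ‖u + v * y‖ₑ ^ 2 ∂stdComplexGaussian ≤ ‖u‖ₑ ^ 2 + ‖v‖ₑ ^ 2 := by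
  have hneg : ∫⁻ y, ‖u + v * y‖ₑ ^ 2 ∂stdComplexGaussian =
      ∫⁻ y, ‖u + v * -y‖ₑ ^ 2 ∂stdComplexGaussian :=
    (measurePreserving_neg_gaussian.lintegral_comp (f := fun y => ‖u + v * y‖ₑ ^ 2)
      (by fun_prop)).symm
  have hpar : ∀ y : ℂ, ‖u + v * y‖ₑ ^ 2 + ‖u + v * -y‖ₑ ^ 2 =
      2 * ‖u‖ₑ ^ 2 + 2 * ‖v‖ₑ ^ 2 * ‖y‖ₑ ^ 2 := fun y => by
    have hsq : ∀ x : ℂ, ‖x‖ₑ ^ 2 = ENNReal.ofReal (‖x‖ ^ 2) := fun x => by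
      rw [← ofReal_norm, ENNReal.ofReal_pow (norm_nonneg _)]
    rw [hsq, hsq, hsq, hsq, hsq, show (2 : ℝ≥0∞) = ENNReal.ofReal 2 by simp,
      ← ENNReal.ofReal_add (by positivity) (by positivity), ← ENNReal.ofReal_mul (by positivity),
      ← ENNReal.ofReal_mul (by positivity), ← ENNReal.ofReal_mul (by positivity),
      ← ENNReal.ofReal_add (by positivity) (by positivity)]
    congr 1
    simp only [Complex.sq_norm, Complex.normSq_apply, Complex.add_re, Complex.add_im,
      Complex.mul_re, Complex.mul_im, Complex.neg_re, Complex.neg_im]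
    ring
  have h2 : 2 * ∫⁻ y, ‖u + v * y‖ₑ ^ 2 ∂stdComplexGaussian = 2 * (‖u‖ₑ ^ 2 + ‖v‖ₑ ^ 2) := by
    rw [two_mul]
    nth_rewrite 2 [hneg]
    rw [← lintegral_add_left (by fun_prop)]
    simp only [hpar]
    rw [lintegral_add_left (by fun_prop), lintegral_const_mul (2 * ‖v‖ₑ ^ 2) (by fun_prop),
      lintegral_enorm_sq_gaussian]
    simp [mul_add]
  exact ((ENNReal.mul_right_inj (by simp) (by simp)).1 h2).le

theorem enorm_le_half_one_add_sq (z : ℂ) : ‖z‖ₑ ≤ 2⁻¹ * (1 + ‖z‖ₑ ^ 2) := by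
  rw [← ofReal_norm, ← ENNReal.ofReal_pow (norm_nonneg _),
    show (2⁻¹ : ℝ≥0∞) = ENNReal.ofReal 2⁻¹ by rw [ENNReal.ofReal_inv_of_pos (by simp)]; simp,
    show (1 : ℝ≥0∞) = ENNReal.ofReal 1 by simp, ← ENNReal.ofReal_add (by simp) (by positivity),
    ← ENNReal.ofReal_mul (by positivity)]
  exact ENNReal.ofReal_le_ofReal (by nlinarith [sq_nonneg (‖z‖ - 1)])

/-- Rotated coordinates `y` make the denominator `τ |y₁|` and the numerator `|ᾱ y₁ - β y₂|`. With
`y₁` fixed, `|u| ≤ (1 + |u|²) / 2` bounds the mean of the numerator by second moments; what remains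
are the moments of `1 / |y₁|` and `|y₁|`. -/
theorem lintegral_enorm_div_gaussian_le {c : ℂ} {σ : ℝ} (h : 0 < ‖c‖ ^ 2 + σ ^ 2) :
    ∫⁻ x, ‖x.1‖ₑ * ‖c * x.1 + σ * x.2‖ₑ⁻¹ ∂(stdComplexGaussian.prod stdComplexGaussian) ≤
      ENNReal.ofReal (Real.sqrt Real.pi) / ENNReal.ofReal (Real.sqrt (‖c‖ ^ 2 + σ ^ 2)) := by
  set τ := Real.sqrt (‖c‖ ^ 2 + σ ^ 2) with hτ
  have hτ2 : τ ^ 2 = ‖c‖ ^ 2 + σ ^ 2 := Real.sq_sqrt h.le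
  have h0 : 0 < τ := Real.sqrt_pos.2 h
  have hτc : (τ : ℂ) ≠ 0 := by exact_mod_cast h0.ne'
  set α : ℂ := c / τ with hα
  set β : ℂ := (σ : ℂ) / τ with hβ
  have hαβ : ‖α‖ ^ 2 + ‖β‖ ^ 2 = 1 := by
    rw [hα, hβ, norm_div, norm_div, Complex.norm_real, Complex.norm_real, Real.norm_of_nonneg h0.le,
      div_pow, div_pow, Real.norm_eq_abs, sq_abs, ← add_div, ← hτ2]
    exact div_self (by positivity)
  have hαβ' : α * starRingEnd ℂ α + β * starRingEnd ℂ β = 1 := by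
    rw [Complex.mul_conj', Complex.mul_conj']
    exact_mod_cast hαβ
  let g : ℂ × ℂ → ℝ≥0∞ := fun y => ‖starRingEnd ℂ α * y.1 + (-β) * y.2‖ₑ * ‖(τ : ℂ) * y.1‖ₑ⁻¹
  have hg : Measurable g := by fun_prop
  have hcomp : ∀ x : ℂ × ℂ, ‖x.1‖ₑ * ‖c * x.1 + σ * x.2‖ₑ⁻¹ = g (rotation α β x) := fun x => by
    have e1 : starRingEnd ℂ α * (rotation α β x).1 + (-β) * (rotation α β x).2 = x.1 := by
      simp only [rotation]
      linear_combination x.1 * hαβ'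
    have e2 : (τ : ℂ) * (rotation α β x).1 = c * x.1 + σ * x.2 := by
      simp only [rotation, hα, hβ]
      field_simp
    simp only [g, e1, e2]
  simp only [hcomp]
  rw [(measurePreserving_rotation hαβ).lintegral_comp hg, lintegral_prod _ hg.aemeasurable]
  have hτe : ‖(τ : ℂ)‖ₑ = ENNReal.ofReal τ := by
    rw [← ofReal_norm, Complex.norm_real, Real.norm_of_nonneg h0.le]
  have hα1 : ‖starRingEnd ℂ α‖ₑ ^ 2 = ENNReal.ofReal (‖α‖ ^ 2) := by
    rw [← ofReal_norm, RCLike.norm_conj, ENNReal.ofReal_pow (norm_nonneg _)]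
  have hβ1 : ‖-β‖ₑ ^ 2 = ENNReal.ofReal (‖β‖ ^ 2) := by
    rw [← ofReal_norm, norm_neg, ENNReal.ofReal_pow (norm_nonneg _)]
  have hone : ENNReal.ofReal (‖α‖ ^ 2) + ENNReal.ofReal (‖β‖ ^ 2) = 1 := by
    rw [← ENNReal.ofReal_add (by positivity) (by positivity), hαβ, ENNReal.ofReal_one]
  set A := ENNReal.ofReal (‖α‖ ^ 2)
  set B := ENNReal.ofReal (‖β‖ ^ 2)
  have hinner : ∀ x : ℂ, ∫⁻ y, g (x, y) ∂stdComplexGaussian ≤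
      (ENNReal.ofReal τ)⁻¹ * (2⁻¹ * ((1 + B) * ‖x‖ₑ⁻¹ + A * ‖x‖ₑ)) := fun x => by
    have e1 : ∫⁻ y, ‖starRingEnd ℂ α * x + (-β) * y‖ₑ ∂stdComplexGaussian ≤
        2⁻¹ * (1 + (A * ‖x‖ₑ ^ 2 + B)) := by
      calc _ ≤ ∫⁻ y, 2⁻¹ * (1 + ‖starRingEnd ℂ α * x + (-β) * y‖ₑ ^ 2) ∂stdComplexGaussian :=
            lintegral_mono fun y => enorm_le_half_one_add_sq _
        _ = 2⁻¹ * (1 + ∫⁻ y, ‖starRingEnd ℂ α * x + (-β) * y‖ₑ ^ 2 ∂stdComplexGaussian) := by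
            rw [lintegral_const_mul _ (by fun_prop), lintegral_add_left (by fun_prop)]
            simp
        _ ≤ _ := by
            gcongr
            refine (lintegral_enorm_add_sq_gaussian_le _ _).trans_eq ?_
            rw [enorm_mul, mul_pow, hα1, hβ1]
    have e2 : ‖x‖ₑ ^ 2 * ‖x‖ₑ⁻¹ = ‖x‖ₑ := by
      rcases eq_or_ne x 0 with rfl | hx
      · simp
      · rw [sq, mul_assoc, ENNReal.mul_inv_cancel (by simpa using hx) enorm_ne_top, mul_one]
    calc ∫⁻ y, g (x, y) ∂stdComplexGaussian
        = (∫⁻ y, ‖starRingEnd ℂ α * x + (-β) * y‖ₑ ∂stdComplexGaussian) * ‖(τ : ℂ) * x‖ₑ⁻¹ :=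
          lintegral_mul_const ‖(τ : ℂ) * x‖ₑ⁻¹
            (f := fun y : ℂ => ‖starRingEnd ℂ α * x + (-β) * y‖ₑ) (by fun_prop)
      _ ≤ 2⁻¹ * (1 + (A * ‖x‖ₑ ^ 2 + B)) * ((ENNReal.ofReal τ)⁻¹ * ‖x‖ₑ⁻¹) := by
          rw [enorm_mul, hτe, ENNReal.mul_inv (Or.inr enorm_ne_top)
            (Or.inl ENNReal.ofReal_ne_top)]
          gcongr
      _ = (ENNReal.ofReal τ)⁻¹ * (2⁻¹ * ((1 + B) * ‖x‖ₑ⁻¹ + A * (‖x‖ₑ ^ 2 * ‖x‖ₑ⁻¹))) := by ring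
      _ = _ := by rw [e2]
  set S := ENNReal.ofReal (Real.sqrt Real.pi) with hS
  calc ∫⁻ x, ∫⁻ y, g (x, y) ∂stdComplexGaussian ∂stdComplexGaussian
      ≤ ∫⁻ x, (ENNReal.ofReal τ)⁻¹ * (2⁻¹ * ((1 + B) * ‖x‖ₑ⁻¹ + A * ‖x‖ₑ)) ∂stdComplexGaussian :=
        lintegral_mono hinner
    _ = (ENNReal.ofReal τ)⁻¹ * (2⁻¹ * ((1 + B) * S + A * (S / 2))) := by
        rw [lintegral_const_mul _ (by fun_prop), lintegral_const_mul _ (by fun_prop),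
          lintegral_add_left (by fun_prop), lintegral_const_mul _ (by fun_prop),
          lintegral_const_mul _ (by fun_prop), lintegral_enorm_inv_gaussian,
          lintegral_enorm_gaussian]
    -- With `S / 2` enlarged to `S`, the relation `A + B = 1` makes the bracket `2 S`.
    _ ≤ (ENNReal.ofReal τ)⁻¹ * (2⁻¹ * ((1 + B) * S + A * S)) := by
        gcongr
        exact ENNReal.half_le_self
    _ = S / ENNReal.ofReal τ := by
        rw [← add_mul, show 1 + B + A = 1 + (A + B) by ring, hone, one_add_one_eq_two,
          ← mul_assoc 2⁻¹, ENNReal.inv_mul_cancel (by simp) (by simp), one_mul, mul_comm,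
          div_eq_mul_inv]

/-! ### Linear combinations of independent Gaussian variables -/

section Independent

variable {Ω : Type*} [MeasurableSpace Ω] {P : Measure Ω} {ζ : ℕ → Ω → ℂ}

theorem indepFun_sum (hm : ∀ n, Measurable (ζ n)) (hind : iIndepFun ζ P) (c : ℕ → ℂ)
    {s : Finset ℕ} {i : ℕ} (hi : i ∉ s) :
    IndepFun (fun ω => ∑ n ∈ s, c n * ζ n ω) (ζ i) P := by
  classical
  -- a scaling of the other variables keeps independence
  let ξ : ℕ → Ω → ℂ := fun n => (fun z => (if n = i then 1 else c n) * z) ∘ ζ n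
  have hξ : iIndepFun ξ P := hind.comp _ fun n => measurable_const_mul _
  have h1 := hξ.indepFun_finsetSum_of_notMem (fun n => (measurable_const_mul _).comp (hm n)) hi
  have h2 : (∑ j ∈ s, ξ j) = fun ω => ∑ n ∈ s, c n * ζ n ω := by
    ext ω
    rw [Finset.sum_apply]
    refine Finset.sum_congr rfl fun n hn => ?_
    have : n ≠ i := fun h => hi (h ▸ hn)
    simp [ξ, this]
  have h3 : ξ i = ζ i := by
    ext ω; simp [ξ]
  rwa [h2, h3] at h1

theorem map_sum_eq_scaledGaussian [IsProbabilityMeasure P] (hm : ∀ n, Measurable (ζ n))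
    (hζ : ∀ n, P.map (ζ n) = stdComplexGaussian) (hind : iIndepFun ζ P) (c : ℕ → ℂ)
    (s : Finset ℕ) :
    P.map (fun ω => ∑ n ∈ s, c n * ζ n ω) =
      scaledGaussian (Real.sqrt (∑ n ∈ s, ‖c n‖ ^ 2)) := by
  classical
  induction s using Finset.induction_on with
  | empty => simp [scaledGaussian, Measure.map_const]
  | insert i s hi ih =>
    have hms : Measurable fun ω => ∑ n ∈ s, c n * ζ n ω :=
      Finset.measurable_sum _ fun n _ => (hm n).const_mul _
    have h1 := (indepFun_iff_map_prod_eq_prod_map_map hms.aemeasurable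
      (hm i).aemeasurable).1 (indepFun_sum hm hind c hi)
    rw [ih, hζ i] at h1
    have hfun : (fun ω => ∑ n ∈ insert i s, c n * ζ n ω) =
        (fun x : ℂ × ℂ => x.1 + c i * x.2) ∘ fun ω => (∑ n ∈ s, c n * ζ n ω, ζ i ω) := by
      ext ω
      simp [Finset.sum_insert hi, add_comm]
    rw [hfun, ← Measure.map_map (by fun_prop) (hms.prodMk (hm i)), h1, scaledGaussian]
    have h2 := Measure.map_prod_map stdComplexGaussian stdComplexGaussian
      (f := fun z : ℂ => (Real.sqrt (∑ n ∈ s, ‖c n‖ ^ 2) : ℂ) * z) (g := fun z : ℂ => z)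
      (by fun_prop) (by fun_prop)
    rw [Measure.map_id'] at h2
    rw [h2, Measure.map_map (by fun_prop) (by fun_prop)]
    have h3 := map_add_eq_scaledGaussian (σ := Real.sqrt (∑ n ∈ s, ‖c n‖ ^ 2)) (c i)
    rw [Real.sq_sqrt (by positivity), add_comm (∑ n ∈ s, ‖c n‖ ^ 2),
      ← Finset.sum_insert (f := fun n => ‖c n‖ ^ 2) hi] at h3
    exact h3

/-- The terms other than the zeroth add up to a Gaussian variable independent of `ζ 0`, which
reduces the claim to two variables. -/
theorem lintegral_enorm_div_sum_le [IsProbabilityMeasure P] (hm : ∀ n, Measurable (ζ n))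
    (hζ : ∀ n, P.map (ζ n) = stdComplexGaussian) (hind : iIndepFun ζ P) {c : ℕ → ℂ} (hc : c 0 ≠ 0)
    (N : ℕ) :
    ∫⁻ ω, ‖ζ 0 ω‖ₑ * ‖∑ n ∈ Finset.range (N + 1), c n * ζ n ω‖ₑ⁻¹ ∂P ≤
      ENNReal.ofReal (Real.sqrt Real.pi) /
        (∑ n ∈ Finset.range (N + 1), ‖c n‖ₑ ^ 2) ^ (1 / 2 : ℝ) := by
  set s := (Finset.range (N + 1)).erase 0 with hs
  have h0 : (0 : ℕ) ∈ Finset.range (N + 1) := by simp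
  have hms : Measurable fun ω => ∑ n ∈ s, c n * ζ n ω :=
    Finset.measurable_sum _ fun n _ => (hm n).const_mul _
  set σ := Real.sqrt (∑ n ∈ s, ‖c n‖ ^ 2) with hσ
  have hlaw : P.map (fun ω => (ζ 0 ω, ∑ n ∈ s, c n * ζ n ω)) =
      (stdComplexGaussian.prod stdComplexGaussian).map
        (Prod.map (fun z => z) fun z => (σ : ℂ) * z) := by
    rw [(indepFun_iff_map_prod_eq_prod_map_map (hm 0).aemeasurable hms.aemeasurable).1
      (indepFun_sum hm hind c (Finset.notMem_erase 0 _)).symm, hζ 0,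
      map_sum_eq_scaledGaussian hm hζ hind, ← Measure.map_prod_map _ _ (by fun_prop) (by fun_prop),
      Measure.map_id', scaledGaussian]
  have hpos : 0 < ‖c 0‖ ^ 2 + σ ^ 2 := by
    have := norm_pos_iff.2 hc
    positivity
  have hF : Measurable fun x : ℂ × ℂ => ‖x.1‖ₑ * ‖c 0 * x.1 + x.2‖ₑ⁻¹ := by fun_prop
  calc ∫⁻ ω, ‖ζ 0 ω‖ₑ * ‖∑ n ∈ Finset.range (N + 1), c n * ζ n ω‖ₑ⁻¹ ∂P
      = ∫⁻ x, ‖x.1‖ₑ * ‖c 0 * x.1 + x.2‖ₑ⁻¹ ∂(P.map fun ω => (ζ 0 ω, ∑ n ∈ s, c n * ζ n ω)) := by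
        rw [lintegral_map hF ((hm 0).prodMk hms)]
        refine lintegral_congr fun ω => ?_
        rw [Finset.add_sum_erase _ (fun n => c n * ζ n ω) h0]
    _ = ∫⁻ x, ‖x.1‖ₑ * ‖c 0 * x.1 + σ * x.2‖ₑ⁻¹
          ∂(stdComplexGaussian.prod stdComplexGaussian) := by
        rw [hlaw, lintegral_map hF (by fun_prop)]
        rfl
    _ ≤ _ := lintegral_enorm_div_gaussian_le hpos
    _ = _ := by
        rw [hσ, Real.sq_sqrt (by positivity), Finset.add_sum_erase _ (fun n => ‖c n‖ ^ 2) h0,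
          Real.sqrt_eq_rpow (∑ n ∈ Finset.range (N + 1), ‖c n‖ ^ 2),
          ← ENNReal.ofReal_rpow_of_nonneg (by positivity) (by norm_num),
          ENNReal.ofReal_sum_of_nonneg fun n _ => by positivity]
        have hsum : ∑ n ∈ Finset.range (N + 1), ENNReal.ofReal (‖c n‖ ^ 2) =
            ∑ n ∈ Finset.range (N + 1), ‖c n‖ₑ ^ 2 := Finset.sum_congr rfl fun n _ => by
          rw [← ofReal_norm, ENNReal.ofReal_pow (norm_nonneg _)]
        rw [hsum]

end Independent

/-! ### Random power series -/

theorem summable_mul_pow {a : ℕ → ℝ} (ha : ∀ n, 0 ≤ a n) {R : ℝ≥0∞}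
    (hR : R⁻¹ = limsup (fun n : ℕ => ENNReal.ofReal (a n ^ (1 / (n : ℝ)))) atTop) {r : ℝ}
    (hr : 0 ≤ r) (hrR : ENNReal.ofReal r < R) : Summable fun n => a n * r ^ n := by
  obtain ⟨t, hrt, htR⟩ := exists_lt_ofReal_lt hr hrR
  have ht : 0 < t := hr.trans_lt hrt
  have hlim : limsup (fun n : ℕ => ENNReal.ofReal (a n ^ (1 / (n : ℝ)))) atTop <
      ENNReal.ofReal t⁻¹ := by
    rw [← hR, ENNReal.ofReal_inv_of_pos ht]
    exact ENNReal.inv_lt_inv.2 htR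
  have hev := eventually_lt_of_limsup_lt hlim
  have hgeo : Summable fun n : ℕ => (r / t) ^ n :=
    summable_geometric_of_lt_one (by positivity) ((div_lt_one ht).2 hrt)
  refine Summable.of_norm_bounded_eventually_nat hgeo ?_
  -- At `n = 0` the exponent `1 / n` is `0` by convention and says nothing about `a 0`.
  filter_upwards [hev, eventually_gt_atTop 0] with n hn hn0
  have h1 : a n ^ (1 / (n : ℝ)) < t⁻¹ := (ENNReal.ofReal_lt_ofReal_iff (by positivity)).1 hn
  have h2 : a n ≤ t⁻¹ ^ n := by
    calc a n = (a n ^ (1 / (n : ℝ))) ^ n := by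
          rw [one_div, Real.rpow_inv_natCast_pow (ha n) hn0.ne']
      _ ≤ _ := pow_le_pow_left₀ (Real.rpow_nonneg (ha n) _) h1.le n
  rw [Real.norm_of_nonneg (mul_nonneg (ha n) (pow_nonneg hr n)), div_pow, div_eq_inv_mul, ← inv_pow]
  gcongr

/-- The power series with coefficients `a n * c n` converges absolutely on `disc R`. -/
def ConvergesOn (a : ℕ → ℝ) (R : ℝ≥0∞) (c : ℕ → ℂ) : Prop :=
  ∀ r : ℝ, 0 ≤ r → ENNReal.ofReal r < R → Summable fun n => ‖(a n : ℂ) * c n‖ * r ^ n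

section ConvergesOn

variable {a : ℕ → ℝ} {R : ℝ≥0∞} {c : ℕ → ℂ}

theorem ConvergesOn.summable (h : ConvergesOn a R c) {z : ℂ} (hz : z ∈ disc R) :
    Summable fun n => (a n : ℂ) * c n * z ^ n := by
  refine Summable.of_norm ?_
  simpa only [norm_mul, norm_pow] using h ‖z‖ (norm_nonneg _) (mem_disc.1 hz)

theorem ConvergesOn.tendsto (h : ConvergesOn a R c) {z : ℂ} (hz : z ∈ disc R) :
    Tendsto (fun N => ∑ n ∈ Finset.range N, (a n : ℂ) * c n * z ^ n) atTop (𝓝 (gaf a c z)) :=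
  (h.summable hz).hasSum.tendsto_sum_nat

theorem ConvergesOn.analyticOnNhd (h : ConvergesOn a R c) : AnalyticOnNhd ℂ (gaf a c) (disc R) := by
  intro z hz
  obtain ⟨t, hzt, htR⟩ := exists_lt_ofReal_lt (norm_nonneg z) (mem_disc.1 hz)
  have hd : DifferentiableOn ℂ (gaf a c) (ball 0 t) := by
    refine Complex.differentiableOn_tsum_of_summable_norm
      (h t ((norm_nonneg z).trans hzt.le) htR) (fun n => by fun_prop) isOpen_ball fun n w hw => ?_
    rw [norm_mul, norm_pow]
    gcongr
    exact (mem_ball_zero_iff.1 hw).le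
  exact hd.analyticAt (isOpen_ball.mem_nhds (mem_ball_zero_iff.2 hzt))

theorem gaf_zero : gaf a c 0 = a 0 * c 0 := by
  rw [gaf, tsum_eq_single 0 fun n hn => by simp [hn]]
  simp

end ConvergesOn

section Random

variable {Ω : Type*} [MeasurableSpace Ω] {P : Measure Ω} {ζ : ℕ → Ω → ℂ} {a : ℕ → ℝ} {R : ℝ≥0∞}

/-- At a fixed radius the sum of absolute values has finite expectation, because all `|ζ n|` have
the same mean. Rational radii suffice, so the exceptional set is null. -/
theorem ae_convergesOn (ha : ∀ n, 0 ≤ a n)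
    (hR : R⁻¹ = limsup (fun n : ℕ => ENNReal.ofReal (a n ^ (1 / (n : ℝ)))) atTop)
    (hm : ∀ n, Measurable (ζ n)) (hζ : ∀ n, P.map (ζ n) = stdComplexGaussian) :
    ∀ᵐ ω ∂P, ConvergesOn a R fun n => ζ n ω := by
  have hq : ∀ q : ℚ, ∀ᵐ ω ∂P, 0 ≤ (q : ℝ) → ENNReal.ofReal q < R →
      Summable fun n => ‖(a n : ℂ) * ζ n ω‖ * (q : ℝ) ^ n := fun q => by
    by_cases h : 0 ≤ (q : ℝ) ∧ ENNReal.ofReal q < R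
    swap
    · exact ae_of_all _ fun ω h0 h1 => absurd ⟨h0, h1⟩ h
    obtain ⟨h0, h1⟩ := h
    have hsum := summable_mul_pow ha hR h0 h1
    have hterm : ∀ n ω, ‖(a n : ℂ) * ζ n ω * (q : ℂ) ^ n‖ₑ =
        ENNReal.ofReal (a n * (q : ℝ) ^ n) * ‖ζ n ω‖ₑ := fun n ω => by
      rw [← ofReal_norm (ζ n ω), ← ENNReal.ofReal_mul (mul_nonneg (ha n) (pow_nonneg h0 n)),
        ← ofReal_norm]
      congr 1
      rw [norm_mul, norm_mul, norm_pow, Complex.norm_real, Real.norm_of_nonneg (ha n),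
        show ((q : ℂ)) = ((q : ℝ) : ℂ) by simp, Complex.norm_real, Real.norm_of_nonneg h0]
      ring
    have hfin : ∫⁻ ω, ∑' n, ‖(a n : ℂ) * ζ n ω * (q : ℂ) ^ n‖ₑ ∂P ≠ ∞ := by
      rw [lintegral_tsum fun n => by fun_prop]
      have : ∀ n, ∫⁻ ω, ‖(a n : ℂ) * ζ n ω * (q : ℂ) ^ n‖ₑ ∂P =
          ENNReal.ofReal (a n * (q : ℝ) ^ n) * (ENNReal.ofReal (Real.sqrt Real.pi) / 2) :=
        fun n => by
          simp only [hterm]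
          rw [lintegral_const_mul _ (by fun_prop), ← lintegral_enorm_gaussian, ← hζ n,
            lintegral_map (by fun_prop) (hm n)]
      simp only [this]
      rw [ENNReal.tsum_mul_right, ← ENNReal.ofReal_tsum_of_nonneg
        (fun n => mul_nonneg (ha n) (pow_nonneg h0 n)) hsum]
      exact ENNReal.mul_ne_top ENNReal.ofReal_ne_top (ENNReal.div_ne_top ENNReal.ofReal_ne_top
        (by simp))
    filter_upwards [ae_lt_top' (AEMeasurable.tsum fun n => by fun_prop) hfin] with ω hω _ _
    have h2 : Summable fun n => ‖(a n : ℂ) * ζ n ω * (q : ℂ) ^ n‖ :=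
      tsum_enorm_ne_top_iff_summable_norm.1 hω.ne
    refine h2.congr fun n => ?_
    rw [norm_mul _ ((q : ℂ) ^ n), norm_pow, show ((q : ℂ)) = ((q : ℝ) : ℂ) by simp,
      Complex.norm_real, Real.norm_of_nonneg h0]
  filter_upwards [ae_all_iff.2 hq] with ω hω r hr hrR
  obtain ⟨t, hrt, htR⟩ := exists_lt_ofReal_lt hr hrR
  obtain ⟨q, hrq, hqt⟩ := exists_rat_btwn hrt
  have h1 := hω q (hr.trans hrq.le) ((ENNReal.ofReal_le_ofReal hqt.le).trans_lt htR)
  refine Summable.of_nonneg_of_le (fun n => by positivity) (fun n => ?_) h1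
  gcongr

theorem ae_ne_zero (hm : ∀ n, Measurable (ζ n)) (hζ : ∀ n, P.map (ζ n) = stdComplexGaussian)
    (n : ℕ) : ∀ᵐ ω ∂P, ζ n ω ≠ 0 := by
  have h1 : ∀ᵐ z ∂P.map (ζ n), z ≠ 0 := by
    rw [hζ n, ae_iff]
    refine withDensity_absolutelyContinuous _ _ ?_
    simp
  exact ae_of_ae_map (hm n).aemeasurable h1

end Random

/-! ### Zeros on a fixed circle -/

/-- The sequence with `x.2` in front of `x.1`. -/
def consSeq (x : (ℕ → ℂ) × ℂ) : ℕ → ℂ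
  | 0 => x.2
  | n + 1 => x.1 n

theorem measurable_consSeq : ∀ n, Measurable fun x => consSeq x n
  | 0 => measurable_snd
  | n + 1 => (measurable_pi_apply n).comp measurable_fst

theorem ConvergesOn.consSeq_of_consSeq {a : ℕ → ℝ} {R : ℝ≥0∞} {d : ℕ → ℂ} {x : ℂ}
    (h : ConvergesOn a R (consSeq (d, x))) (y : ℂ) : ConvergesOn a R (consSeq (d, y)) :=
  fun r hr hrR => (summable_nat_add_iff 1).1 ((summable_nat_add_iff 1).2 (h r hr hrR))

theorem gaf_consSeq {a : ℕ → ℝ} {R : ℝ≥0∞} {d : ℕ → ℂ} {x : ℂ}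
    (h : ConvergesOn a R (consSeq (d, x))) {z : ℂ} (hz : z ∈ disc R) :
    gaf a (consSeq (d, x)) z = a 0 * x + gaf a (consSeq (d, 0)) z := by
  rw [gaf, gaf, (h.summable hz).tsum_eq_zero_add,
    ((h.consSeq_of_consSeq 0).summable hz).tsum_eq_zero_add]
  simp [consSeq]

/-- The sequences for which the power series comes arbitrarily near to zero on the circle of
radius `t`. -/
def nearZero (a : ℕ → ℝ) (t : ℝ) : Set ((ℕ → ℂ) × ℂ) :=
  {x | ∀ k : ℕ, ∃ θ : ℚ, liminf (fun N => ‖∑ n ∈ Finset.range N,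
    (a n : ℂ) * consSeq x n * circlePoint t θ ^ n‖ₑ) atTop < ((k : ℝ≥0∞) + 1)⁻¹}

theorem measurableSet_nearZero (a : ℕ → ℝ) (t : ℝ) : MeasurableSet (nearZero a t) := by
  have : nearZero a t = ⋂ k : ℕ, ⋃ θ : ℚ, {x | liminf (fun N => ‖∑ n ∈ Finset.range N,
      (a n : ℂ) * consSeq x n * circlePoint t θ ^ n‖ₑ) atTop < ((k : ℝ≥0∞) + 1)⁻¹} := by
    ext x; simp [nearZero]
  rw [this]
  refine MeasurableSet.iInter fun k => MeasurableSet.iUnion fun θ =>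
    measurableSet_lt (Measurable.liminf fun N => Measurable.enorm ?_) measurable_const
  exact Finset.measurable_sum _ fun n _ => ((measurable_consSeq n).const_mul _).mul_const _

/-- Compactness of the circle gives a zero from small values, and density of the rationals gives the
converse. The event of a zero on the circle thus agrees with a measurable set wherever the series
converges. -/
theorem mem_nearZero_iff {a : ℕ → ℝ} {R : ℝ≥0∞} {t : ℝ} (ht : 0 ≤ t) (htR : ENNReal.ofReal t < R)
    {x : (ℕ → ℂ) × ℂ} (h : ConvergesOn a R (consSeq x)) :
    x ∈ nearZero a t ↔ ∃ z, ‖z‖ = t ∧ gaf a (consSeq x) z = 0 := by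
  have hcirc : ∀ θ, circlePoint t θ ∈ disc R := fun θ => by
    rw [mem_disc, norm_circlePoint, abs_of_nonneg ht]; exact htR
  have hlim : ∀ θ : ℝ, liminf (fun N => ‖∑ n ∈ Finset.range N,
      (a n : ℂ) * consSeq x n * circlePoint t θ ^ n‖ₑ) atTop =
        ‖gaf a (consSeq x) (circlePoint t θ)‖ₑ := fun θ =>
    (h.tendsto (hcirc θ)).enorm.liminf_eq
  simp only [nearZero, Set.mem_ofPred_eq, hlim]
  constructor
  · intro hx
    have hcont : ContinuousOn (fun z => ‖gaf a (consSeq x) z‖) (sphere (0 : ℂ) t) :=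
      (h.analyticOnNhd.continuousOn.mono fun z hz => by
        rw [mem_disc, mem_sphere_zero_iff_norm.1 hz]; exact htR).norm
    obtain ⟨z, hz, hmin⟩ := (isCompact_sphere (0 : ℂ) t).exists_isMinOn
      (NormedSpace.sphere_nonempty.2 ht) hcont
    refine ⟨z, mem_sphere_zero_iff_norm.1 hz, ?_⟩
    rw [← enorm_eq_zero]
    refine le_antisymm (ENNReal.le_of_forall_pos_le_add fun ε hε _ => ?_) bot_le
    obtain ⟨k, hk⟩ := ENNReal.exists_inv_nat_lt (a := (ε : ℝ≥0∞)) (by simpa using hε.ne')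
    obtain ⟨θ, hθ⟩ := hx k
    have h1 : ‖gaf a (consSeq x) z‖ ≤ ‖gaf a (consSeq x) (circlePoint t θ)‖ :=
      hmin (mem_sphere_zero_iff_norm.2 (by rw [norm_circlePoint, abs_of_nonneg ht]))
    rw [zero_add]
    calc ‖gaf a (consSeq x) z‖ₑ ≤ ‖gaf a (consSeq x) (circlePoint t θ)‖ₑ :=
          enorm_le_iff_norm_le.2 h1
      _ ≤ ((k : ℝ≥0∞) + 1)⁻¹ := hθ.le
      _ ≤ (k : ℝ≥0∞)⁻¹ := ENNReal.inv_le_inv.2 le_self_add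
      _ ≤ ε := hk.le
  · rintro ⟨z, hz, hz0⟩ k
    obtain ⟨ψ, hψ⟩ := exists_circlePoint z
    rw [hz] at hψ
    have hcont : Continuous fun θ : ℝ => ‖gaf a (consSeq x) (circlePoint t θ)‖ₑ := by
      refine Continuous.enorm (h.analyticOnNhd.continuousOn.comp_continuous
        (continuous_circlePoint.comp (by fun_prop : Continuous fun θ : ℝ => (t, θ))) hcirc)
    obtain ⟨θ, hθ⟩ := (Rat.denseRange_cast (𝕜 := ℝ)).exists_mem_open
      (hcont.isOpen_preimage (Iio ((k : ℝ≥0∞) + 1)⁻¹) isOpen_Iio) ⟨ψ, by simp [← hψ, hz0]⟩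
    exact ⟨θ, hθ⟩

section Random

variable {Ω : Type*} [MeasurableSpace Ω] {P : Measure Ω} {ζ : ℕ → Ω → ℂ}
  {a : ℕ → ℝ} {R : ℝ≥0∞}

theorem indepFun_tail_zero (hm : ∀ n, Measurable (ζ n)) (hind : iIndepFun ζ P) :
    IndepFun (fun ω n => ζ (n + 1) ω) (ζ 0) P := by
  rw [IndepFun_iff_Indep]
  have h1 := indep_iSup_of_disjoint (fun n => (hm n).comap_le) hind.iIndep
    (S := {n | n ≠ 0}) (T := {0}) (by simp)
  refine indep_of_indep_of_le_left (indep_of_indep_of_le_right h1 ?_) ?_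
  · simp
  · rw [MeasurableSpace.pi, MeasurableSpace.comap_iSup]
    refine iSup_le fun n => ?_
    rw [MeasurableSpace.comap_comp]
    exact le_iSup₂_of_le (n + 1) (by simp) le_rfl

/-- Fix all coefficients but the zeroth. A zero `z` on the circle determines `ζ 0` from the rest of
the series at `z`, so `ζ 0` lies in a smooth image of a circle, which is null in the plane. -/
theorem ae_gaf_ne_zero [IsProbabilityMeasure P] (ha : ∀ n, 0 ≤ a n) (ha0 : a 0 ≠ 0)
    (hR : R⁻¹ = limsup (fun n : ℕ => ENNReal.ofReal (a n ^ (1 / (n : ℝ)))) atTop)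
    (hm : ∀ n, Measurable (ζ n)) (hζ : ∀ n, P.map (ζ n) = stdComplexGaussian)
    (hind : iIndepFun ζ P) {t : ℝ} (ht : 0 ≤ t) (htR : ENNReal.ofReal t < R) :
    ∀ᵐ ω ∂P, ∀ z, ‖z‖ = t → gaf a (fun n => ζ n ω) z ≠ 0 := by
  set g : Ω → ℕ → ℂ := fun ω n => ζ (n + 1) ω with hg
  have hgm : Measurable g := measurable_pi_lambda _ fun n => hm (n + 1)
  have hpair : Measurable fun ω => (g ω, ζ 0 ω) := hgm.prodMk (hm 0)
  have hseq : ∀ ω, consSeq (g ω, ζ 0 ω) = fun n => ζ n ω := fun ω => by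
    ext n; cases n <;> rfl
  have hlaw := (indepFun_iff_map_prod_eq_prod_map_map hgm.aemeasurable (hm 0).aemeasurable).1
    (indepFun_tail_zero hm hind)
  have : IsProbabilityMeasure (P.map g) := Measure.isProbabilityMeasure_map hgm.aemeasurable
  have hconv : ∀ᵐ x ∂(P.map g).prod stdComplexGaussian, ConvergesOn a R (consSeq x) := by
    rw [← hζ 0, ← hlaw]
    refine ae_convergesOn (ζ := fun n x => consSeq x n) ha hR measurable_consSeq fun n => ?_
    rw [Measure.map_map (measurable_consSeq n) hpair, ← hζ n]
    congr 1
    ext ω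
    exact congrFun (hseq ω) n
  have hnull : (P.map g).prod stdComplexGaussian (nearZero a t) = 0 := by
    rw [Measure.measure_prod_null (measurableSet_nearZero a t)]
    filter_upwards [Measure.ae_ae_of_ae_prod hconv] with d hd
    obtain ⟨x₀, hx₀⟩ := hd.exists
    have hd0 := hx₀.consSeq_of_consSeq 0
    refine withDensity_absolutelyContinuous _ _ (measure_mono_null (t :=
      (fun z => -(gaf a (consSeq (d, 0)) z) / a 0) '' sphere 0 t) (fun x hx => ?_) ?_)
    · have hdx := hx₀.consSeq_of_consSeq x
      obtain ⟨z, hz, hz0⟩ := (mem_nearZero_iff ht htR hdx).1 hx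
      refine ⟨z, mem_sphere_zero_iff_norm.2 hz, ?_⟩
      rw [gaf_consSeq hdx (mem_disc.2 (hz ▸ htR))] at hz0
      have ha0' : (a 0 : ℂ) ≠ 0 := by exact_mod_cast ha0
      rw [div_eq_iff ha0']
      linear_combination -hz0
    · refine addHaar_image_eq_zero_of_differentiableOn_of_addHaar_eq_zero _ ?_
        (Measure.addHaar_sphere _ _ _)
      have h1 : DifferentiableOn ℂ (fun z => -(gaf a (consSeq (d, 0)) z) / a 0) (sphere 0 t) :=
        ((hd0.analyticOnNhd.differentiableOn.mono fun z hz => by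
          rw [mem_disc, mem_sphere_zero_iff_norm.1 hz]; exact htR).neg).div_const _
      exact h1.restrictScalars ℝ
  rw [← hζ 0, ← hlaw, Measure.map_apply hpair (measurableSet_nearZero a t)] at hnull
  filter_upwards [ae_convergesOn ha hR hm hζ, measure_eq_zero_iff_ae_notMem.1 hnull]
    with ω hω hn z hz hz0
  refine hn ((mem_nearZero_iff ht htR (by rw [hseq]; exact hω)).2 ⟨z, hz, ?_⟩)
  rw [hseq]
  exact hz0

end Random

/-! ### The bound of the expectation -/

/-- Hölder's inequality with exponents `p + 1` and `(p + 1) / p` separates the mean of `|f|^p`,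
which becomes the norm, from the weighted mean of `1 / |F|`. -/
theorem ratio_le_of_weight {μ : Measure ℝ} {p : ℝ} (hp : 0 < p) {t : ℝ} {ρ : ℝ≥0∞}
    (htρ : ENNReal.ofReal t < ρ) {F : ℂ → ℂ} (hF : AnalyticOnNhd ℂ F (disc ρ)) (hF0 : F 0 ≠ 0)
    {b : ℝ → ℝ≥0∞} (hb : Measurable b)
    (hC0 : ∫⁻ r in radii (ENNReal.ofReal t), b r ^ p ∂μ ≠ 0)
    (hC : ∫⁻ r in radii (ENNReal.ofReal t), b r ^ p ∂μ ≠ ∞)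
    {x : ℝ≥0∞} (hx : x ∈ ratios μ p ρ (ENNReal.ofReal t) F) :
    x ≤ ‖F 0‖ₑ * (∫⁻ r in radii (ENNReal.ofReal t), b r ^ (p + 1) * circMean F (-1) r ∂μ) /
      (∫⁻ r in radii (ENNReal.ofReal t), b r ^ p ∂μ) ^ ((p + 1) / p) := by
  obtain ⟨f, hf, rfl⟩ := hx
  rcases eq_or_ne (f 0) 0 with hf0 | hf0
  · simp [hf0]
  have hp1 : 0 < p + 1 := by linarith
  set C := ∫⁻ r in radii (ENNReal.ofReal t), b r ^ p ∂μ with hCdef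
  set D := ∫⁻ r in radii (ENNReal.ofReal t), b r ^ (p + 1) * circMean F (-1) r ∂μ with hDdef
  set κ := ‖f 0‖ₑ / ‖F 0‖ₑ with hκ
  have hball : ∀ r ∈ radii (ENNReal.ofReal t), closedBall (0 : ℂ) r ⊆ disc ρ := fun r hr =>
    closedBall_subset_disc (hr.2.trans_lt htρ)
  have hν : ∀ᵐ r ∂μ.restrict (radii (ENNReal.ofReal t)), ∀ z : ℂ, ‖z‖ = |r| → z ∈ disc ρ := by
    filter_upwards [ae_restrict_mem (measurableSet_radii _)] with r hr z hz
    exact hball r hr (mem_closedBall_zero_iff.2 (by rw [hz, abs_of_pos hr.1]))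
  have hmA : AEMeasurable (circMean f p) (μ.restrict (radii (ENNReal.ofReal t))) :=
    aemeasurable_circMean (isOpen_disc ρ).measurableSet hν hf.analytic.continuousOn
  have hmB : AEMeasurable (circMean F (-1)) (μ.restrict (radii (ENNReal.ofReal t))) :=
    aemeasurable_circMean (isOpen_disc ρ).measurableSet hν hF.continuousOn
  -- After the power `p / (p + 1)` the mean of `|f|^p` has exponent `1 / (p + 1)`, as Hölder
  -- requires, and `b ^ p` joins the other factor entirely.
  have hpt : ∀ r ∈ radii (ENNReal.ofReal t), κ ^ (p / (p + 1)) * b r ^ p ≤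
      circMean f p r ^ (1 / (p + 1)) * (b r ^ (p + 1) * circMean F (-1) r) ^ (p / (p + 1)) := by
    intro r hr
    have h1 : κ ≤ circMean f p r ^ (1 / p) * circMean F (-1) r :=
      enorm_div_le_circMean_mul hr.1 hp (hf.analytic.mono (hball r hr)) (hF.mono (hball r hr)) hf0
        hF0 fun z hz hz0 => hf.vanishes z (mem_disc.2
          ((ENNReal.ofReal_lt_ofReal_iff hr.1).2 hz |>.trans_le hr.2)) hz0
    calc κ ^ (p / (p + 1)) * b r ^ p
        ≤ (circMean f p r ^ (1 / p) * circMean F (-1) r) ^ (p / (p + 1)) * b r ^ p := by gcongr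
      _ = _ := by
        rw [ENNReal.mul_rpow_of_nonneg _ _ (by positivity),
          ENNReal.mul_rpow_of_nonneg _ _ (by positivity), ← ENNReal.rpow_mul, ← ENNReal.rpow_mul,
          show 1 / p * (p / (p + 1)) = 1 / (p + 1) by field_simp,
          show (p + 1) * (p / (p + 1)) = p by field_simp]
        ring
  have hint : κ ^ (p / (p + 1)) * C ≤ (∫⁻ r in radii (ENNReal.ofReal t), circMean f p r ∂μ) ^
      (1 / (p + 1)) * D ^ (p / (p + 1)) := by
    have hholder := ENNReal.lintegral_mul_le_Lp_mul_Lq (μ.restrict (radii (ENNReal.ofReal t)))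
      (p := p + 1) (q := (p + 1) / p) ⟨by field_simp; ring, hp1, by positivity⟩
      (hmA.pow_const (1 / (p + 1))) (((hb.pow_const (p + 1)).aemeasurable.mul hmB).pow_const
        (p / (p + 1)))
    simp only [← ENNReal.rpow_mul, Pi.mul_apply] at hholder
    rw [show 1 / (p + 1) * (p + 1) = 1 by field_simp,
      show p / (p + 1) * ((p + 1) / p) = 1 by field_simp,
      show 1 / ((p + 1) / p) = p / (p + 1) by field_simp] at hholder
    simp only [ENNReal.rpow_one] at hholder
    refine le_trans ?_ hholder
    rw [hCdef, ← lintegral_const_mul _ (hb.pow_const p)]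
    refine lintegral_mono_ae ?_
    filter_upwards [ae_restrict_mem (measurableSet_radii _)] with r hr
    exact hpt r hr
  have hmain : κ * C ^ ((p + 1) / p) ≤ D * normA μ p (ENNReal.ofReal t) f := by
    have h2 := ENNReal.rpow_le_rpow hint (z := (p + 1) / p) (by positivity)
    rw [ENNReal.mul_rpow_of_nonneg _ _ (by positivity),
      ENNReal.mul_rpow_of_nonneg _ _ (by positivity), ← ENNReal.rpow_mul, ← ENNReal.rpow_mul,
      ← ENNReal.rpow_mul, show p / (p + 1) * ((p + 1) / p) = 1 by field_simp,
      show 1 / (p + 1) * ((p + 1) / p) = 1 / p by field_simp, ENNReal.rpow_one,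
      ENNReal.rpow_one] at h2
    rw [mul_comm D]
    exact h2
  have hF0' : ‖F 0‖ₑ ≠ 0 := by simpa using hF0
  have hfκ : ‖f 0‖ₑ = ‖F 0‖ₑ * κ := by
    rw [hκ, ENNReal.mul_div_cancel hF0' enorm_ne_top]
  have hC0' : C ^ ((p + 1) / p) ≠ 0 := by
    rw [Ne, ENNReal.rpow_eq_zero_iff]
    rintro (⟨h, -⟩ | ⟨h, -⟩)
    · exact hC0 h
    · exact hC h
  have hC' : C ^ ((p + 1) / p) ≠ ∞ := ENNReal.rpow_ne_top_of_nonneg (by positivity) hC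
  refine ENNReal.div_le_of_le_mul ?_
  calc ‖f 0‖ₑ = ‖F 0‖ₑ * κ := hfκ
    _ ≤ ‖F 0‖ₑ * (D * normA μ p (ENNReal.ofReal t) f / C ^ ((p + 1) / p)) := by
        gcongr
        exact (ENNReal.le_div_iff_mul_le (Or.inl hC0') (Or.inl hC')).2 hmain
    _ = _ := by
        simp only [div_eq_mul_inv]
        ring

theorem measurable_coeffNorm (a : ℕ → ℝ) : Measurable (coeffNorm a) := by
  unfold coeffNorm
  exact (Measurable.tsum fun n => by fun_prop).pow_const _

theorem coeffNorm_mono {a : ℕ → ℝ} (ha : ∀ n, 0 ≤ a n) {r t : ℝ} (hr : 0 ≤ r) (hrt : r ≤ t) :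
    coeffNorm a r ≤ coeffNorm a t := by
  unfold coeffNorm
  gcongr with n
  exact ha n

theorem coeffNorm_ne_zero {a : ℕ → ℝ} (ha : ∀ n, 0 ≤ a n) (ha0 : a 0 ≠ 0) (r : ℝ) :
    coeffNorm a r ≠ 0 := by
  have h1 : ∑' n : ℕ, ENNReal.ofReal (a n * r ^ n) ^ 2 ≠ 0 := by
    intro h
    have := ENNReal.tsum_eq_zero.1 h 0
    simp only [pow_zero, mul_one, pow_eq_zero_iff (two_ne_zero), ENNReal.ofReal_eq_zero] at this
    exact ha0 (le_antisymm this (ha 0))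
  rw [coeffNorm, Ne, ENNReal.rpow_eq_zero_iff]
  rintro (⟨h, -⟩ | ⟨-, h⟩)
  · exact h1 h
  · norm_num at h

theorem coeffNorm_ne_top {a : ℕ → ℝ} (ha : ∀ n, 0 ≤ a n) {r : ℝ} (hr : 0 ≤ r)
    (h : Summable fun n => a n * r ^ n) : coeffNorm a r ≠ ∞ := by
  refine ENNReal.rpow_ne_top_of_nonneg (by norm_num) ?_
  have hsum : ∑' n, ENNReal.ofReal (a n * r ^ n) ≠ ∞ := by
    rw [← ENNReal.ofReal_tsum_of_nonneg (fun n => mul_nonneg (ha n) (pow_nonneg hr n)) h]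
    exact ENNReal.ofReal_ne_top
  refine ne_top_of_le_ne_top (ENNReal.mul_ne_top hsum hsum) ?_
  rw [← ENNReal.tsum_mul_right]
  refine ENNReal.tsum_le_tsum fun n => ?_
  rw [sq]
  gcongr
  exact ENNReal.le_tsum n

section Random

variable {Ω : Type*} [MeasurableSpace Ω] {P : Measure Ω} {ζ : ℕ → Ω → ℂ} {a : ℕ → ℝ} {R : ℝ≥0∞}

/-- Fatou's lemma carries the estimate for partial sums to the limit. -/
theorem lintegral_liminf_enorm_inv_le [IsProbabilityMeasure P] (ha : ∀ n, 0 ≤ a n) (ha0 : a 0 ≠ 0)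
    (hm : ∀ n, Measurable (ζ n)) (hζ : ∀ n, P.map (ζ n) = stdComplexGaussian)
    (hind : iIndepFun ζ P) {z : ℂ} :
    ∫⁻ ω, ‖(a 0 : ℂ) * ζ 0 ω‖ₑ * liminf (fun N => ‖∑ n ∈ Finset.range (N + 1),
      (a n : ℂ) * ζ n ω * z ^ n‖ₑ⁻¹) atTop ∂P ≤
        ENNReal.ofReal (Real.sqrt Real.pi * a 0) / coeffNorm a ‖z‖ := by
  have hmeas : ∀ N, Measurable fun ω => ‖∑ n ∈ Finset.range (N + 1),
      (a n : ℂ) * ζ n ω * z ^ n‖ₑ⁻¹ := fun N => by fun_prop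
  have hN : ∀ N, ∫⁻ ω, ‖ζ 0 ω‖ₑ * ‖∑ n ∈ Finset.range (N + 1),
      (a n : ℂ) * ζ n ω * z ^ n‖ₑ⁻¹ ∂P ≤ ENNReal.ofReal (Real.sqrt Real.pi) /
        (∑ n ∈ Finset.range (N + 1), ENNReal.ofReal (a n * ‖z‖ ^ n) ^ 2) ^ (1 / 2 : ℝ) :=
    fun N => by
      have h := lintegral_enorm_div_sum_le hm hζ hind (c := fun n => (a n : ℂ) * z ^ n)
        (by simpa using ha0) N
      have e1 : ∀ ω, ∑ n ∈ Finset.range (N + 1), (a n : ℂ) * z ^ n * ζ n ω =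
          ∑ n ∈ Finset.range (N + 1), (a n : ℂ) * ζ n ω * z ^ n := fun ω =>
        Finset.sum_congr rfl fun n _ => by ring
      have e2 : ∀ n, ‖(a n : ℂ) * z ^ n‖ₑ = ENNReal.ofReal (a n * ‖z‖ ^ n) := fun n => by
        rw [← ofReal_norm, norm_mul, norm_pow, Complex.norm_real, Real.norm_of_nonneg (ha n)]
      simpa only [e1, e2] using h
  have hlim : Tendsto (fun N => ENNReal.ofReal (Real.sqrt Real.pi) /
      (∑ n ∈ Finset.range (N + 1), ENNReal.ofReal (a n * ‖z‖ ^ n) ^ 2) ^ (1 / 2 : ℝ)) atTop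
      (𝓝 (ENNReal.ofReal (Real.sqrt Real.pi) / coeffNorm a ‖z‖)) := by
    refine ENNReal.Tendsto.const_div ?_ (Or.inr ENNReal.ofReal_ne_top)
    exact (ENNReal.continuous_rpow_const.tendsto _).comp
      ((ENNReal.tendsto_nat_tsum _).comp (tendsto_add_atTop_nat 1))
  have hconst : ∀ ω, ‖(a 0 : ℂ) * ζ 0 ω‖ₑ = ENNReal.ofReal (a 0) * ‖ζ 0 ω‖ₑ := fun ω => by
    rw [enorm_mul, ← ofReal_norm, Complex.norm_real, Real.norm_of_nonneg (ha 0)]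
  simp only [hconst, mul_assoc (ENNReal.ofReal (a 0))]
  rw [lintegral_const_mul _ (by fun_prop), mul_comm (Real.sqrt Real.pi),
    ENNReal.ofReal_mul (ha 0), mul_div_assoc]
  gcongr
  calc ∫⁻ ω, ‖ζ 0 ω‖ₑ * liminf (fun N => ‖∑ n ∈ Finset.range (N + 1),
        (a n : ℂ) * ζ n ω * z ^ n‖ₑ⁻¹) atTop ∂P
      ≤ ∫⁻ ω, liminf (fun N => ‖ζ 0 ω‖ₑ * ‖∑ n ∈ Finset.range (N + 1),
        (a n : ℂ) * ζ n ω * z ^ n‖ₑ⁻¹) atTop ∂P := by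
        refine lintegral_mono fun ω => ?_
        exact le_of_eq_of_le (ENNReal.liminf_const_mul_of_ne_top enorm_ne_top).symm le_rfl
    _ ≤ liminf (fun N => ∫⁻ ω, ‖ζ 0 ω‖ₑ * ‖∑ n ∈ Finset.range (N + 1),
        (a n : ℂ) * ζ n ω * z ^ n‖ₑ⁻¹ ∂P) atTop :=
        lintegral_liminf_le fun N => by fun_prop
    _ ≤ liminf (fun N => ENNReal.ofReal (Real.sqrt Real.pi) /
      (∑ n ∈ Finset.range (N + 1), ENNReal.ofReal (a n * ‖z‖ ^ n) ^ 2) ^ (1 / 2 : ℝ)) atTop :=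
        liminf_le_liminf (Eventually.of_forall hN)
    _ = _ := hlim.liminf_eq

/-- The lower limit of a function of the partial sums of the power series. -/
noncomputable def liminfPartialSum (a : ℕ → ℝ) (h : ℂ → ℂ → ℝ≥0∞) (c : ℕ → ℂ) (z : ℂ) : ℝ≥0∞ :=
  liminf (fun N => h z (∑ n ∈ Finset.range (N + 1), (a n : ℂ) * c n * z ^ n)) atTop

/-- Lower limits are jointly measurable in sample, radius and angle whether or not the series
converges; this permits Tonelli's theorem. -/
theorem measurable_liminfPartialSum (hm : ∀ n, Measurable (ζ n)) {h : ℂ → ℂ → ℝ≥0∞}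
    (hh : Measurable (Function.uncurry h)) :
    Measurable fun x : Ω × ℝ × ℝ =>
      liminfPartialSum a h (fun n => ζ n x.1) (circlePoint x.2.1 x.2.2) := by
  have hz : Measurable fun x : Ω × ℝ × ℝ => circlePoint x.2.1 x.2.2 :=
    continuous_circlePoint.measurable.comp measurable_snd
  have hs : ∀ N, Measurable fun x : Ω × ℝ × ℝ => ∑ n ∈ Finset.range (N + 1),
      (a n : ℂ) * ζ n x.1 * circlePoint x.2.1 x.2.2 ^ n := fun N =>
    Finset.measurable_sum _ fun n _ =>
      (((hm n).comp measurable_fst).const_mul _).mul (hz.pow_const n)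
  exact Measurable.liminf fun N => hh.comp (hz.prodMk (hs N))

theorem ConvergesOn.liminfPartialSum_eq {c : ℕ → ℂ} (hc : ConvergesOn a R c) {z : ℂ}
    (hz : z ∈ disc R) {h : ℂ → ℂ → ℝ≥0∞} (hh : Continuous (h z)) :
    liminfPartialSum a h c z = h z (gaf a c z) :=
  (hh.continuousAt.tendsto.comp ((hc.tendsto hz).comp (tendsto_add_atTop_nat 1))).liminf_eq

theorem circlePoint_mem_disc {t r : ℝ} (htR : ENNReal.ofReal t < R)
    (hr : r ∈ radii (ENNReal.ofReal t)) (θ : ℝ) : circlePoint r θ ∈ disc R := by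
  rw [mem_disc, norm_circlePoint, abs_of_pos hr.1]
  exact hr.2.trans_lt htR

theorem lintegral_sSup_ratios_le_of_lt [IsProbabilityMeasure P] (ha : ∀ n, 0 ≤ a n) (ha0 : a 0 ≠ 0)
    (hR : R⁻¹ = limsup (fun n : ℕ => ENNReal.ofReal (a n ^ (1 / (n : ℝ)))) atTop)
    (hm : ∀ n, Measurable (ζ n)) (hζ : ∀ n, P.map (ζ n) = stdComplexGaussian)
    (hind : iIndepFun ζ P) {μ : Measure ℝ} [IsFiniteMeasure μ] {p : ℝ} (hp : 0 < p) {t : ℝ}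
    (htR : ENNReal.ofReal t < R) :
    ∫⁻ ω, sSup (ratios μ p R (ENNReal.ofReal t) (gaf a fun n => ζ n ω)) ∂P ≤
      ENNReal.ofReal (Real.sqrt Real.pi * a 0) /
        (∫⁻ r in radii (ENNReal.ofReal t), coeffNorm a r ^ p ∂μ) ^ (1 / p) := by
  set S := radii (ENNReal.ofReal t) with hS
  set C := ∫⁻ r in S, coeffNorm a r ^ p ∂μ with hCdef
  set K := ENNReal.ofReal (Real.sqrt Real.pi * a 0) with hK
  have hK0 : K ≠ 0 := by
    rw [hK, Ne, ENNReal.ofReal_eq_zero, not_le]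
    exact mul_pos (Real.sqrt_pos.2 Real.pi_pos) ((ha 0).lt_of_ne' ha0)
  have hb := measurable_coeffNorm a
  have hb0 : ∀ r, coeffNorm a r ≠ 0 := coeffNorm_ne_zero ha ha0
  have hbt : ∀ r ∈ S, coeffNorm a r ≠ ∞ := fun r hr =>
    coeffNorm_ne_top ha hr.1.le (summable_mul_pow ha hR hr.1.le (hr.2.trans_lt htR))
  rcases eq_or_ne C 0 with hC0 | hC0
  · rw [hC0, ENNReal.zero_rpow_of_pos (by positivity), ENNReal.div_zero hK0]
    exact le_top
  have ht : 0 ≤ t := by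
    by_contra! h
    refine hC0 ?_
    have : S = ∅ := by
      ext r
      simp only [hS, radii, ENNReal.ofReal_of_nonpos h.le, Set.mem_ofPred_eq, nonpos_iff_eq_zero,
        ENNReal.ofReal_eq_zero, mem_empty_iff_false, iff_false, not_and, not_le, imp_self]
    rw [hCdef, this]
    simp
  have hC : C ≠ ∞ := by
    have h1 : C ≤ ∫⁻ _ in S, coeffNorm a t ^ p ∂μ := by
      refine setLIntegral_mono measurable_const fun r hr => ?_
      gcongr
      exact coeffNorm_mono ha hr.1.le ((ENNReal.ofReal_le_ofReal_iff ht).1 hr.2)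
    refine ne_top_of_le_ne_top ?_ h1
    rw [setLIntegral_const]
    exact ENNReal.mul_ne_top (ENNReal.rpow_ne_top_of_nonneg hp.le
      (coeffNorm_ne_top ha ht (summable_mul_pow ha hR ht htR))) (measure_ne_top _ _)
  have hC0' : C ^ (1 / p) ≠ 0 := by
    rw [Ne, ENNReal.rpow_eq_zero_iff]
    rintro (⟨h, -⟩ | ⟨h, -⟩)
    · exact hC0 h
    · exact hC h
  let ν : Measure (ℝ × ℝ) := (μ.restrict S).prod unitMeasure
  obtain ⟨H, hHdef⟩ : ∃ H : Ω → ℝ × ℝ → ℝ≥0∞, ∀ ω x, H ω x =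
      liminfPartialSum a (fun _ w => ‖w‖ₑ⁻¹) (fun n => ζ n ω) (circlePoint x.1 x.2) :=
    ⟨_, fun _ _ => rfl⟩
  have hH : Measurable (Function.uncurry H) := by
    have : Function.uncurry H = fun x => liminfPartialSum a (fun _ w => ‖w‖ₑ⁻¹)
        (fun n => ζ n x.1) (circlePoint x.2.1 x.2.2) := by
      ext x; exact hHdef x.1 x.2
    rw [this]
    exact measurable_liminfPartialSum (a := a) hm (h := fun _ w => ‖w‖ₑ⁻¹) measurable_snd.enorm.inv
  let b : ℝ × ℝ → ℝ≥0∞ := fun x => coeffNorm a x.1 ^ (p + 1)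
  have hbm : Measurable b := (hb.comp measurable_fst).pow_const _
  -- The supremum need not be known to be measurable here: it is dominated by a measurable function.
  have hratio : ∀ᵐ ω ∂P, sSup (ratios μ p R (ENNReal.ofReal t) (gaf a fun n => ζ n ω)) ≤
      (∫⁻ x, b x * (‖(a 0 : ℂ) * ζ 0 ω‖ₑ * H ω x) ∂ν) / C ^ ((p + 1) / p) := by
    filter_upwards [ae_convergesOn ha hR hm hζ, ae_ne_zero hm hζ 0] with ω hω hω0
    refine sSup_le fun x hx => ?_
    have hF0 : gaf a (fun n => ζ n ω) 0 ≠ 0 := by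
      rw [gaf_zero]
      exact mul_ne_zero (by exact_mod_cast ha0) hω0
    refine (ratio_le_of_weight hp htR hω.analyticOnNhd hF0 hb hC0 hC hx).trans_eq ?_
    congr 1
    have hHω : Measurable (H ω) := hH.comp measurable_prodMk_left
    have hmeas : Measurable fun x => b x * (‖(a 0 : ℂ) * ζ 0 ω‖ₑ * H ω x) :=
      hbm.mul (hHω.const_mul _)
    rw [lintegral_prod _ hmeas.aemeasurable, ← lintegral_const_mul' _ _ enorm_ne_top]
    refine setLIntegral_congr_fun (measurableSet_radii _) fun r hr => ?_
    simp only [circMean, b, gaf_zero, ENNReal.rpow_neg_one]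
    rw [lintegral_const_mul' _ _ (ENNReal.rpow_ne_top_of_nonneg (by positivity) (hbt r hr)),
      lintegral_const_mul' _ _ enorm_ne_top, mul_left_comm]
    congr 2
    refine lintegral_congr fun θ => ?_
    rw [hHdef]
    exact (hω.liminfPartialSum_eq (circlePoint_mem_disc htR hr θ) (h := fun _ w => ‖w‖ₑ⁻¹)
      continuous_enorm.inv).symm
  have hjoint : Measurable fun x : Ω × ℝ × ℝ =>
      b x.2 * (‖(a 0 : ℂ) * ζ 0 x.1‖ₑ * H x.1 x.2) :=
    (hbm.comp measurable_snd).mul ((((hm 0).comp measurable_fst).const_mul _).enorm.mul hH)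
  have hE : ∫⁻ ω, ∫⁻ x, b x * (‖(a 0 : ℂ) * ζ 0 ω‖ₑ * H ω x) ∂ν ∂P ≤ K * C := by
    rw [lintegral_lintegral_swap hjoint.aemeasurable]
    have hmeas : Measurable fun x : ℝ × ℝ =>
        ∫⁻ ω, b x * (‖(a 0 : ℂ) * ζ 0 ω‖ₑ * H ω x) ∂P := hjoint.lintegral_prod_left'
    rw [lintegral_prod _ hmeas.aemeasurable, hCdef, ← lintegral_const_mul _ (hb.pow_const p)]
    refine setLIntegral_mono ((hb.pow_const p).const_mul _) fun r hr => ?_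
    have hrp : 0 < r := hr.1
    calc ∫⁻ θ, ∫⁻ ω, b (r, θ) * (‖(a 0 : ℂ) * ζ 0 ω‖ₑ * H ω (r, θ)) ∂P ∂unitMeasure
        ≤ ∫⁻ _, K * coeffNorm a r ^ p ∂unitMeasure := by
          refine lintegral_mono fun θ => ?_
          have h1 := lintegral_liminf_enorm_inv_le ha ha0 hm hζ hind (z := circlePoint r θ)
          rw [norm_circlePoint, abs_of_pos hrp] at h1
          rw [lintegral_const_mul' _ _ (ENNReal.rpow_ne_top_of_nonneg (by positivity) (hbt r hr))]
          simp only [hHdef]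
          calc _ ≤ coeffNorm a r ^ (p + 1) * (K / coeffNorm a r) := mul_le_mul' le_rfl h1
            -- The choice of weight: the expectation cancels one of the `p + 1` powers, leaving the
            -- integrand of `C`.
            _ = K * coeffNorm a r ^ p := by
                rw [ENNReal.rpow_add _ _ (hb0 r) (hbt r hr), ENNReal.rpow_one, mul_assoc,
                  ENNReal.mul_div_cancel (hb0 r) (hbt r hr), mul_comm]
      _ = K * coeffNorm a r ^ p := by simp
  calc ∫⁻ ω, sSup (ratios μ p R (ENNReal.ofReal t) (gaf a fun n => ζ n ω)) ∂P
      ≤ ∫⁻ ω, (∫⁻ x, b x * (‖(a 0 : ℂ) * ζ 0 ω‖ₑ * H ω x) ∂ν) / C ^ ((p + 1) / p) ∂P :=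
        lintegral_mono_ae hratio
    _ = (∫⁻ ω, ∫⁻ x, b x * (‖(a 0 : ℂ) * ζ 0 ω‖ₑ * H ω x) ∂ν ∂P) / C ^ ((p + 1) / p) := by
        simp only [div_eq_mul_inv]
        exact lintegral_mul_const _ hjoint.lintegral_prod_right'
    _ ≤ K * C / C ^ ((p + 1) / p) := by gcongr
    _ = K / C ^ (1 / p) := by
        rw [show (p + 1) / p = 1 + 1 / p by field_simp, ENNReal.rpow_add _ _ hC0 hC,
          ENNReal.rpow_one, mul_comm C, ENNReal.mul_div_mul_right _ _ hC0 hC]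

end Random

/-! ### Measurability, and the limit of large radii -/

theorem exists_seq_ofReal_tendsto {s : ℝ≥0∞} (hs : 0 < s) : ∃ t : ℕ → ℝ, Monotone t ∧
    (∀ n, 0 < t n) ∧ (∀ n, ENNReal.ofReal (t n) < s) ∧
      Tendsto (fun n => ENNReal.ofReal (t n)) atTop (𝓝 s) := by
  obtain ⟨T, hmono, hT, hlim⟩ := exists_seq_strictMono_tendsto' hs
  have htop : ∀ n, T n ≠ ∞ := fun n => (hT n).2.ne_top
  have heq : ∀ n, ENNReal.ofReal (T n).toReal = T n := fun n => ENNReal.ofReal_toReal (htop n)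
  refine ⟨fun n => (T n).toReal, fun m n h => ENNReal.toReal_mono (htop n) (hmono.monotone h),
    fun n => ENNReal.toReal_pos (hT n).1.ne' (htop n), fun n => ?_, ?_⟩
  · rw [heq]; exact (hT n).2
  · simpa only [heq] using hlim

theorem tendsto_setLIntegral_radii {μ : Measure ℝ} {s : ℝ≥0∞}
    (hatom : μ {r : ℝ | ENNReal.ofReal r = s} = 0) {t : ℕ → ℝ} (htm : Monotone t)
    (hts : ∀ n, ENNReal.ofReal (t n) < s)
    (hlim : Tendsto (fun n => ENNReal.ofReal (t n)) atTop (𝓝 s)) (f : ℝ → ℝ≥0∞) :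
    Tendsto (fun n => ∫⁻ r in radii (ENNReal.ofReal (t n)), f r ∂μ) atTop
      (𝓝 (∫⁻ r in radii s, f r ∂μ)) := by
  have hmono : Monotone fun n => radii (ENNReal.ofReal (t n)) := fun m n h r hr =>
    ⟨hr.1, hr.2.trans (ENNReal.ofReal_le_ofReal (htm h))⟩
  have hae : (radii s : Set ℝ) =ᵐ[μ] ⋃ n, radii (ENNReal.ofReal (t n)) := by
    filter_upwards [measure_eq_zero_iff_ae_notMem.1 hatom] with r hr
    refine propext ⟨fun h => ?_, fun h => ?_⟩
    · obtain ⟨n, hn⟩ := (hlim.eventually (lt_mem_nhds (lt_of_le_of_ne h.2 hr))).exists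
      exact mem_iUnion.2 ⟨n, h.1, hn.le⟩
    · obtain ⟨n, hn⟩ := mem_iUnion.1 h
      exact ⟨hn.1, hn.2.trans (hts n).le⟩
  rw [setLIntegral_congr hae, setLIntegral_iUnion_of_directed _ hmono.directed_le]
  exact tendsto_atTop_iSup fun m n h => lintegral_mono_set (hmono h)

/-- There is no mass beyond `s` or at `s`; a null annulus from `t` to `s` would therefore bring the
outer radius down to `t`. -/
theorem chargesBoundary_of_outerRadius {μ : Measure ℝ} {s : ℝ≥0∞} (h : outerRadius μ = s)
    (hatom : μ {r : ℝ | ENNReal.ofReal r = s} = 0) : ChargesBoundary μ s := by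
  intro t ht hts h0
  have hout : μ {r : ℝ | s < ENNReal.ofReal r} = 0 := by
    rcases eq_or_ne s ∞ with rfl | hs
    · simp
    obtain ⟨u, -, hu, hlim⟩ := exists_seq_strictAnti_tendsto' hs.lt_top
    refine measure_mono_null (t := ⋃ n, {r : ℝ | u n < ENNReal.ofReal r}) (fun r hr => ?_)
      (measure_iUnion_null fun n => ?_)
    · obtain ⟨n, hn⟩ := (hlim.eventually (gt_mem_nhds hr)).exists
      exact mem_iUnion.2 ⟨n, hn⟩
    · have h1 : sInf {ρ : ℝ≥0∞ | μ {r : ℝ | ρ < ENNReal.ofReal r} = 0} < u n := by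
        rw [← outerRadius, h]; exact (hu n).1
      obtain ⟨ρ, hρ, hρu⟩ := sInf_lt_iff.1 h1
      exact measure_mono_null (fun r hr => hρu.trans hr) hρ
  have h2 : μ {r : ℝ | ENNReal.ofReal t < ENNReal.ofReal r} = 0 := by
    refine measure_mono_null (fun r hr => ?_)
      (measure_union_null (measure_union_null h0 hatom) hout)
    rcases lt_trichotomy (ENNReal.ofReal r) s with h3 | h3 | h3
    · exact Or.inl (Or.inl ⟨(ENNReal.ofReal_lt_ofReal_iff_of_nonneg ht).1 hr, h3⟩)
    · exact Or.inl (Or.inr h3)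
    · exact Or.inr h3
  have h3 : outerRadius μ ≤ ENNReal.ofReal t := sInf_le h2
  rw [h] at h3
  exact absurd hts (not_lt.2 h3)

theorem ChargesBoundary.mono {μ ν : Measure ℝ} {s : ℝ≥0∞} (h : ChargesBoundary ν s) (hνμ : ν ≤ μ) :
    ChargesBoundary μ s := fun t ht hts h0 =>
  h t ht hts (le_antisymm ((hνμ _).trans h0.le) bot_le)

section Random

variable {Ω : Type*} [MeasurableSpace Ω] {P : Measure Ω} {ζ : ℕ → Ω → ℂ} {a : ℕ → ℝ} {R : ℝ≥0∞}

theorem gaf_zero_ne_zero (ha0 : a 0 ≠ 0) {c : ℕ → ℂ} (hc : c 0 ≠ 0) : gaf a c 0 ≠ 0 := by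
  rw [gaf_zero]
  exact mul_ne_zero (by exact_mod_cast ha0) hc

/-- For each polynomial the norm is an integral of lower limits of partial sums wherever the series
converges, and the supremum is countable. -/
theorem aemeasurable_polySup (ha : ∀ n, 0 ≤ a n)
    (hR : R⁻¹ = limsup (fun n : ℕ => ENNReal.ofReal (a n ^ (1 / (n : ℝ)))) atTop)
    (hm : ∀ n, Measurable (ζ n)) (hζ : ∀ n, P.map (ζ n) = stdComplexGaussian)
    {μ : Measure ℝ} [IsFiniteMeasure μ] {p t : ℝ}
    (htR : ENNReal.ofReal t < R) (q : ℕ → Polynomial ℂ) :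
    AEMeasurable (fun ω => polySup μ p (ENNReal.ofReal t) q (gaf a fun n => ζ n ω)) P := by
  let ν : Measure (ℝ × ℝ) := (μ.restrict (radii (ENNReal.ofReal t))).prod unitMeasure
  have hq : ∀ k, Measurable fun z : ℂ => (q k).eval z := fun k => (q k).continuous.measurable
  have hh : ∀ k, Measurable (Function.uncurry fun z w : ℂ => ‖w * (q k).eval z‖ₑ ^ p) := fun k =>
    ((measurable_snd.mul ((hq k).comp measurable_fst)).enorm).pow_const p
  obtain ⟨H, hHdef⟩ : ∃ H : ℕ → Ω × ℝ × ℝ → ℝ≥0∞, ∀ k x, H k x =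
      liminfPartialSum a (fun z w => ‖w * (q k).eval z‖ₑ ^ p) (fun n => ζ n x.1)
        (circlePoint x.2.1 x.2.2) := ⟨_, fun _ _ => rfl⟩
  have hH : ∀ k, Measurable (H k) := fun k => by
    rw [funext (hHdef k)]
    exact measurable_liminfPartialSum (a := a) hm (hh k)
  refine ⟨fun ω => ⨆ k, ‖(a 0 : ℂ) * ζ 0 ω * (q k).eval 0‖ₑ /
    (∫⁻ x, H k (ω, x) ∂ν) ^ (1 / p), ?_, ?_⟩
  · refine Measurable.iSup fun k => Measurable.div ?_ ((hH k).lintegral_prod_right'.pow_const _)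
    exact (((hm 0).const_mul _).mul_const _).enorm
  · filter_upwards [ae_convergesOn ha hR hm hζ] with ω hω
    refine iSup_congr fun k => ?_
    have hHω : Measurable fun x => H k (ω, x) := (hH k).comp measurable_prodMk_left
    rw [gaf_zero, normA_eq]
    congr 2
    rw [lintegral_prod _ hHω.aemeasurable]
    refine setLIntegral_congr_fun (measurableSet_radii _) fun r hr => lintegral_congr fun θ => ?_
    rw [hHdef]
    refine (hω.liminfPartialSum_eq (circlePoint_mem_disc htR hr θ)
      (h := fun z w => ‖w * (q k).eval z‖ₑ ^ p) ?_).symm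
    exact (ENNReal.continuous_rpow_const (y := p)).comp (by fun_prop)

theorem aemeasurable_sSup_ratios_of_lt [IsProbabilityMeasure P] (ha : ∀ n, 0 ≤ a n) (ha0 : a 0 ≠ 0)
    (hR : R⁻¹ = limsup (fun n : ℕ => ENNReal.ofReal (a n ^ (1 / (n : ℝ)))) atTop)
    (hm : ∀ n, Measurable (ζ n)) (hζ : ∀ n, P.map (ζ n) = stdComplexGaussian)
    (hind : iIndepFun ζ P) {μ : Measure ℝ} [IsFiniteMeasure μ] {p : ℝ} (hp : 0 < p) {t : ℝ}
    (ht : 0 < t) (htR : ENNReal.ofReal t < R) :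
    AEMeasurable (fun ω => sSup (ratios μ p R (ENNReal.ofReal t) (gaf a fun n => ζ n ω))) P := by
  obtain ⟨q, hq⟩ := exists_dense_polynomials ht.le
  refine (aemeasurable_polySup (μ := μ) (p := p) ha hR hm hζ htR q).congr ?_
  filter_upwards [ae_convergesOn ha hR hm hζ, ae_ne_zero hm hζ 0,
    ae_gaf_ne_zero ha ha0 hR hm hζ hind ht.le htR] with ω hω hω0 hnz
  exact (sSup_ratios_eq_polySup hp ht hq htR hω.analyticOnNhd (gaf_zero_ne_zero ha0 hω0) hnz).symm

theorem aemeasurable_sSup_ratios_self [IsProbabilityMeasure P] (ha : ∀ n, 0 ≤ a n) (ha0 : a 0 ≠ 0)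
    (hR : R⁻¹ = limsup (fun n : ℕ => ENNReal.ofReal (a n ^ (1 / (n : ℝ)))) atTop)
    (hm : ∀ n, Measurable (ζ n)) (hζ : ∀ n, P.map (ζ n) = stdComplexGaussian)
    (hind : iIndepFun ζ P) {μ : Measure ℝ} [IsFiniteMeasure μ] {p : ℝ} (hp : 0 < p) (hR0 : 0 < R)
    (hμ : ChargesBoundary μ R) (hatom : μ {r : ℝ | ENNReal.ofReal r = R} = 0) :
    AEMeasurable (fun ω => sSup (ratios μ p R R (gaf a fun n => ζ n ω))) P := by
  obtain ⟨t, -, ht, htR, hlim⟩ := exists_seq_ofReal_tendsto hR0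
  simp only [sSup_ratios_eq_iInf hp hR0 hμ hatom htR hlim]
  exact AEMeasurable.iInf fun n =>
    aemeasurable_sSup_ratios_of_lt ha ha0 hR hm hζ hind hp (ht n) (htR n)

/-- The supremum for `R` is at most that for each smaller radius, and the bounds converge by
monotone convergence. -/
theorem lintegral_sSup_ratios_self_le [IsProbabilityMeasure P] (ha : ∀ n, 0 ≤ a n) (ha0 : a 0 ≠ 0)
    (hR : R⁻¹ = limsup (fun n : ℕ => ENNReal.ofReal (a n ^ (1 / (n : ℝ)))) atTop)
    (hm : ∀ n, Measurable (ζ n)) (hζ : ∀ n, P.map (ζ n) = stdComplexGaussian)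
    (hind : iIndepFun ζ P) {μ : Measure ℝ} [IsFiniteMeasure μ] {p : ℝ} (hp : 0 < p) (hR0 : 0 < R)
    (hatom : μ {r : ℝ | ENNReal.ofReal r = R} = 0) :
    ∫⁻ ω, sSup (ratios μ p R R (gaf a fun n => ζ n ω)) ∂P ≤
      ENNReal.ofReal (Real.sqrt Real.pi * a 0) /
        (∫⁻ r in radii R, coeffNorm a r ^ p ∂μ) ^ (1 / p) := by
  obtain ⟨t, htm, ht, htR, hlim⟩ := exists_seq_ofReal_tendsto hR0
  refine ge_of_tendsto' (ENNReal.Tendsto.const_div ((ENNReal.continuous_rpow_const.tendsto _).comp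
    (tendsto_setLIntegral_radii hatom htm htR hlim fun r => coeffNorm a r ^ p))
      (Or.inr ENNReal.ofReal_ne_top)) fun n => ?_
  refine le_trans (lintegral_mono fun ω => sSup_le fun x hx => ?_)
    (lintegral_sSup_ratios_le_of_lt ha ha0 hR hm hζ hind hp (htR n))
  obtain ⟨y, hy, hxy⟩ := ratios_le_of_le hp (htR n).le hx
  exact hxy.trans (le_sSup hy)

theorem ae_isGreatest_ratios_of_lt [IsProbabilityMeasure P] (ha : ∀ n, 0 ≤ a n) (ha0 : a 0 ≠ 0)
    (hR : R⁻¹ = limsup (fun n : ℕ => ENNReal.ofReal (a n ^ (1 / (n : ℝ)))) atTop)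
    (hm : ∀ n, Measurable (ζ n)) (hζ : ∀ n, P.map (ζ n) = stdComplexGaussian)
    (hind : iIndepFun ζ P) {μ : Measure ℝ} [IsFiniteMeasure μ] {p : ℝ} (hp : 0 < p) {t : ℝ}
    (ht : 0 < t) (htR : ENNReal.ofReal t < R) (hμ : ChargesBoundary μ (ENNReal.ofReal t))
    (hatom : μ {r : ℝ | ENNReal.ofReal r = ENNReal.ofReal t} = 0) :
    ∀ᵐ ω ∂P, IsGreatest (ratios μ p (ENNReal.ofReal t) (ENNReal.ofReal t) (gaf a fun n => ζ n ω))
      (sSup (ratios μ p R (ENNReal.ofReal t) (gaf a fun n => ζ n ω))) := by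
  obtain ⟨q, hq⟩ := exists_dense_polynomials ht.le
  filter_upwards [ae_convergesOn ha hR hm hζ, ae_ne_zero hm hζ 0,
    ae_gaf_ne_zero ha ha0 hR hm hζ hind ht.le htR] with ω hω hω0 hnz
  have hF0 := gaf_zero_ne_zero (c := fun n => ζ n ω) ha0 hω0
  rw [sSup_ratios_eq_polySup hp ht hq htR hω.analyticOnNhd hF0 hnz,
    ← sSup_ratios_eq_polySup_of_ne hp ht hq htR hω.analyticOnNhd hF0 hnz hatom]
  exact isGreatest_ratios hp (ENNReal.ofReal_pos.2 ht) hμ hatom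
    (hω.analyticOnNhd.mono (disc_mono htR.le)) hF0

theorem ae_isGreatest_ratios_self (ha : ∀ n, 0 ≤ a n) (ha0 : a 0 ≠ 0)
    (hR : R⁻¹ = limsup (fun n : ℕ => ENNReal.ofReal (a n ^ (1 / (n : ℝ)))) atTop)
    (hm : ∀ n, Measurable (ζ n)) (hζ : ∀ n, P.map (ζ n) = stdComplexGaussian)
    {μ : Measure ℝ} [IsFiniteMeasure μ] {p : ℝ} (hp : 0 < p) (hR0 : 0 < R)
    (hμ : ChargesBoundary μ R) (hatom : μ {r : ℝ | ENNReal.ofReal r = R} = 0) :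
    ∀ᵐ ω ∂P, IsGreatest (ratios μ p R R (gaf a fun n => ζ n ω))
      (sSup (ratios μ p R R (gaf a fun n => ζ n ω))) := by
  filter_upwards [ae_convergesOn ha hR hm hζ, ae_ne_zero hm hζ 0] with ω hω hω0
  exact isGreatest_ratios hp hR0 hμ hatom hω.analyticOnNhd (gaf_zero_ne_zero ha0 hω0)

/-- The theorem for measurable variables. -/
theorem sSup_ratios_properties [IsProbabilityMeasure P] (ha : ∀ n, 0 ≤ a n) (ha0 : a 0 ≠ 0)
    (hR : R⁻¹ = limsup (fun n : ℕ => ENNReal.ofReal (a n ^ (1 / (n : ℝ)))) atTop)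
    (hm : ∀ n, Measurable (ζ n)) (hζ : ∀ n, P.map (ζ n) = stdComplexGaussian)
    (hind : iIndepFun ζ P) {μ : Measure ℝ} [IsFiniteMeasure μ] (hμR : outerRadius μ = R)
    (hμatom : μ {r : ℝ | ENNReal.ofReal r = R} = 0) {p : ℝ} (hp : 0 < p) {s : ℝ≥0∞} (hs0 : 0 < s)
    (hsR : s ≤ R) :
    AEMeasurable (fun ω => sSup (ratios μ p R s (gaf a fun n => ζ n ω))) P ∧
    ∫⁻ ω, sSup (ratios μ p R s (gaf a fun n => ζ n ω)) ∂P ≤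
      ENNReal.ofReal (Real.sqrt Real.pi * a 0) /
        (∫⁻ r in radii s, coeffNorm a r ^ p ∂μ) ^ (1 / p) ∧
    (s = R → ∀ᵐ ω ∂P, IsGreatest (ratios μ p R s (gaf a fun n => ζ n ω))
      (sSup (ratios μ p R s (gaf a fun n => ζ n ω)))) ∧
    (outerRadius (μ.restrict (radii s)) = s → μ {r : ℝ | ENNReal.ofReal r = s} = 0 →
      ∀ᵐ ω ∂P, IsGreatest (ratios μ p s s (gaf a fun n => ζ n ω))
        (sSup (ratios μ p R s (gaf a fun n => ζ n ω)))) := by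
  rcases hsR.eq_or_lt with rfl | hlt
  · have hμ := chargesBoundary_of_outerRadius hμR hμatom
    have hmax := ae_isGreatest_ratios_self (μ := μ) ha ha0 hR hm hζ hp hs0 hμ hμatom
    exact ⟨aemeasurable_sSup_ratios_self ha ha0 hR hm hζ hind hp hs0 hμ hμatom,
      lintegral_sSup_ratios_self_le ha ha0 hR hm hζ hind hp hs0 hμatom, fun _ => hmax,
      fun _ _ => hmax⟩
  · obtain ⟨t, ht, rfl⟩ : ∃ t, 0 < t ∧ ENNReal.ofReal t = s :=
      ⟨s.toReal, ENNReal.toReal_pos hs0.ne' hlt.ne_top, ENNReal.ofReal_toReal hlt.ne_top⟩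
    refine ⟨aemeasurable_sSup_ratios_of_lt ha ha0 hR hm hζ hind hp ht hlt,
      lintegral_sSup_ratios_le_of_lt ha ha0 hR hm hζ hind hp hlt, fun h => absurd h hlt.ne,
      fun hout hatom => ?_⟩
    -- The outer radius is that of `μ` restricted to radii up to `s`; the mass found there is also
    -- mass of `μ`.
    have hμ := (chargesBoundary_of_outerRadius hout
      (le_antisymm ((Measure.restrict_apply_le _ _).trans hatom.le) bot_le)).mono
        Measure.restrict_le_self
    exact ae_isGreatest_ratios_of_lt ha ha0 hR hm hζ hind hp ht hlt hμ hatom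

end Random

end GAF

theorem theoremt {Ω : Type*} [MeasurableSpace Ω] (P : Measure Ω) [IsProbabilityMeasure P]
    (a : ℕ → ℝ) (ha : ∀ n, 0 ≤ a n) (ha0 : a 0 ≠ 0)
    (R : ℝ≥0∞)
    (hR : R⁻¹ = limsup (fun n : ℕ => ENNReal.ofReal (a n ^ (1 / (n : ℝ)))) atTop)
    (hfin : limsup (fun n : ℕ => ENNReal.ofReal (a n ^ (1 / (n : ℝ)))) atTop < ∞)
    (ζ : ℕ → Ω → ℂ) (hζ : ∀ n, HasLaw (ζ n) GAF.stdComplexGaussian P) (hind : iIndepFun ζ P)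
    (μ : Measure ℝ) [IsFiniteMeasure μ] (hμpos : μ (Set.Iic 0) = 0)
    (hμR : GAF.outerRadius μ = R) (hμatom : μ {r : ℝ | ENNReal.ofReal r = R} = 0)
    (p : ℝ) (hp : 0 < p) (s : ℝ≥0∞) (hs0 : 0 < s) (hsR : s ≤ R) :
    -- the supremum over the nonzero functions analytic on `{|z| < R}` is a random variable,
    AEMeasurable (fun ω => sSup (GAF.ratios μ p R s (GAF.gaf a fun n => ζ n ω))) P ∧
    -- its expectation satisfies the bound,
    ∫⁻ ω, sSup (GAF.ratios μ p R s (GAF.gaf a fun n => ζ n ω)) ∂P ≤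
      ENNReal.ofReal (Real.sqrt Real.pi * a 0) /
        (∫⁻ r in GAF.radii s, GAF.coeffNorm a r ^ p ∂μ) ^ (1 / p) ∧
    -- it is almost surely a maximum if `s = R`,
    (s = R → ∀ᵐ ω ∂P,
      IsGreatest (GAF.ratios μ p R s (GAF.gaf a fun n => ζ n ω))
        (sSup (GAF.ratios μ p R s (GAF.gaf a fun n => ζ n ω)))) ∧
    -- and for every `s` that is the outer radius of the restriction of `μ` to `(0, s]`, and not an
    -- atom, it is almost surely the maximum over the nonzero functions analytic on `{|z| < s}`.
    (GAF.outerRadius (μ.restrict (GAF.radii s)) = s → μ {r : ℝ | ENNReal.ofReal r = s} = 0 →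
      ∀ᵐ ω ∂P,
        IsGreatest (GAF.ratios μ p s s (GAF.gaf a fun n => ζ n ω))
          (sSup (GAF.ratios μ p R s (GAF.gaf a fun n => ζ n ω)))) := by
  -- A law only presupposes almost everywhere measurability; the measurable versions agree with all
  -- `ζ n` at once outside a null set.
  set ξ : ℕ → Ω → ℂ := fun n => (hζ n).aemeasurable.mk with hξ
  have hξm : ∀ n, Measurable (ξ n) := fun n => (hζ n).aemeasurable.measurable_mk
  have hae : ∀ n, ζ n =ᵐ[P] ξ n := fun n => (hζ n).aemeasurable.ae_eq_mk
  have hlaw : ∀ n, P.map (ξ n) = GAF.stdComplexGaussian := fun n => by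
    rw [← Measure.map_congr (hae n), (hζ n).map_eq]
  have heq : ∀ᵐ ω ∂P, (fun n => ξ n ω) = fun n => ζ n ω := by
    filter_upwards [ae_all_iff.2 hae] with ω hω
    exact funext fun n => (hω n).symm
  obtain ⟨h1, h2, h3, h4⟩ := GAF.sSup_ratios_properties ha ha0 hR hξm hlaw (hind.congr hae) hμR
    hμatom hp hs0 hsR
  refine ⟨h1.congr ?_, (lintegral_congr_ae ?_).trans_le h2, fun h => ?_, fun hout hatom => ?_⟩
  · filter_upwards [heq] with ω hω
    rw [hω]
  · filter_upwards [heq] with ω hω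
    rw [hω]
  · filter_upwards [heq, h3 h] with ω hω hmax
    rwa [hω] at hmax
  · filter_upwards [heq, h4 hout hatom] with ω hω hmax
    rwa [hω] at hmax
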